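/- Let $X$ be a compact convex polyhedron with nonempty interior in $\mathbb H^3$ (hyperboloid model in Minkowski space $\mathbb R^{3,1}$). Its Gaussian image $X^*$ is the surface in de Sitter space formed by the outward unit normals of the supporting planes of $X$. It is tiled by the spherical polygons dual to the vertices of $X$; the tile sides are the great-circle arcs dual to the edges of $X$, with length the exterior dihedral angle; the tile corners are the normals of the faces of $X$, and these are the cone points of the intrinsic metric. For a closed curve in $X^*$ made of dual arcs, the geodesic curvature at a cone point is $\max(0,\pi-\theta)$, where $\theta$ is the smaller of the angles of the two sectors of $X^*$ between the incoming and the outgoing arc. The geodesic curvature of the curve is the sum of these contributions over its corners. **Theorem.** For every $N$ there is $\rho_0=\rho_0(N)$ such that the following holds for every compact convex polyhedron $X\subset\mathbb H^3$ with nonempty interior, with $N$ vertices and with diameter $\rho\ge\rho_0$. There is a segment $D=[a,b]$ with $a,b\in X$ and $d(a,b)=\rho$. For every such $D$, let $p_1=a,p_2,\dots,p_N=b$ be equally spaced on $D$. Then there is an index $i<N$ such that no vertex of $X$ lies strictly between the planes $P^-$ and $P^+$ orthogonal to $D$ at $p_i$ and $p_{i+1}$. For every such $i$, let $P$ be the plane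 orthogonal to $D$ at the midpoint of $p_ip_{i+1}$. The faces of $X$ that meet $P$ can be listed, each exactly once, as a cyclic sequence $F_1,\dots,F_k$ with $k\ge 3$ (indices mod $k$), such that $F_j$ and $F_{j+1}$ share an edge $e_j$ that meets $P$, and: 1. the sum of the exterior dihedral angles at $e_1,\dots,e_k$ is smaller than $2\pi+12N\exp(-\rho/(2N))$; 2. the arcs dual to $e_1,\dots,e_k$ form a closed curve in the Gaussian image of $X$, passing through the normals of $F_1,\dots,F_k$; 3. the geodesic curvature of this curve is at most $3k\exp(-\rho/N)$, i.e. the curve is a quasigeodesic with this bound on its geodesic curvature. The same bound holds for $\sum_j\gamma_j$, where $\gamma_j$ is the angle of intersection of the lines containing $e_{j-1}$ and $e_j$ (and $\gamma_j=0$ if these lines do not meet). -/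

import Mathlib

namespace Hyp3

/-- The ambient space of the hyperboloid model. -/
abbrev E : Type := Fin 4 → ℝ

/-- The Minkowski scalar product on `ℝ⁴`. -/
def mink (x y : E) : ℝ := -(x 0 * y 0) + x 1 * y 1 + x 2 * y 2 + x 3 * y 3

/-- Hyperbolic 3-space: the upper sheet of the hyperboloid `⟨x, x⟩ = -1`. -/
def H3 : Set E := {x | mink x x = -1 ∧ 0 < x 0}

/-- The hyperbolic distance. -/
noncomputable def hdist (x y : E) : ℝ := Real.arcosh (-mink x y)

/-- The hyperbolic convex hull of a set of points of the hyperboloid: the radial projection to the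
hyperboloid of the affine convex hull. -/
def hypHull (S : Set E) : Set E := {x | x ∈ H3 ∧ ∃ r : ℝ, 0 < r ∧ r • x ∈ convexHull ℝ S}

/-- A compact convex polyhedron in hyperbolic 3-space, with nonempty interior, given by its set of
vertices. -/
structure ConvexPolyhedron where
  /-- the vertices -/
  vertices : Finset E
  mem_H3 : ∀ v ∈ vertices, v ∈ H3
  /-- every vertex is an extreme point -/
  extreme : ∀ v ∈ vertices, v ∉ hypHull {w | w ∈ vertices ∧ w ≠ v}
  /-- the vertices do not lie in one hyperbolic plane -/
  full : Submodule.span ℝ (vertices : Set E) = ⊤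

namespace ConvexPolyhedron

/-- The polyhedron as a set of points of hyperbolic space. -/
def carrier (X : ConvexPolyhedron) : Set E := hypHull (X.vertices : Set E)

/-- The diameter of the polyhedron. -/
noncomputable def diam (X : ConvexPolyhedron) : ℝ :=
  sSup {d | ∃ x ∈ X.carrier, ∃ y ∈ X.carrier, d = hdist x y}

/-- A two-dimensional face, encoded by its outward unit normal: the plane `⟨normal, x⟩ = 0`
supports the polyhedron and is spanned by the vertices that it contains. -/
@[ext] structure Face (X : ConvexPolyhedron) where
  /-- the outward unit normal, a point of de Sitter space -/
  normal : E
  unit : mink normal normal = 1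
  supporting : ∀ v ∈ X.vertices, mink normal v ≤ 0
  dim : Module.finrank ℝ
    (Submodule.span ℝ {v : E | v ∈ X.vertices ∧ mink normal v = 0}) = 3

variable {X : ConvexPolyhedron}

/-- The face as a set of points of hyperbolic space. -/
def Face.carrier (F : X.Face) : Set E := {x | x ∈ X.carrier ∧ mink F.normal x = 0}

/-- Two faces share an edge: their common vertices span a (hyperbolic) line. The edge is then
`F.carrier ∩ G.carrier`. -/
def Face.Adj (F G : X.Face) : Prop :=
  Module.finrank ℝ (Submodule.span ℝ
    {v : E | v ∈ X.vertices ∧ mink F.normal v = 0 ∧ mink G.normal v = 0}) = 2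

/-- The exterior dihedral angle at the edge shared by two adjacent faces. -/
noncomputable def extDihedral (F G : X.Face) : ℝ := Real.arccos (mink F.normal G.normal)

/-! ### The Gaussian image

The Gaussian image (polar dual) of `X` is the surface in de Sitter space formed by the outward unit
normals of all supporting planes. It is tiled by the spherical polygons dual to the vertices `v`
of `X` (the normals orthogonal to `v`, lying in a round unit 2-sphere). The sides of the tiles are
the great-circle arcs dual to the edges of `X`, of length the exterior dihedral angle; the corners
of the tiles, which are the cone points of the intrinsic metric, are the normals of the faces. -/

/-- The Gaussian image of the polyhedron. -/
def gaussianImage (X : ConvexPolyhedron) : Set E :=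
  {n | mink n n = 1 ∧ (∀ x ∈ X.carrier, mink n x ≤ 0) ∧ ∃ x ∈ X.carrier, mink n x = 0}

/-- The arc dual to the edge shared by `F` and `G`: the great-circle arc from the normal of `F` to
the normal of `G`, parametrized by `[0, 1]`. -/
noncomputable def dualArc (F G : X.Face) (s : ℝ) : E :=
  let w : E := (1 - s) • F.normal + s • G.normal
  (Real.sqrt (mink w w))⁻¹ • w

/-- The direction at the point `F.normal` of the arc dual to the edge shared by `F` and `G` (not
normalized). As a vector of the tangent space `F.normal^⊥` it is also a positive multiple of the
outward normal, within the plane of `F`, of the line containing that edge. -/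
def direction (F G : X.Face) : E := G.normal - mink F.normal G.normal • F.normal

/-- The angle at the point `F.normal` between the arcs towards `G.normal` and `G'.normal`.
If the planes of `F`, `G`, `G'` have a common point, this is the angle in the round sphere dual
to that point; if the lines `F ∩ G` and `F ∩ G'` bounding `F` do not meet,
`Real.arccos` returns `π`. -/
noncomputable def dualAngle (F G G' : X.Face) : ℝ :=
  Real.arccos (mink (direction F G) (direction F G') /
    Real.sqrt (mink (direction F G) (direction F G) * mink (direction F G') (direction F G')))

/-- `LinkPath F G G' ℓ`: in the link of the Gaussian image at the point `F.normal` there is an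
edge path of length `ℓ` from the direction of `G.normal` to the direction of `G'.normal`. That link
is a circle: its nodes are the arcs dual to the edges of `F`; its edges are the corners at
`F.normal` of the tiles dual to the vertices `v` of `F`, each of length the angle of the corner,
joining the two edges of `F` that meet at `v`. -/
inductive LinkPath (F : X.Face) : X.Face → X.Face → ℝ → Prop
  | nil (G : X.Face) (hG : F.Adj G) : LinkPath F G G 0
  | cons (G G' G'' : X.Face) (ℓ : ℝ) (v : E) (hG : F.Adj G) (hG' : F.Adj G') (hne : G ≠ G')
      (hv : v ∈ X.vertices) (hF : mink F.normal v = 0) (hvG : mink G.normal v = 0)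
      (hvG' : mink G'.normal v = 0) (h : LinkPath F G' G'' ℓ) :
      LinkPath F G G'' (dualAngle F G G' + ℓ)

/-- The distance, in the link of the Gaussian image at `F.normal`, between the directions of two
dual arcs: the smaller of the angles of the two sectors into which the arcs divide the surface near
`F.normal`. -/
noncomputable def linkDist (F G G' : X.Face) : ℝ := sInf {ℓ | LinkPath F G G' ℓ}

/-- The geodesic curvature concentrated at the cone point `F.normal` of a curve that arrives along
the arc from `G.normal` and leaves along the arc to `G'.normal`: the amount by which the smaller
sector falls short of `π`, and `0` if both sectors have angle at least `π` (the curve is then a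
local geodesic there). -/
noncomputable def turning (G F G' : X.Face) : ℝ := max 0 (Real.pi - linkDist F G G')

/-- The angle of intersection of the lines containing the edges `G ∩ F` and `F ∩ G'` of `F`, and
`0` if these lines do not meet. -/
noncomputable def edgeLineAngle (G F G' : X.Face) : ℝ := Real.pi - dualAngle F G G'

/-- The arcs dual to the consecutive edges of a cyclic sequence of faces form a closed curve in
the Gaussian image. -/
def IsCurveInGaussianImage {k : ℕ} (F : Fin k → X.Face) : Prop :=
  ∀ i, dualArc (F i) (F (finRotate k i)) 0 = (F i).normal ∧
    dualArc (F i) (F (finRotate k i)) 1 = (F (finRotate k i)).normal ∧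
    ContinuousOn (dualArc (F i) (F (finRotate k i))) (Set.Icc 0 1) ∧
    Set.MapsTo (dualArc (F i) (F (finRotate k i))) (Set.Icc 0 1) X.gaussianImage

/-- The (total) geodesic curvature of the closed curve formed by the dual arcs of a cyclic sequence
of faces. The arcs are geodesic, so only the corners contribute. -/
noncomputable def geodesicCurvature {k : ℕ} (F : Fin k → X.Face) : ℝ :=
  ∑ i, turning (F ((finRotate k).symm i)) (F i) (F (finRotate k i))

/-! ### The cycle of faces around a vertex-free slab -/

/-- The segment from `a` to `b` is a diameter of the polyhedron. -/
def IsDiameter (X : ConvexPolyhedron) (a b : E) : Prop :=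
  a ∈ X.carrier ∧ b ∈ X.carrier ∧ hdist a b = X.diam

end ConvexPolyhedron

/-- The unit normal, pointing from `a` to `b`, of the plane orthogonal to the geodesic from `a` to
`b` at the point at distance `s` from `a`. With `u` the unit tangent vector at `a` towards `b`, the
geodesic is `cosh s • a + sinh s • u`, and this is its velocity. -/
noncomputable def orthNormal (a b : E) (s : ℝ) : E :=
  Real.sinh s • a +
    Real.cosh s • ((Real.sinh (hdist a b))⁻¹ • (b - Real.cosh (hdist a b) • a))

namespace ConvexPolyhedron

variable {X : ConvexPolyhedron}

/-- No vertex of the polyhedron lies strictly between the planes orthogonal to the geodesic from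
`a` to `b` at distances `s` and `s'` from `a`. -/
def VertexFree (X : ConvexPolyhedron) (a b : E) (s s' : ℝ) : Prop :=
  ∀ v ∈ X.vertices, ¬ (0 < mink (orthNormal a b s) v ∧ mink (orthNormal a b s') v < 0)

/-- `F` lists, once each, the faces that meet the plane with normal `m`, in such a cyclic order
that consecutive faces share an edge that meets this plane. -/
def IsTransverseCycle {k : ℕ} (F : Fin k → X.Face) (m : E) : Prop :=
  3 ≤ k ∧ Function.Injective F ∧
    (∀ G : X.Face, (∃ i, F i = G) ↔ ∃ x ∈ G.carrier, mink m x = 0) ∧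
    ∀ i, (F i).Adj (F (finRotate k i)) ∧
      ∃ x ∈ (F i).carrier ∩ (F (finRotate k i)).carrier, mink m x = 0

end ConvexPolyhedron

end Hyp3

/-!
The diameter `D` has length `ρ` and its endpoints are vertices, because the distance to a point has
no maximum in a polyhedron outside the vertices. The other `N - 2` vertices cannot meet all of the
`N - 1` open slabs that the division points cut out (`IsDiameter.exists_vertexFree`).

Let `S` be a slab without vertices, of half-width `h = ρ / (2 (N - 1))`, with middle plane `P` and
center `c = P ∩ D`. Edges that meet `P` cross the whole slab. Hence the faces that meet `P` are the
sides of the polygon `X ∩ P`, and consecutive sides come from faces that share a crossing edge. The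
cyclic order of the sides of a polygon is found by rotating a supporting line
(`exists_rotated_support`, `exists_cyclic_order`, `exists_cyclic_order_sides`); the outward normals
of the sides, read in the projective chart of `P` centered at `c`, turn by `2 π` altogether
(`IsEmptySlab.exists_cycle`).

* Dihedral angles. Seen from `c`, the vertices beyond the slab are within `1 / cosh h` of the line
  of `D`, so the normal of a face that crosses the slab is orthogonal to this line up to
  `O(1 / sinh h)` (`IsEmptySlab.normal_components_le`). The exterior dihedral angle therefore
  exceeds the angle of the two normals within `P` by at most `6 / sinh h`
  (`IsEmptySlab.extDihedral_le`).
* Geodesic curvature. A path in the link of the Gaussian image at the normal of a face `F` is a walk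
  along the boundary of `F`, whose length is a sum of exterior angles of `F`. A simple walk
  from one crossing edge to another one stays on one side of the slab, as `F` has only two crossing
  edges. Since the angle sum of hyperbolic triangles is at most `π`, the length is at least `π`
  minus the angle under which the far ends of the two edges are seen from across the slab
  (`sum_exterior_angle_ge`), and this angle is at most `2 / sinh (2 h)`
  (`hangle_le_across_slab`). This gives `IsEmptySlab.turning_le`.
* Intersection angles. If the lines of two crossing edges of a face meet, they do so outside the
  slab, and from the point of intersection the far ends of the edges are again seen under an angle
  of at most `2 / sinh (2 h)` (`IsEmptySlab.edgeLineAngle_le`).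

There are at most `2 ^ N` faces, and `h` exceeds `ρ / (2 N)` by a positive multiple of `ρ`, so for
large `ρ` the constants in these bounds are absorbed by the exponentials of the theorem.
-/

namespace Hyp3

open Finset

/-! ### The Minkowski product -/

theorem mink_comm (x y : E) : mink x y = mink y x := by simp only [mink]; ring

theorem mink_add_left (x y z : E) : mink (x + y) z = mink x z + mink y z := by
  simp only [mink, Pi.add_apply]; ring

theorem mink_add_right (x y z : E) : mink x (y + z) = mink x y + mink x z := by
  simp only [mink, Pi.add_apply]; ring

theorem mink_sub_left (x y z : E) : mink (x - y) z = mink x z - mink y z := by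
  simp only [mink, Pi.sub_apply]; ring

theorem mink_sub_right (x y z : E) : mink x (y - z) = mink x y - mink x z := by
  simp only [mink, Pi.sub_apply]; ring

theorem mink_smul_left (r : ℝ) (x y : E) : mink (r • x) y = r * mink x y := by
  simp only [mink, Pi.smul_apply, smul_eq_mul]; ring

theorem mink_smul_right (r : ℝ) (x y : E) : mink x (r • y) = r * mink x y := by
  simp only [mink, Pi.smul_apply, smul_eq_mul]; ring

theorem mink_neg_left (x y : E) : mink (-x) y = -mink x y := by
  simp only [mink, Pi.neg_apply]; ring

theorem mink_neg_right (x y : E) : mink x (-y) = -mink x y := by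
  simp only [mink, Pi.neg_apply]; ring

theorem mink_zero_left (x : E) : mink 0 x = 0 := by simp [mink]

theorem mink_zero_right (x : E) : mink x 0 = 0 := by simp [mink]

/-- The linear functional `⟨n, ·⟩`. -/
def minkLin (n : E) : E →ₗ[ℝ] ℝ where
  toFun := mink n
  map_add' := mink_add_right n
  map_smul' r x := by simp [mink_smul_right]

@[simp] theorem minkLin_apply (n x : E) : minkLin n x = mink n x := rfl

theorem mink_sum_right {ι : Type*} (s : Finset ι) (n : E) (f : ι → E) :
    mink n (∑ i ∈ s, f i) = ∑ i ∈ s, mink n (f i) := map_sum (minkLin n) f s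

theorem eq_zero_of_mink_eq_zero {n : E} (h : ∀ x, mink n x = 0) : n = 0 := by
  have h0 := h ![1, 0, 0, 0]
  have h1 := h ![0, 1, 0, 0]
  have h2 := h ![0, 0, 1, 0]
  have h3 := h ![0, 0, 0, 1]
  simp [mink] at h0 h1 h2 h3
  ext i
  fin_cases i <;> simp_all

theorem mink_eq_zero_of_mem_span {n x : E} {S : Set E} (h : ∀ v ∈ S, mink n v = 0)
    (hx : x ∈ Submodule.span ℝ S) : mink n x = 0 := by
  have : Submodule.span ℝ S ≤ LinearMap.ker (minkLin n) := by
    rw [Submodule.span_le]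
    intro v hv
    simpa using h v hv
  simpa using this hx

theorem eq_zero_of_span_eq_top {n : E} {S : Set E} (hS : Submodule.span ℝ S = ⊤)
    (h : ∀ v ∈ S, mink n v = 0) : n = 0 :=
  eq_zero_of_mink_eq_zero fun _ => mink_eq_zero_of_mem_span h (hS ▸ Submodule.mem_top)

theorem cauchy3 (a b c x y z : ℝ) :
    (a * x + b * y + c * z) ^ 2 ≤ (a ^ 2 + b ^ 2 + c ^ 2) * (x ^ 2 + y ^ 2 + z ^ 2) := by
  nlinarith [sq_nonneg (a * y - b * x), sq_nonneg (a * z - c * x), sq_nonneg (b * z - c * y)]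

/-- The orthogonal complement of a timelike vector is positive definite. -/
theorem mink_self_pos_of_orth {x w : E} (hx : mink x x < 0) (h : mink x w = 0) (hw : w ≠ 0) :
    0 < mink w w := by
  by_contra hcon
  have hcs := cauchy3 (x 1) (x 2) (x 3) (w 1) (w 2) (w 3)
  simp only [mink] at hx h hcon
  have e : x 1 * w 1 + x 2 * w 2 + x 3 * w 3 = x 0 * w 0 := by linarith
  rw [e] at hcs
  have h1 : x 1 ^ 2 + x 2 ^ 2 + x 3 ^ 2 < x 0 ^ 2 := by linarith
  have h2 : w 1 ^ 2 + w 2 ^ 2 + w 3 ^ 2 ≤ w 0 ^ 2 := by linarith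
  have h3 : w 0 = 0 := by
    by_contra hne
    have hp : 0 < w 0 ^ 2 := by positivity
    have := mul_le_mul_of_nonneg_left h2 (by positivity : 0 ≤ x 1 ^ 2 + x 2 ^ 2 + x 3 ^ 2)
    nlinarith
  rw [h3] at h2
  apply hw
  ext i
  fin_cases i
  · exact h3
  · simp; nlinarith [sq_nonneg (w 1), sq_nonneg (w 2), sq_nonneg (w 3)]
  · simp; nlinarith [sq_nonneg (w 1), sq_nonneg (w 2), sq_nonneg (w 3)]
  · simp; nlinarith [sq_nonneg (w 1), sq_nonneg (w 2), sq_nonneg (w 3)]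

theorem mink_self_nonneg_of_orth {x w : E} (hx : mink x x < 0) (h : mink x w = 0) :
    0 ≤ mink w w := by
  rcases eq_or_ne w 0 with rfl | hw
  · simp [mink]
  · exact (mink_self_pos_of_orth hx h hw).le

/-- The Cauchy–Schwarz inequality in the orthogonal complement of a timelike vector. -/
theorem mink_sq_le_of_orth {x p q : E} (hx : mink x x < 0) (hp : mink x p = 0)
    (hq : mink x q = 0) : mink p q ^ 2 ≤ mink p p * mink q q := by
  rcases eq_or_ne q 0 with rfl | hq0
  · simp [mink]
  have hqq := mink_self_pos_of_orth hx hq hq0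
  have h := mink_self_nonneg_of_orth (w := mink q q • p - mink p q • q) hx (by
    simp [mink_sub_right, mink_smul_right, hp, hq])
  simp only [mink_sub_left, mink_sub_right, mink_smul_left, mink_smul_right, mink_comm q p] at h
  have : 0 ≤ mink q q * (mink p p * mink q q - mink p q ^ 2) := by linarith
  nlinarith [nonneg_of_mul_nonneg_right this hqq]

theorem mink_self_lt_zero {x : E} (hx : x ∈ H3) : mink x x < 0 := by rw [hx.1]; norm_num

/-- A causal vector has the same nonzero sign against all points of hyperbolic space. -/
theorem mul_pos_of_causal {w x y : E} (hw : mink w w ≤ 0) (hw0 : w ≠ 0) (hx : x ∈ H3)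
    (hy : y ∈ H3) : 0 < mink w x * mink w y := by
  have hne : w 0 ≠ 0 := by
    intro h
    apply hw0
    simp only [mink, h] at hw
    ext i
    fin_cases i
    · exact h
    · simp; nlinarith [sq_nonneg (w 1), sq_nonneg (w 2), sq_nonneg (w 3)]
    · simp; nlinarith [sq_nonneg (w 1), sq_nonneg (w 2), sq_nonneg (w 3)]
    · simp; nlinarith [sq_nonneg (w 1), sq_nonneg (w 2), sq_nonneg (w 3)]
  have key : ∀ z ∈ H3, mink w z * w 0 < 0 := by
    intro z hz
    obtain ⟨hz1, hz0⟩ := hz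
    have hcs := cauchy3 (w 1) (w 2) (w 3) (z 1) (z 2) (z 3)
    simp only [mink] at hz1 hw ⊢
    set s := w 1 * z 1 + w 2 * z 2 + w 3 * z 3
    have h1 : w 1 ^ 2 + w 2 ^ 2 + w 3 ^ 2 ≤ w 0 ^ 2 := by linarith
    have h2 : z 1 ^ 2 + z 2 ^ 2 + z 3 ^ 2 = z 0 ^ 2 - 1 := by linarith
    rw [h2] at hcs
    have h0 : 0 < w 0 ^ 2 := by positivity
    have h3 : s ^ 2 < (w 0 * z 0) ^ 2 := by
      have : 0 ≤ z 0 ^ 2 - 1 := by rw [← h2]; positivity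
      nlinarith [mul_le_mul_of_nonneg_right h1 this]
    have h4 : (s * w 0) ^ 2 < (w 0 ^ 2 * z 0) ^ 2 := by nlinarith
    have h5 := (abs_lt_of_sq_lt_sq' h4 (by positivity)).2
    nlinarith
  have h1 := key x hx
  have h2 := key y hy
  have h3 := mul_pos_of_neg_of_neg h1 h2
  have h0 : 0 < w 0 ^ 2 := by positivity
  have : 0 < (mink w x * mink w y) * w 0 ^ 2 := by linarith
  exact pos_of_mul_pos_left this h0.le

theorem mink_lt_zero {x y : E} (hx : x ∈ H3) (hy : y ∈ H3) : mink x y < 0 := by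
  have hx0 : x ≠ 0 := by
    rintro rfl
    exact absurd hx.2 (by simp)
  have := mul_pos_of_causal (mink_self_lt_zero hx).le hx0 hx hy
  rw [hx.1] at this
  linarith

/-- The component of `y` orthogonal to the point `x` of hyperbolic space: a positive multiple of
the unit tangent vector at `x` of the geodesic to `y`. -/
def proj (x y : E) : E := y + mink x y • x

theorem mink_proj_right {x : E} (hx : x ∈ H3) (y : E) : mink x (proj x y) = 0 := by
  simp [proj, mink_add_right, mink_smul_right, hx.1]

theorem mink_proj_proj {x : E} (hx : x ∈ H3) (y z : E) :
    mink (proj x y) (proj x z) = mink y z + mink x y * mink x z := by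
  simp only [proj, mink_add_right, mink_smul_right, mink_add_left, mink_smul_left, hx.1,
    mink_comm y x]
  ring

theorem mink_proj_of_orth {n x : E} (h : mink n x = 0) (y : E) :
    mink n (proj x y) = mink n y := by
  simp [proj, mink_add_right, mink_smul_right, h]

theorem mink_proj_self {x y : E} (hx : x ∈ H3) (hy : y ∈ H3) :
    mink (proj x y) (proj x y) = mink x y ^ 2 - 1 := by
  rw [mink_proj_proj hx, hy.1]; ring

theorem proj_ne_zero {x y : E} (hx : x ∈ H3) (hy : y ∈ H3) (hne : x ≠ y) : proj x y ≠ 0 := by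
  intro h
  have h1 : mink x y ^ 2 = 1 := by
    have := mink_proj_self hx hy
    rw [h, mink_zero_left] at this
    linarith
  have h2 := mink_lt_zero hx hy
  have h3 : mink x y = -1 := by nlinarith
  apply hne
  have h4 : y + mink x y • x = 0 := h
  rw [h3] at h4
  simpa [add_neg_eq_zero, eq_comm] using h4

theorem mink_le_neg_one {x y : E} (hx : x ∈ H3) (hy : y ∈ H3) : mink x y ≤ -1 := by
  have h1 := mink_self_nonneg_of_orth (mink_self_lt_zero hx) (mink_proj_right hx y)
  rw [mink_proj_self hx hy] at h1
  have h2 := mink_lt_zero hx hy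
  nlinarith

theorem mink_lt_neg_one {x y : E} (hx : x ∈ H3) (hy : y ∈ H3) (hne : x ≠ y) :
    mink x y < -1 := by
  have h1 := mink_self_pos_of_orth (mink_self_lt_zero hx) (mink_proj_right hx y)
    (proj_ne_zero hx hy hne)
  rw [mink_proj_self hx hy] at h1
  have h2 := mink_lt_zero hx hy
  nlinarith

theorem ne_smul_of_ne {x y : E} (hx : x ∈ H3) (hy : y ∈ H3) (hne : x ≠ y) (s : ℝ) :
    y ≠ s • x := by
  intro h
  have h1 : mink y y = s ^ 2 * mink x x := by
    rw [h, mink_smul_left, mink_smul_right]; ring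
  rw [hx.1, hy.1] at h1
  have h2 := mink_lt_zero hx hy
  rw [h, mink_smul_right, hx.1] at h2
  have h3 : s = 1 := by nlinarith
  apply hne
  rw [h, h3, one_smul]

/-- A timelike vector that is negative against one point of hyperbolic space is a positive
multiple of a point of hyperbolic space. -/
theorem exists_smul_mem_H3 {x q : E} (hx : x ∈ H3) (hq : mink q q < 0) (hxq : mink x q < 0) :
    ∃ r : ℝ, 0 < r ∧ r • q ∈ H3 := by
  have hs : 0 < √(-mink q q) := Real.sqrt_pos.2 (by linarith)
  refine ⟨(√(-mink q q))⁻¹, inv_pos.2 hs, ?_, ?_⟩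
  · rw [mink_smul_left, mink_smul_right, ← mul_assoc, ← mul_inv,
      Real.mul_self_sqrt (by linarith), inv_neg, neg_mul, inv_mul_cancel₀ hq.ne]
  · have h0 : ![1, 0, 0, 0] ∈ H3 := by constructor <;> simp [mink]
    have hq0 : q ≠ 0 := by
      rintro rfl
      simp [mink] at hq
    have h1 := mul_pos_of_causal hq.le hq0 hx h0
    rw [mink_comm q x] at h1
    have h2 : mink q ![1, 0, 0, 0] < 0 := by nlinarith
    simp [mink] at h2
    simp only [Pi.smul_apply, smul_eq_mul]
    positivity

/-! ### Orthonormal frames -/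

/-- A Lorentz orthonormal basis whose first vector is timelike. -/
structure IsFrame (c e₁ e₂ m : E) : Prop where
  cc : mink c c = -1
  c1 : mink c e₁ = 0
  c2 : mink c e₂ = 0
  cm : mink c m = 0
  e11 : mink e₁ e₁ = 1
  e12 : mink e₁ e₂ = 0
  e1m : mink e₁ m = 0
  e22 : mink e₂ e₂ = 1
  e2m : mink e₂ m = 0
  mm : mink m m = 1

namespace IsFrame

variable {c e₁ e₂ m : E}

theorem eq_zero (h : IsFrame c e₁ e₂ m) {x : E} (h0 : mink c x = 0) (h1 : mink e₁ x = 0)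
    (h2 : mink e₂ x = 0) (h3 : mink m x = 0) : x = 0 := by
  let Φ : E →ₗ[ℝ] E := LinearMap.pi ![minkLin c, minkLin e₁, minkLin e₂, minkLin m]
  have hsurj : Function.Surjective Φ := by
    intro y
    refine ⟨(-y 0) • c + y 1 • e₁ + y 2 • e₂ + y 3 • m, ?_⟩
    have a1 := h.c1; have a2 := h.c2; have a3 := h.cm; have a4 := h.e12; have a5 := h.e1m
    have a6 := h.e2m
    ext i
    fin_cases i
    · simp [Φ, mink_add_right, mink_smul_right, mink_neg_right, h.cc, a1, a2, a3]
    · simp [Φ, mink_add_right, mink_smul_right, mink_neg_right, h.e11, a4, a5, mink_comm e₁ c, a1]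
    · simp [Φ, mink_add_right, mink_smul_right, mink_neg_right, h.e22, a6, mink_comm e₂ c, a2,
        mink_comm e₂ e₁, a4]
    · simp [Φ, mink_add_right, mink_smul_right, mink_neg_right, h.mm, mink_comm m c, a3,
        mink_comm m e₁, a5, mink_comm m e₂, a6]
  have hinj := LinearMap.injective_iff_surjective.2 hsurj
  apply hinj
  ext i
  fin_cases i
  · simp [Φ, h0, mink_zero_right]
  · simp [Φ, h1, mink_zero_right]
  · simp [Φ, h2, mink_zero_right]
  · simp [Φ, h3, mink_zero_right]

theorem expand (h : IsFrame c e₁ e₂ m) (x : E) :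
    x = (-mink c x) • c + mink e₁ x • e₁ + mink e₂ x • e₂ + mink m x • m := by
  rw [← sub_eq_zero]
  have a1 := h.c1; have a2 := h.c2; have a3 := h.cm; have a4 := h.e12; have a5 := h.e1m
  have a6 := h.e2m
  apply h.eq_zero
  · simp [mink_add_right, mink_smul_right, mink_neg_right, mink_sub_right, h.cc, a1, a2, a3]
  · simp [mink_add_right, mink_smul_right, mink_neg_right, mink_sub_right, h.e11, a4, a5,
      mink_comm e₁ c, a1]
  · simp [mink_add_right, mink_smul_right, mink_neg_right, mink_sub_right, h.e22, a6,
      mink_comm e₂ c, a2, mink_comm e₂ e₁, a4]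
  · simp [mink_add_right, mink_smul_right, mink_neg_right, mink_sub_right, h.mm, mink_comm m c, a3,
      mink_comm m e₁, a5, mink_comm m e₂, a6]

theorem mink_eq (h : IsFrame c e₁ e₂ m) (x y : E) :
    mink x y = -(mink c x * mink c y) + mink e₁ x * mink e₁ y + mink e₂ x * mink e₂ y
      + mink m x * mink m y := by
  conv_lhs => rw [h.expand x]
  simp only [mink_add_left, mink_smul_left]
  ring

theorem ext (h : IsFrame c e₁ e₂ m) {x y : E} (h0 : mink c x = mink c y)
    (h1 : mink e₁ x = mink e₁ y) (h2 : mink e₂ x = mink e₂ y) (h3 : mink m x = mink m y) :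
    x = y := by
  rw [h.expand x, h.expand y, h0, h1, h2, h3]

end IsFrame

theorem exists_unit_scale {p : E} (hp : 0 < mink p p) :
    ∃ r : ℝ, 0 < r ∧ r * (r * mink p p) = 1 := by
  refine ⟨(√(mink p p))⁻¹, inv_pos.2 (Real.sqrt_pos.2 hp), ?_⟩
  rw [← mul_assoc, ← mul_inv, Real.mul_self_sqrt hp.le, inv_mul_cancel₀ hp.ne']

theorem exists_mink_unit_orth {k : ℕ} (hk : k < 3) {c : E} (hc : mink c c = -1) (f : Fin k → E) :
    ∃ e : E, mink e e = 1 ∧ mink c e = 0 ∧ ∀ i, mink (f i) e = 0 := by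
  let Φ : E →ₗ[ℝ] (Fin (k + 1) → ℝ) :=
    LinearMap.pi (Fin.cons (minkLin c) (fun i => minkLin (f i)))
  have hker : LinearMap.ker Φ ≠ ⊥ := LinearMap.ker_ne_bot_of_finrank_lt (by
    simp [Module.finrank_fintype_fun_eq_card]; omega)
  obtain ⟨w, hw, hw0⟩ := Submodule.exists_mem_ne_zero_of_ne_bot hker
  have hcw : mink c w = 0 := by
    have := congrFun (LinearMap.mem_ker.1 hw) 0
    simpa [Φ] using this
  have hfw : ∀ i, mink (f i) w = 0 := by
    intro i
    have := congrFun (LinearMap.mem_ker.1 hw) i.succ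
    simpa [Φ] using this
  have hpos := mink_self_pos_of_orth (by rw [hc]; norm_num) hcw hw0
  obtain ⟨r, -, hr⟩ := exists_unit_scale hpos
  refine ⟨r • w, ?_, ?_, ?_⟩
  · rw [mink_smul_left, mink_smul_right, hr]
  · rw [mink_smul_right, hcw, mul_zero]
  · intro i
    rw [mink_smul_right, hfw, mul_zero]

theorem exists_isFrame {c m : E} (hc : mink c c = -1) (hm : mink m m = 1) (hcm : mink c m = 0) :
    ∃ e₁ e₂, IsFrame c e₁ e₂ m := by
  obtain ⟨e₁, h1, h2, h3⟩ := exists_mink_unit_orth (k := 1) (by norm_num) hc ![m]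
  obtain ⟨e₂, h4, h5, h6⟩ := exists_mink_unit_orth (k := 2) (by norm_num) hc ![m, e₁]
  have h7 := h3 0
  have h8 := h6 0
  have h9 := h6 1
  simp at h7 h8 h9
  exact ⟨e₁, e₂, ⟨hc, h2, h5, hcm, h1, h9, mink_comm e₁ m ▸ h7, h4, mink_comm e₂ m ▸ h8, hm⟩⟩

/-! ### Angles -/

/-- The angle between two vectors of a spacelike plane. -/
noncomputable def mangle (p q : E) : ℝ :=
  Real.arccos (mink p q / √(mink p p * mink q q))

/-- The angle at the point `x` between the geodesics to `y` and to `z`. -/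
noncomputable def hangle (x y z : E) : ℝ := mangle (proj x y) (proj x z)

theorem mangle_comm (p q : E) : mangle p q = mangle q p := by
  rw [mangle, mangle, mink_comm p q, mul_comm (mink p p)]

theorem hangle_comm (x y z : E) : hangle x y z = hangle x z y := mangle_comm _ _

theorem mangle_nonneg (p q : E) : 0 ≤ mangle p q := Real.arccos_nonneg _

theorem mangle_smul_left {s : ℝ} (hs : 0 < s) (p q : E) : mangle (s • p) q = mangle p q := by
  have h : √(s * (s * mink p p) * mink q q) = s * √(mink p p * mink q q) := by
    rw [show s * (s * mink p p) * mink q q = s ^ 2 * (mink p p * mink q q) by ring,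
      Real.sqrt_mul (by positivity), Real.sqrt_sq hs.le]
  rw [mangle, mangle]
  simp only [mink_smul_left, mink_smul_right]
  rw [h, mul_div_mul_left _ _ hs.ne']

theorem mangle_smul_right {s : ℝ} (hs : 0 < s) (p q : E) : mangle p (s • q) = mangle p q := by
  rw [mangle_comm, mangle_smul_left hs, mangle_comm]

theorem arccos_le_add {a b c : ℝ} (hb : |b| ≤ 1) (hc : |c| ≤ 1)
    (h : (a - b * c) ^ 2 ≤ (1 - b ^ 2) * (1 - c ^ 2)) :
    Real.arccos a ≤ Real.arccos b + Real.arccos c := by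
  obtain ⟨hb1, hb2⟩ := abs_le.1 hb
  obtain ⟨hc1, hc2⟩ := abs_le.1 hc
  rcases le_total Real.pi (Real.arccos b + Real.arccos c) with h1 | h1
  · exact (Real.arccos_le_pi a).trans h1
  · have h2 : Real.cos (Real.arccos b + Real.arccos c) ≤ a := by
      rw [Real.cos_add, Real.cos_arccos hb1 hb2, Real.cos_arccos hc1 hc2, Real.sin_arccos,
        Real.sin_arccos, ← Real.sqrt_mul (by nlinarith)]
      have := Real.abs_le_sqrt h
      linarith [(abs_le.1 this).1]
    calc Real.arccos a ≤ Real.arccos (Real.cos (Real.arccos b + Real.arccos c)) :=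
          Real.arccos_le_arccos h2
      _ = _ := Real.arccos_cos (add_nonneg (Real.arccos_nonneg _) (Real.arccos_nonneg _)) h1

theorem abs_mink_div_sqrt_le_one {x p q : E} (hx : mink x x < 0) (hp : mink x p = 0)
    (hq : mink x q = 0) : |mink p q / √(mink p p * mink q q)| ≤ 1 := by
  rw [abs_div, abs_of_nonneg (Real.sqrt_nonneg _)]
  apply div_le_one_of_le₀ _ (Real.sqrt_nonneg _)
  exact Real.abs_le_sqrt (mink_sq_le_of_orth hx hp hq)

/-- The triangle inequality for angles between tangent vectors at a point. -/
theorem mangle_triangle {x p q r : E} (hx : mink x x < 0) (hp : mink x p = 0)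
    (hq : mink x q = 0) (hr : mink x r = 0) (hp0 : p ≠ 0) (hq0 : q ≠ 0) (hr0 : r ≠ 0) :
    mangle p r ≤ mangle p q + mangle q r := by
  have hpp := mink_self_pos_of_orth hx hp hp0
  have hqq := mink_self_pos_of_orth hx hq hq0
  have hrr := mink_self_pos_of_orth hx hr hr0
  apply arccos_le_add (abs_mink_div_sqrt_le_one hx hp hq) (abs_mink_div_sqrt_le_one hx hq hr)
  have hg := mink_sq_le_of_orth (p := mink q q • p - mink p q • q)
    (q := mink q q • r - mink q r • q) hx
    (by simp [mink_sub_right, mink_smul_right, hp, hq])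
    (by simp [mink_sub_right, mink_smul_right, hr, hq])
  simp only [mink_sub_left, mink_sub_right, mink_smul_left, mink_smul_right, mink_comm q p,
    mink_comm r q] at hg
  simp only [Real.sqrt_mul hpp.le, Real.sqrt_mul hqq.le]
  have e1 := Real.sq_sqrt hpp.le
  have e2 := Real.sq_sqrt hqq.le
  have e3 := Real.sq_sqrt hrr.le
  have s1 := Real.sqrt_pos.2 hpp
  have s2 := Real.sqrt_pos.2 hqq
  have s3 := Real.sqrt_pos.2 hrr
  set a := √(mink p p)
  set b := √(mink q q)
  set c := √(mink r r)
  have hg' : (mink p r * mink q q - mink p q * mink q r) ^ 2 ≤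
      (mink p p * mink q q - mink p q ^ 2) * (mink q q * mink r r - mink q r ^ 2) := by
    have hq2 : 0 < mink q q ^ 2 := by positivity
    nlinarith
  rw [← e1, ← e2, ← e3] at hg'
  have l : (mink p r / (a * c) - mink p q / (a * b) * (mink q r / (b * c))) ^ 2 =
      (mink p r * b ^ 2 - mink p q * mink q r) ^ 2 / (a * b ^ 2 * c) ^ 2 := by
    field_simp
  have r' : (1 - (mink p q / (a * b)) ^ 2) * (1 - (mink q r / (b * c)) ^ 2) =
      ((a ^ 2 * b ^ 2 - mink p q ^ 2) * (b ^ 2 * c ^ 2 - mink q r ^ 2)) / (a * b ^ 2 * c) ^ 2 := by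
    field_simp
  rw [l, r']
  gcongr

theorem hangle_triangle {x y z w : E} (hx : x ∈ H3) (hy : y ∈ H3) (hz : z ∈ H3) (hw : w ∈ H3)
    (hxy : x ≠ y) (hxz : x ≠ z) (hxw : x ≠ w) : hangle x y w ≤ hangle x y z + hangle x z w :=
  mangle_triangle (mink_self_lt_zero hx) (mink_proj_right hx y) (mink_proj_right hx z)
    (mink_proj_right hx w) (proj_ne_zero hx hy hxy) (proj_ne_zero hx hz hxz)
    (proj_ne_zero hx hw hxw)

theorem mangle_self {p : E} (hp : 0 < mink p p) : mangle p p = 0 := by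
  rw [mangle, Real.sqrt_mul_self hp.le, div_self hp.ne', Real.arccos_one]

theorem hangle_self {x y : E} (hx : x ∈ H3) (hy : y ∈ H3) (hxy : x ≠ y) : hangle x y y = 0 :=
  mangle_self (mink_self_pos_of_orth (mink_self_lt_zero hx) (mink_proj_right hx y)
    (proj_ne_zero hx hy hxy))

theorem hangle_eq {x y z : E} (hx : x ∈ H3) (hy : y ∈ H3) (hz : z ∈ H3) :
    hangle x y z = Real.arccos ((mink y z + mink x y * mink x z) /
      (√(mink x y ^ 2 - 1) * √(mink x z ^ 2 - 1))) := by
  rw [hangle, mangle, mink_proj_proj hx, mink_proj_self hx hy, mink_proj_self hx hz,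
    Real.sqrt_mul]
  have := mink_le_neg_one hx hy
  nlinarith

/-- The second hyperbolic law of cosines, in the form of an inequality: the angles `α`, `β`, `γ` of
a triangle whose sides have hyperbolic cosines `p`, `q`, `r` satisfy `cos (α + β) ≥ -cos γ`. -/
theorem cos_add_le_of_gram {p q r : ℝ} (hp : 1 < p) (hq : 1 < q) (hr : 1 < r)
    (hg : 0 ≤ 1 + 2 * p * q * r - p ^ 2 - q ^ 2 - r ^ 2) :
    -((p * q - r) / (√(p ^ 2 - 1) * √(q ^ 2 - 1))) ≤
      Real.cos (Real.arccos ((q * r - p) / (√(q ^ 2 - 1) * √(r ^ 2 - 1))) +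
        Real.arccos ((p * r - q) / (√(p ^ 2 - 1) * √(r ^ 2 - 1)))) := by
  have hp1 : 0 < p ^ 2 - 1 := by nlinarith
  have hq1 : 0 < q ^ 2 - 1 := by nlinarith
  have hr1 : 0 < r ^ 2 - 1 := by nlinarith
  have e1 := Real.sq_sqrt hp1.le
  have e2 := Real.sq_sqrt hq1.le
  have e3 := Real.sq_sqrt hr1.le
  have s1 := Real.sqrt_pos.2 hp1
  have s2 := Real.sqrt_pos.2 hq1
  have s3 := Real.sqrt_pos.2 hr1
  set a := √(p ^ 2 - 1)
  set b := √(q ^ 2 - 1)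
  set c := √(r ^ 2 - 1)
  set D := 1 + 2 * p * q * r - p ^ 2 - q ^ 2 - r ^ 2 with hD
  have hA : 1 - ((q * r - p) / (b * c)) ^ 2 = D / (b * c) ^ 2 := by
    field_simp
    rw [e2, e3]; ring
  have hB : 1 - ((p * r - q) / (a * c)) ^ 2 = D / (a * c) ^ 2 := by
    field_simp
    rw [e1, e3]; ring
  have hA0 : 0 ≤ 1 - ((q * r - p) / (b * c)) ^ 2 := by rw [hA]; positivity
  have hB0 : 0 ≤ 1 - ((p * r - q) / (a * c)) ^ 2 := by rw [hB]; positivity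
  have hA1 := abs_le.1 ((sq_le_one_iff_abs_le_one _).1 (sub_nonneg.1 hA0))
  have hB1 := abs_le.1 ((sq_le_one_iff_abs_le_one _).1 (sub_nonneg.1 hB0))
  rw [Real.cos_add, Real.cos_arccos hA1.1 hA1.2, Real.cos_arccos hB1.1 hB1.2, Real.sin_arccos,
    Real.sin_arccos, hA, hB, Real.sqrt_div hg, Real.sqrt_div hg,
    Real.sqrt_sq (by positivity), Real.sqrt_sq (by positivity)]
  have h1 : (q * r - p) / (b * c) * ((p * r - q) / (a * c)) - √D / (b * c) * (√D / (a * c))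
      + (p * q - r) / (a * b) = (r - 1) * D / (a * b * c ^ 2) := by
    have e4 := Real.sq_sqrt hg
    field_simp
    rw [e3, e4]
    ring
  have h2 : 0 ≤ (r - 1) * D / (a * b * c ^ 2) := by
    have : 0 ≤ r - 1 := by linarith
    positivity
  linarith

/-- Three angles in `[0, π]` with `cos (a + b) ≥ cos (π - c)`, and likewise after permuting, have
sum at most `π`, unless they are all equal to `π`. -/
theorem add_add_le_pi {a b c : ℝ} (ha : a ∈ Set.Icc 0 Real.pi) (hb : b ∈ Set.Icc 0 Real.pi)
    (hc : c ∈ Set.Icc 0 Real.pi) (hab : -Real.cos c ≤ Real.cos (a + b))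
    (hbc : -Real.cos a ≤ Real.cos (b + c)) (hca : -Real.cos b ≤ Real.cos (c + a))
    (hne : ¬(a = Real.pi ∧ b = Real.pi)) : a + b + c ≤ Real.pi := by
  have key : ∀ {x y z : ℝ}, x ∈ Set.Icc 0 Real.pi → y ∈ Set.Icc 0 Real.pi →
      z ∈ Set.Icc 0 Real.pi → -Real.cos z ≤ Real.cos (x + y) →
      x + y + z ≤ Real.pi ∨ Real.pi + z ≤ x + y := by
    intro x y z hx hy hz h
    rw [← Real.cos_pi_sub] at h
    rcases le_total (x + y) Real.pi with h1 | h1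
    · left
      by_contra hcon
      have := Real.cos_lt_cos_of_nonneg_of_le_pi (x := Real.pi - z) (y := x + y)
        (by linarith [hz.2]) h1 (by linarith)
      linarith
    · right
      by_contra hcon
      rw [← Real.cos_two_pi_sub (x + y)] at h
      have := Real.cos_lt_cos_of_nonneg_of_le_pi (x := Real.pi - z) (y := 2 * Real.pi - (x + y))
        (by linarith [hz.2]) (by linarith) (by linarith)
      linarith
  rcases key ha hb hc hab with h1 | h1
  · exact h1
  rcases key hb hc ha hbc with h2 | h2
  · linarith
  rcases key hc ha hb hca with h3 | h3
  · linarith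
  · exact absurd ⟨le_antisymm ha.2 (by linarith), le_antisymm hb.2 (by linarith)⟩ hne

/-- The angle sum of a hyperbolic triangle is at most `π`. -/
theorem hangle_add_hangle_add_hangle_le {x y z : E} (hx : x ∈ H3) (hy : y ∈ H3) (hz : z ∈ H3)
    (hxy : x ≠ y) (hyz : y ≠ z) (hxz : x ≠ z) :
    hangle x y z + hangle y x z + hangle z x y ≤ Real.pi := by
  have gram : mink y z ^ 2 + mink x z ^ 2 + mink x y ^ 2 +
      2 * mink y z * mink x z * mink x y ≤ 1 := by
    have h := mink_sq_le_of_orth (mink_self_lt_zero hx) (mink_proj_right hx y)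
      (mink_proj_right hx z)
    rw [mink_proj_proj hx, mink_proj_self hx hy, mink_proj_self hx hz] at h
    nlinarith
  have hp := mink_lt_neg_one hy hz hyz
  have hq := mink_lt_neg_one hx hz hxz
  have hr := mink_lt_neg_one hx hy hxy
  obtain ⟨p, hpd⟩ : ∃ p, mink y z = -p := ⟨_, (neg_neg _).symm⟩
  obtain ⟨q, hqd⟩ : ∃ q, mink x z = -q := ⟨_, (neg_neg _).symm⟩
  obtain ⟨r, hrd⟩ : ∃ r, mink x y = -r := ⟨_, (neg_neg _).symm⟩
  rw [hangle_eq hx hy hz, hangle_eq hy hx hz, hangle_eq hz hx hy, mink_comm y x, mink_comm z x,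
    mink_comm z y]
  rw [hpd, hqd, hrd] at gram ⊢
  rw [hpd] at hp
  rw [hqd] at hq
  rw [hrd] at hr
  replace hp : 1 < p := by linarith
  replace hq : 1 < q := by linarith
  replace hr : 1 < r := by linarith
  have hp1 : 0 < p ^ 2 - 1 := by nlinarith
  have hq1 : 0 < q ^ 2 - 1 := by nlinarith
  have hr1 : 0 < r ^ 2 - 1 := by nlinarith
  have s1 := Real.sqrt_pos.2 hp1
  have s2 := Real.sqrt_pos.2 hq1
  have s3 := Real.sqrt_pos.2 hr1
  have e1 := Real.sq_sqrt hp1.le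
  have e2 := Real.sq_sqrt hq1.le
  have e3 := Real.sq_sqrt hr1.le
  have bound : ∀ {p q r : ℝ}, 1 < p → 1 < q → 1 < r →
      p ^ 2 + q ^ 2 + r ^ 2 - 2 * p * q * r ≤ 1 →
      |(q * r - p) / (√(q ^ 2 - 1) * √(r ^ 2 - 1))| ≤ 1 := by
    intro p q r hp hq hr hg
    rw [abs_div, abs_of_nonneg (by positivity : 0 ≤ √(q ^ 2 - 1) * √(r ^ 2 - 1))]
    apply div_le_one_of_le₀ _ (by positivity)
    rw [← Real.sqrt_mul (by nlinarith)]
    apply Real.abs_le_sqrt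
    nlinarith
  have b1 := abs_le.1 (bound hp hq hr (by nlinarith))
  have b2 := abs_le.1 (bound hq hp hr (by nlinarith))
  have b3 := abs_le.1 (bound hr hp hq (by nlinarith))
  have c1 := cos_add_le_of_gram hp hq hr (by nlinarith)
  have c2 := cos_add_le_of_gram hr hp hq (by nlinarith)
  have c3 := cos_add_le_of_gram hr hq hp (by nlinarith)
  simp only [neg_mul_neg, neg_sq]
  rw [show -p + r * q = q * r - p by ring, show -q + r * p = p * r - q by ring,
    show -r + q * p = p * q - r by ring, mul_comm (√(r ^ 2 - 1)) (√(q ^ 2 - 1)),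
    mul_comm (√(r ^ 2 - 1)) (√(p ^ 2 - 1)), mul_comm (√(q ^ 2 - 1)) (√(p ^ 2 - 1))]
  apply add_add_le_pi ⟨Real.arccos_nonneg _, Real.arccos_le_pi _⟩
    ⟨Real.arccos_nonneg _, Real.arccos_le_pi _⟩ ⟨Real.arccos_nonneg _, Real.arccos_le_pi _⟩
  · rwa [Real.cos_arccos b3.1 b3.2]
  · rw [Real.cos_arccos b1.1 b1.2]
    rwa [add_comm, mul_comm p q, mul_comm (√(p ^ 2 - 1)) (√(q ^ 2 - 1)), mul_comm p r,
      mul_comm (√(p ^ 2 - 1)) (√(r ^ 2 - 1)), mul_comm q r,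
      mul_comm (√(q ^ 2 - 1)) (√(r ^ 2 - 1))]
  · rw [Real.cos_arccos b2.1 b2.2]
    rwa [mul_comm p r, mul_comm (√(p ^ 2 - 1)) (√(r ^ 2 - 1)), mul_comm q r,
      mul_comm (√(q ^ 2 - 1)) (√(r ^ 2 - 1))]
  · rintro ⟨h1, h2⟩
    rw [Real.arccos_eq_pi] at h1 h2
    have h3 : q * r - p < 0 := by
      by_contra hcon
      have : 0 ≤ (q * r - p) / (√(q ^ 2 - 1) * √(r ^ 2 - 1)) :=
        div_nonneg (by linarith) (by positivity)
      linarith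
    have h4 : p * r - q < 0 := by
      by_contra hcon
      have : 0 ≤ (p * r - q) / (√(p ^ 2 - 1) * √(r ^ 2 - 1)) :=
        div_nonneg (by linarith) (by positivity)
      linarith
    nlinarith

/-! ### Chains of geodesic segments and visual angles -/

/-- The hyperbolic substitute for the Gauss–Bonnet formula: along a chain of geodesic segments
`v₀ v₁ … vₘ₊₁`, the exterior angles at `v₁, …, vₘ` sum to at least the angle at `v₁` between the
continuation of the first segment and the geodesic to the last point, up to the angle under which
the chain reaches that point. It follows by decomposing into the triangles `v₁ vᵢ vᵢ₊₁`. -/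
theorem sum_exterior_angle_ge_aux {v : ℕ → E} (m : ℕ) (hv : ∀ i ≤ m + 2, v i ∈ H3)
    (h01 : v 0 ≠ v 1) (hne : ∀ i ≤ m, v (i + 1) ≠ v (i + 2)) (h1 : ∀ i ≤ m, v (i + 2) ≠ v 1) :
    Real.pi - hangle (v 1) (v 0) (v (m + 2)) + hangle (v (m + 2)) (v 1) (v (m + 1)) ≤
      ∑ i ∈ range (m + 1), (Real.pi - hangle (v (i + 1)) (v i) (v (i + 2))) := by
  induction m with
  | zero =>
    simp only [zero_add, sum_range_one]
    rw [hangle_self (hv 2 le_rfl) (hv 1 (by omega)) (h1 0 le_rfl)]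
    simp
  | succ m ih =>
    have ih := ih (fun i hi => hv i (by omega)) (fun i hi => hne i (by omega))
      (fun i hi => h1 i (by omega))
    rw [sum_range_succ]
    have H0 := hv 0 (by omega)
    have H1 := hv 1 (by omega)
    have Hm := hv (m + 1) (by omega)
    have Hm2 := hv (m + 2) (by omega)
    have Hm3 := hv (m + 3) (by omega)
    have n1 := h1 m (by omega)
    have n2 : v (m + 3) ≠ v 1 := h1 (m + 1) le_rfl
    have n3 : v (m + 2) ≠ v (m + 3) := hne (m + 1) le_rfl
    have n4 : v (m + 1) ≠ v (m + 2) := hne m (by omega)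
    have t1 := hangle_triangle Hm2 Hm H1 Hm3 n4.symm n1 n3
    have t2 := hangle_triangle H1 H0 Hm3 Hm2 h01.symm n2.symm n1.symm
    have t3 := hangle_add_hangle_add_hangle_le H1 Hm2 Hm3 n1.symm n3 n2.symm
    rw [hangle_comm _ (v (m + 1))] at t1
    rw [hangle_comm _ (v (m + 3)) (v (m + 2))] at t2
    rw [hangle_comm (v (m + 2)) (v (m + 1)) (v 1)] at t1
    rw [show m + 1 + 2 = m + 3 from rfl, show m + 1 + 1 = m + 2 from rfl]
    rw [hangle_comm (v (m + 2)) (v (m + 1)) (v (m + 3))]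
    linarith

theorem sum_exterior_angle_ge {v : ℕ → E} (m : ℕ) (hv : ∀ i ≤ m + 2, v i ∈ H3)
    (h01 : v 0 ≠ v 1) (hne : ∀ i ≤ m, v (i + 1) ≠ v (i + 2)) (h1 : ∀ i ≤ m, v (i + 2) ≠ v 1) :
    Real.pi - hangle (v 1) (v 0) (v (m + 2)) ≤
      ∑ i ∈ range (m + 1), (Real.pi - hangle (v (i + 1)) (v i) (v (i + 2))) := by
  have := sum_exterior_angle_ge_aux m hv h01 hne h1
  have h : 0 ≤ hangle (v (m + 2)) (v 1) (v (m + 1)) := mangle_nonneg _ _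
  linarith

/-- From a point at distance `arsinh σ` from a plane with unit normal `n`, every point beyond the
plane is seen within the angle of parallelism of the perpendicular to the plane. -/
theorem mangle_perpendicular_le {n q b : E} (hn : mink n n = 1) (hq : q ∈ H3) (hb : b ∈ H3)
    (hσ : 0 < mink n q) (hnb : mink n b ≤ 0) :
    mangle (-proj q n) (proj q b) ≤ (mink n q)⁻¹ := by
  set σ := mink n q with hσd
  have hqb : q ≠ b := by rintro rfl; linarith
  have h1 := mink_lt_neg_one hq hb hqb
  have h2 : 0 < mink q b ^ 2 - 1 := by nlinarith
  have hs := Real.sqrt_pos.2 h2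
  have key : Real.arcsin (σ / √(1 + σ ^ 2)) = Real.arctan σ := (Real.arctan_eq_arcsin σ).symm
  have h3 : mangle (-proj q n) (proj q b) ≤ Real.arccos (σ / √(1 + σ ^ 2)) := by
    apply Real.arccos_le_arccos
    have e1 : mink (-proj q n) (proj q b) = -mink n b - σ * mink q b := by
      rw [mink_neg_left, mink_proj_proj hq, mink_comm q n]; ring
    have e2 : mink (-proj q n) (-proj q n) = 1 + σ ^ 2 := by
      rw [mink_neg_left, mink_neg_right, mink_proj_proj hq, mink_comm q n, hn]; ring
    rw [e1, e2, mink_proj_self hq hb, Real.sqrt_mul (by positivity)]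
    rw [div_le_div_iff₀ (by positivity) (by positivity)]
    have h4 : √(mink q b ^ 2 - 1) ≤ -mink q b := by
      apply Real.sqrt_le_iff.2
      constructor
      · linarith
      · nlinarith
    have h5 : σ * √(mink q b ^ 2 - 1) ≤ -mink n b - σ * mink q b := by nlinarith
    have h6 : 0 ≤ √(1 + σ ^ 2) := Real.sqrt_nonneg _
    nlinarith
  refine h3.trans ?_
  rw [Real.arccos, key, ← Real.arctan_inv_of_pos hσ]
  have h7 : 0 < σ⁻¹ := inv_pos.2 hσ
  have h8 := Real.lt_tan (x := Real.arctan σ⁻¹) (Real.arctan_pos.2 h7)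
    (Real.arctan_lt_pi_div_two _)
  rw [Real.tan_arctan] at h8
  exact h8.le

theorem hangle_le_of_beyond_plane {n q b b' : E} (hn : mink n n = 1) (hq : q ∈ H3) (hb : b ∈ H3)
    (hb' : b' ∈ H3) (hσ : 0 < mink n q) (hnb : mink n b ≤ 0) (hnb' : mink n b' ≤ 0) :
    hangle q b b' ≤ 2 * (mink n q)⁻¹ := by
  have h1 := mangle_perpendicular_le hn hq hb hσ hnb
  have h2 := mangle_perpendicular_le hn hq hb' hσ hnb'
  have h3 : mink (-proj q n) (-proj q n) = 1 + mink n q ^ 2 := by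
    rw [mink_neg_left, mink_neg_right, mink_proj_proj hq, mink_comm q n, hn]; ring
  have h4 : -proj q n ≠ 0 := by
    intro h
    rw [h, mink_zero_left] at h3
    nlinarith
  have h5 := mangle_triangle (mink_self_lt_zero hq) (mink_proj_right hq b)
    (q := -proj q n) (by rw [mink_neg_right, mink_proj_right hq, neg_zero])
    (mink_proj_right hq b') (proj_ne_zero hq hb (by rintro rfl; linarith)) h4
    (proj_ne_zero hq hb' (by rintro rfl; linarith))
  rw [mangle_comm (proj q b) (-proj q n)] at h5
  rw [hangle]
  linarith

/-- Two points on the far side of a slab of width `2 h` are seen from any point on the near side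
under a small angle. -/
theorem hangle_le_across_slab {c m q b b' : E} {h : ℝ} (hh : 0 < h) (hc : c ∈ H3)
    (hm : mink m m = 1) (hcm : mink c m = 0) (hq : q ∈ H3) (hb : b ∈ H3) (hb' : b' ∈ H3)
    (hqs : Real.sinh h * -mink c q ≤ Real.cosh h * mink m q)
    (hbs : Real.cosh h * mink m b ≤ Real.sinh h * mink c b)
    (hbs' : Real.cosh h * mink m b' ≤ Real.sinh h * mink c b') :
    hangle q b b' ≤ 2 * (Real.sinh (2 * h))⁻¹ := by
  set n : E := Real.cosh h • m - Real.sinh h • c with hn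
  have hnx : ∀ x, mink n x = Real.cosh h * mink m x - Real.sinh h * mink c x := by
    intro x; rw [hn, mink_sub_left, mink_smul_left, mink_smul_left]
  have hs : 0 < Real.sinh h := Real.sinh_pos_iff.2 hh
  have hch : 0 < Real.cosh h := Real.cosh_pos h
  have hcs := Real.cosh_sq h
  have hnn : mink n n = 1 := by
    rw [hnx, mink_comm m n, mink_comm c n, hnx, hnx, hm, mink_comm m c, hcm, hc.1]
    nlinarith
  have hcq := mink_lt_zero hc hq
  -- the height of `q` above the middle plane, compared with its distance from `c`
  have hC : Real.cosh h ≤ -mink c q := by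
    have h1 := mink_self_nonneg_of_orth (w := proj c q - mink m q • m) (mink_self_lt_zero hc) (by
      rw [mink_sub_right, mink_proj_right hc, mink_smul_right, hcm]; ring)
    simp only [mink_sub_left, mink_sub_right, mink_smul_left, mink_smul_right,
      mink_proj_self hc hq, hm, mink_comm (proj c q) m,
      mink_proj_of_orth (mink_comm c m ▸ hcm : mink m c = 0)] at h1
    have h2 : (Real.sinh h * -mink c q) ^ 2 ≤ (Real.cosh h * mink m q) ^ 2 := by
      apply pow_le_pow_left₀ _ hqs
      have : 0 < -mink c q := by linarith
      positivity
    have h3 : Real.cosh h ^ 2 ≤ (-mink c q) ^ 2 := by nlinarith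
    exact abs_le_of_sq_le_sq' h3 (by linarith) |>.2
  have hσ : Real.sinh (2 * h) ≤ mink n q := by
    rw [hnx, Real.sinh_two_mul]
    nlinarith
  have hs2 : 0 < Real.sinh (2 * h) := Real.sinh_pos_iff.2 (by linarith)
  refine (hangle_le_of_beyond_plane hnn hq hb hb' (hs2.trans_le hσ) (by rw [hnx]; linarith)
    (by rw [hnx]; linarith)).trans ?_
  gcongr

/-- In a plane, two vectors make the same angle as their normals, up to orientation. Here `u`,
`u'` are outward normals of two sides and `d`, `d'` directions along them. -/
theorem mangle_normals_eq {v n u u' d d' : E} (hv : v ∈ H3) (hn : mink n n = 1)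
    (hvn : mink v n = 0) (hnu : mink n u = 0) (hnu' : mink n u' = 0) (hnd : mink n d = 0)
    (hnd' : mink n d' = 0) (hvu : mink v u = 0) (hvu' : mink v u' = 0) (hvd : mink v d = 0)
    (hvd' : mink v d' = 0) (hd0 : d ≠ 0) (hd0' : d' ≠ 0) (hu0 : u ≠ 0) (hu0' : u' ≠ 0)
    (hud : mink u d = 0) (hud' : mink u' d' = 0) (h1 : mink u d' ≤ 0) (h2 : mink u' d < 0) :
    mangle u u' = Real.pi - mangle d d' := by
  have hvv := mink_self_lt_zero hv
  have huu := mink_self_pos_of_orth hvv hvu hu0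
  have hdd := mink_self_pos_of_orth hvv hvd hd0
  have huu' := mink_self_pos_of_orth hvv hvu' hu0'
  have hdd' := mink_self_pos_of_orth hvv hvd' hd0'
  have key : ∀ x, mink n x = 0 → mink v x = 0 → ∀ y,
      mink x y * (mink u u * mink d d) =
        mink u x * mink u y * mink d d + mink d x * mink d y * mink u u := by
    intro x hx hx' y
    obtain ⟨α, -, hα⟩ := exists_unit_scale huu
    obtain ⟨β, -, hβ⟩ := exists_unit_scale hdd
    have fr : IsFrame v (α • u) (β • d) n := by
      refine ⟨hv.1, ?_, ?_, hvn, ?_, ?_, ?_, ?_, ?_, hn⟩ <;>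
        simp only [mink_smul_left, mink_smul_right]
      · rw [hvu, mul_zero]
      · rw [hvd, mul_zero]
      · exact hα
      · rw [hud]; ring
      · rw [mink_comm u n, hnu]; ring
      · exact hβ
      · rw [mink_comm d n, hnd]; ring
    have := fr.mink_eq x y
    simp only [hx, hx', mink_smul_left] at this
    rw [this]
    linear_combination (mink u x * mink u y * mink d d) * hα +
      (mink d x * mink d y * mink u u) * hβ
  have k1 := key u' hnu' hvu' u'
  have k2 := key d' hnd' hvd' d'
  have k3 := key u' hnu' hvu' d'
  rw [hud'] at k3
  have hneg : Real.pi - mangle d d' = mangle (-d) d' := by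
    rw [mangle, mangle, ← Real.arccos_neg]
    simp only [mink_neg_left, mink_neg_right, neg_neg, neg_div]
  rw [hneg, mangle, mangle]
  congr 1
  simp only [mink_neg_left, mink_neg_right, neg_neg]
  rw [mink_comm d u'] at k1 k3
  set a := mink u u
  set b := mink d d
  set a' := mink u' u'
  set b' := mink d' d'
  set x := mink u d'
  set y := mink d d'
  set z := mink u u'
  set w := mink u' d
  rw [Real.sqrt_mul huu.le, Real.sqrt_mul hdd.le]
  have sa := Real.sq_sqrt huu.le
  have sb := Real.sq_sqrt hdd.le
  have sa' := Real.sq_sqrt huu'.le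
  have sb' := Real.sq_sqrt hdd'.le
  have pa := Real.sqrt_pos.2 huu
  have pb := Real.sqrt_pos.2 hdd
  have pa' := Real.sqrt_pos.2 huu'
  have pb' := Real.sqrt_pos.2 hdd'
  set α := √a
  set β := √b
  set α' := √a'
  set β' := √b'
  rw [← sa, ← sb, ← sa'] at k1
  rw [← sa, ← sb, ← sb'] at k2
  rw [← sa, ← sb] at k3
  rw [div_eq_div_iff (by positivity) (by positivity)]
  -- in unit coordinates: `Z X + W Y = 0`, `X² + Y² = 1 = Z² + W²`, `X ≤ 0`, `W < 0`
  obtain ⟨X, hX⟩ : ∃ X, x = X * (α * β') := ⟨x / (α * β'), by field_simp⟩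
  obtain ⟨Y, hY⟩ : ∃ Y, y = Y * (β * β') := ⟨y / (β * β'), by field_simp⟩
  obtain ⟨Z, hZ⟩ : ∃ Z, z = Z * (α * α') := ⟨z / (α * α'), by field_simp⟩
  obtain ⟨W, hW⟩ : ∃ W, w = W * (α' * β) := ⟨w / (α' * β), by field_simp⟩
  rw [hZ, hW] at k1
  rw [hX, hY] at k2
  rw [hX, hY, hZ, hW] at k3
  rw [hX] at h1
  rw [hW] at h2
  have q1 : Z ^ 2 + W ^ 2 = 1 := by
    have : (Z ^ 2 + W ^ 2) * (α ^ 2 * β ^ 2 * α' ^ 2) = 1 * (α ^ 2 * β ^ 2 * α' ^ 2) := by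
      linarith
    exact mul_right_cancel₀ (by positivity) this
  have q2 : X ^ 2 + Y ^ 2 = 1 := by
    have : (X ^ 2 + Y ^ 2) * (α ^ 2 * β ^ 2 * β' ^ 2) = 1 * (α ^ 2 * β ^ 2 * β' ^ 2) := by
      linarith
    exact mul_right_cancel₀ (by positivity) this
  have q3 : Z * X + W * Y = 0 := by
    have : (Z * X + W * Y) * (α ^ 2 * β ^ 2 * α' * β') = 0 * (α ^ 2 * β ^ 2 * α' * β') := by
      linarith
    exact mul_right_cancel₀ (by positivity) this
  have q4 : X ≤ 0 := by
    by_contra hcon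
    push Not at hcon
    have : 0 < X * (α * β') := by positivity
    linarith
  have q5 : W < 0 := by
    by_contra hcon
    push Not at hcon
    have : 0 ≤ W * (α' * β) := by positivity
    linarith
  have q6 : Z = -Y := by
    have e : W ^ 2 = X ^ 2 := by
      have e1 : Z ^ 2 * X ^ 2 = W ^ 2 * Y ^ 2 := by
        have : Z * X = -(W * Y) := by linarith
        calc Z ^ 2 * X ^ 2 = (Z * X) ^ 2 := by ring
          _ = W ^ 2 * Y ^ 2 := by rw [this]; ring
      have e2 : Z ^ 2 = 1 - W ^ 2 := by linarith
      have e3 : Y ^ 2 = 1 - X ^ 2 := by linarith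
      rw [e2, e3] at e1
      linarith
    have e2 : W = X := by
      rcases sq_eq_sq_iff_eq_or_eq_neg.1 e with h | h
      · exact h
      · linarith
    have e3 : W * (Z + Y) = 0 := by rw [← e2] at q3; linarith
    rcases mul_eq_zero.1 e3 with h | h
    · linarith
    · linarith
  rw [hZ, hY, q6]
  ring

/-! ### The cyclic order of the sides of a convex polygon -/

/-- Rotating a supporting line. Let `cos θ x + sin θ y ≤ r` support a finite non-collinear set of
points of the plane. Turning the line counterclockwise around its extreme contact point until it
meets a further point gives a supporting line with normal angle `θ + φ`, `0 < φ < π`, and no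
supporting line with a normal angle strictly in between has two distinct contact points. -/
theorem exists_rotated_support {ι : Type*} (I : Finset ι) (x y : ι → ℝ) (θ r : ℝ)
    (hsupp : ∀ i ∈ I, Real.cos θ * x i + Real.sin θ * y i ≤ r)
    (hcontact : ∃ i ∈ I, Real.cos θ * x i + Real.sin θ * y i = r)
    (hcol : ∃ i ∈ I, Real.cos θ * x i + Real.sin θ * y i ≠ r) :
    ∃ φ r' : ℝ, ∃ i ∈ I, ∃ j ∈ I, 0 < φ ∧ φ < Real.pi ∧
      (∀ l ∈ I, Real.cos (θ + φ) * x l + Real.sin (θ + φ) * y l ≤ r') ∧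
      Real.cos θ * x i + Real.sin θ * y i = r ∧
      Real.cos (θ + φ) * x i + Real.sin (θ + φ) * y i = r' ∧
      Real.cos (θ + φ) * x j + Real.sin (θ + φ) * y j = r' ∧
      Real.cos θ * x j + Real.sin θ * y j ≠ r ∧
      ∀ ψ, 0 < ψ → ψ < φ → ∀ r'',
        (∀ l ∈ I, Real.cos (θ + ψ) * x l + Real.sin (θ + ψ) * y l ≤ r'') →
        ∀ a ∈ I, Real.cos (θ + ψ) * x a + Real.sin (θ + ψ) * y a = r'' →
          x a = x i ∧ y a = y i := by
  classical
  set f : ι → ℝ := fun i => Real.cos θ * x i + Real.sin θ * y i - r with hf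
  set g : ι → ℝ := fun i => -Real.sin θ * x i + Real.cos θ * y i with hg
  have hrot : ∀ ψ l, Real.cos (θ + ψ) * x l + Real.sin (θ + ψ) * y l =
      Real.cos ψ * (f l + r) + Real.sin ψ * g l := by
    intro ψ l
    rw [Real.cos_add, Real.sin_add, hf, hg]
    ring
  have hf0 : ∀ i ∈ I, f i ≤ 0 := fun i hi => by have := hsupp i hi; simp only [hf]; linarith
  -- the extreme contact point
  obtain ⟨i, hi, himax⟩ := exists_max_image (I.filter fun i => f i = 0) g (by
    obtain ⟨i, hi, h⟩ := hcontact
    exact ⟨i, mem_filter.2 ⟨hi, by simp only [hf]; linarith⟩⟩)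
  obtain ⟨hiI, hif⟩ := mem_filter.1 hi
  -- the point met first has the largest value of the cotangent of the rotation angle
  obtain ⟨j, hj, hjmax⟩ := exists_max_image (I.filter fun i => f i < 0)
    (fun l => (g l - g i) / -f l) (by
    obtain ⟨i, hi, h⟩ := hcol
    refine ⟨i, mem_filter.2 ⟨hi, lt_of_le_of_ne (hf0 i hi) ?_⟩⟩
    intro h'
    apply h
    simp only [hf] at h'
    linarith)
  obtain ⟨hjI, hjf⟩ := mem_filter.1 hj
  set c := (g j - g i) / -f j with hc
  set φ := Real.pi / 2 - Real.arctan c with hφ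
  have hφ0 : 0 < φ := by linarith [Real.arctan_lt_pi_div_two c]
  have hφπ : φ < Real.pi := by linarith [Real.neg_pi_div_two_lt_arctan c]
  have hsin : 0 < Real.sin φ := Real.sin_pos_of_pos_of_lt_pi hφ0 hφπ
  have hcos : Real.cos φ = c * Real.sin φ := by
    have h1 := Real.tan_arctan c
    rw [Real.tan_eq_sin_div_cos, div_eq_iff (Real.cos_arctan_pos c).ne'] at h1
    rw [hφ, Real.cos_pi_div_two_sub, Real.sin_pi_div_two_sub, h1]
  have hle : ∀ l ∈ I, c * f l + (g l - g i) ≤ 0 := by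
    intro l hl
    rcases (hf0 l hl).lt_or_eq with h | h
    · have h1 := hjmax l (mem_filter.2 ⟨hl, h⟩)
      rw [div_le_iff₀ (by linarith)] at h1
      linarith
    · rw [h]
      have := himax l (mem_filter.2 ⟨hl, h⟩)
      linarith
  refine ⟨φ, Real.cos φ * r + Real.sin φ * g i, i, hiI, j, hjI, hφ0, hφπ, ?_, ?_, ?_, ?_, ?_, ?_⟩
  · intro l hl
    rw [hrot, hcos]
    nlinarith [mul_nonneg hsin.le (neg_nonneg.2 (hle l hl))]
  · simp only [hf] at hif
    linarith
  · rw [hrot, hif]; ring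
  · have h1 : c * f j + (g j - g i) = 0 := by
      rw [hc]
      field_simp [hjf.ne]
      ring
    rw [hrot, hcos]
    linear_combination Real.sin φ * h1
  · intro h
    simp only [hf] at hjf
    linarith
  · intro ψ hψ0 hψφ r'' hs a ha hac
    have h1 := hs i hiI
    rw [← hac, hrot, hrot, hif] at h1
    have hsψ : 0 < Real.sin ψ := Real.sin_pos_of_pos_of_lt_pi hψ0 (hψφ.trans hφπ)
    have h2 : 0 < Real.cos ψ - c * Real.sin ψ := by
      have h3 : 0 < Real.sin (φ - ψ) :=
        Real.sin_pos_of_pos_of_lt_pi (by linarith) (by linarith)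
      rw [Real.sin_sub, hcos] at h3
      have : 0 < Real.sin φ * (Real.cos ψ - c * Real.sin ψ) := by linarith
      exact pos_of_mul_pos_right this hsin.le
    have h4 := mul_nonneg hsψ.le (neg_nonneg.2 (hle a ha))
    have hfa : f a = 0 := by
      by_contra hne
      have h5 : f a < 0 := lt_of_le_of_ne (hf0 a ha) hne
      nlinarith
    have hga : g a = g i := by
      have h6 := himax a (mem_filter.2 ⟨ha, hfa⟩)
      rw [hfa] at h1
      have h7 : 0 ≤ Real.sin ψ * (g a - g i) := by linarith
      have := nonneg_of_mul_nonneg_right h7 hsψ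
      linarith
    have hff : f a = f i := hfa.trans hif.symm
    have hcs := Real.sin_sq_add_cos_sq θ
    simp only [hf, hg] at hff hga
    constructor
    · linear_combination Real.cos θ * hff - Real.sin θ * hga - (x a - x i) * hcs
    · linear_combination Real.sin θ * hff + Real.cos θ * hga - (y a - y i) * hcs

/-- Finitely many points of the circle, listed in counterclockwise order. If every point has a
successor at an angle less than `π` with no other point in between, the points form a single cycle
of total angle `2 π`. -/
theorem exists_cyclic_order {T : Type*} [Finite T] [Nonempty T] (θ : T → ℝ)
    (hinj : Function.Injective θ) (hθ : ∀ s, θ s ∈ Set.Ioc (-Real.pi) Real.pi)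
    (R : T → T → Prop)
    (hsucc : ∀ s, ∃ s' φ, ∃ z : ℤ, 0 < φ ∧ φ < Real.pi ∧ θ s' = θ s + φ + 2 * Real.pi * z ∧
      R s s' ∧ ∀ (t : T) (z' : ℤ),
        ¬ (θ s < θ t + 2 * Real.pi * z' ∧ θ t + 2 * Real.pi * z' < θ s + φ)) :
    ∃ (k : ℕ) (F : Fin k → T) (gap : Fin k → ℝ), 3 ≤ k ∧ Function.Bijective F ∧
      (∀ i, 0 < gap i ∧ gap i < Real.pi) ∧ ∑ i, gap i = 2 * Real.pi ∧
      (∀ i, R (F i) (F (finRotate k i))) ∧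
      ∀ i, ∃ z : ℤ, θ (F (finRotate k i)) = θ (F i) + gap i + 2 * Real.pi * z := by
  classical
  have := Fintype.ofFinite T
  choose σ φ z hφ0 hφπ hz hR hno using hsucc
  let _ : LinearOrder T := LinearOrder.lift' θ hinj
  obtain ⟨n, hn⟩ : ∃ n, Fintype.card T = n + 1 :=
    ⟨Fintype.card T - 1, (Nat.succ_pred_eq_of_pos Fintype.card_pos).symm⟩
  let e : Fin (n + 1) ≃o T := Fintype.orderIsoFinOfCardEq T hn
  have hpi := Real.pi_pos
  have hmono : ∀ {i j : Fin (n + 1)}, i < j ↔ θ (e i) < θ (e j) := fun {i j} =>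
    (e.lt_iff_lt (x := i) (y := j)).symm
  have hmono' : ∀ {i j : Fin (n + 1)}, i ≤ j ↔ θ (e i) ≤ θ (e j) := fun {i j} =>
    (e.le_iff_le (x := i) (y := j)).symm
  have hzz : ∀ s, z s = 0 ∨ z s = -1 := by
    intro s
    have h1 := (hθ s).1
    have h2 := (hθ s).2
    have h3 := (hθ (σ s)).1
    have h4 := (hθ (σ s)).2
    have h5 := hz s
    have h6 := hφ0 s
    have h7 := hφπ s
    have a1 : (z s : ℝ) < 1 := by
      by_contra hcon
      push Not at hcon
      nlinarith
    have a2 : (-2 : ℝ) < z s := by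
      by_contra hcon
      push Not at hcon
      nlinarith
    have a1' : z s < 1 := by exact_mod_cast a1
    have a2' : -2 < z s := by exact_mod_cast a2
    omega
  have hnext : ∀ i : Fin (n + 1), σ (e i) = e (finRotate (n + 1) i) ∧
      φ (e i) = (if i = Fin.last n then θ (e 0) + 2 * Real.pi - θ (e i)
        else θ (e (finRotate (n + 1) i)) - θ (e i)) := by
    intro i
    obtain ⟨j, hj⟩ := e.surjective (σ (e i))
    have hzi := hz (e i)
    rw [← hj] at hzi ⊢
    have hni := hno (e i)
    split_ifs with hl
    · subst hl
      rw [finRotate_last]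
      have hz1 : z (e (Fin.last n)) = -1 := by
        rcases hzz (e (Fin.last n)) with h | h
        · exfalso
          rw [h] at hzi
          have h1 : θ (e j) ≤ θ (e (Fin.last n)) := hmono'.1 (Fin.le_last j)
          have := hφ0 (e (Fin.last n))
          push_cast at hzi
          linarith
        · exact h
      rw [hz1] at hzi
      push_cast at hzi
      have h0 := hni (e 0) 1
      push_cast at h0
      have h1 : θ (e 0) ≤ θ (e j) := hmono'.1 (Fin.zero_le j)
      have h2 : θ (e (Fin.last n)) < θ (e 0) + 2 * Real.pi * 1 := by
        linarith [(hθ (e 0)).1, (hθ (e (Fin.last n))).2]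
      have h3 : θ (e (Fin.last n)) + φ (e (Fin.last n)) ≤ θ (e 0) + 2 * Real.pi * 1 := by
        by_contra hcon
        exact h0 ⟨h2, by linarith⟩
      have h4 : θ (e j) = θ (e 0) := by linarith
      exact ⟨hinj h4, by linarith⟩
    · have hlt : i < Fin.last n := lt_of_le_of_ne (Fin.le_last i) hl
      have hii : i < finRotate (n + 1) i := by
        rw [Fin.lt_def, coe_finRotate_of_ne_last hl]; omega
      have h1 := hni (e (finRotate (n + 1) i)) 0
      have h2 := hmono.1 hii
      have h3 : θ (e i) + φ (e i) ≤ θ (e (finRotate (n + 1) i)) := by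
        by_contra hcon
        push_cast at h1
        exact h1 ⟨by linarith, by linarith⟩
      have hz1 : z (e i) = 0 := by
        rcases hzz (e i) with h | h
        · exact h
        · exfalso
          rw [h] at hzi
          push_cast at hzi
          linarith [(hθ (e (finRotate (n + 1) i))).2, (hθ (e j)).1]
      rw [hz1] at hzi
      push_cast at hzi
      have h4 : i < j := hmono.2 (by linarith [hφ0 (e i)])
      have h5 : finRotate (n + 1) i ≤ j := by
        rw [Fin.le_def, coe_finRotate_of_ne_last hl]
        rw [Fin.lt_def] at h4
        omega
      have h6 := hmono'.1 h5
      have h7 : θ (e j) = θ (e (finRotate (n + 1) i)) := by linarith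
      exact ⟨hinj h7, by linarith⟩
  have hsum : ∑ i, φ (e i) = 2 * Real.pi := by
    rw [Fin.sum_univ_castSucc, (hnext (Fin.last n)).2, if_pos rfl]
    have h1 : ∀ i : Fin n, φ (e i.castSucc) = θ (e i.succ) - θ (e i.castSucc) := by
      intro i
      rw [(hnext i.castSucc).2, if_neg (Fin.castSucc_lt_last i).ne]
      congr 3
      ext
      rw [coe_finRotate_of_ne_last (Fin.castSucc_lt_last i).ne]
      simp
    rw [Finset.sum_congr rfl fun i _ => h1 i, Finset.sum_sub_distrib]
    have h2 := Fin.sum_univ_castSucc (fun i : Fin (n + 1) => θ (e i))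
    have h3 := Fin.sum_univ_succ (fun i : Fin (n + 1) => θ (e i))
    linarith
  refine ⟨n + 1, e, fun i => φ (e i), ?_, e.bijective, fun i => ⟨hφ0 _, hφπ _⟩, hsum, ?_, ?_⟩
  · have h1 : ∑ i, φ (e i) < ∑ _i : Fin (n + 1), Real.pi :=
      Finset.sum_lt_sum_of_nonempty ⟨0, mem_univ _⟩ fun i _ => hφπ _
    rw [hsum, Finset.sum_const, card_univ, Fintype.card_fin, nsmul_eq_mul] at h1
    have h2 : (2 : ℝ) < (n + 1 : ℕ) := lt_of_mul_lt_mul_right h1 hpi.le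
    exact_mod_cast h2
  · intro i
    rw [← (hnext i).1]
    exact hR _
  · intro i
    rw [← (hnext i).1]
    exact ⟨_, hz _⟩

/-- The normal, up to positive multiples, of the line `cos ψ x + sin ψ y = r` of the projective
chart `(x, y) = (⟨e₁, ·⟩, ⟨e₂, ·⟩) / (-⟨c, ·⟩)` of a hyperbolic plane. -/
noncomputable def lineNormal (c e₁ e₂ : E) (ψ r : ℝ) : E :=
  Real.cos ψ • e₁ + Real.sin ψ • e₂ + r • c

theorem mink_lineNormal (c e₁ e₂ : E) (ψ r : ℝ) {x : E} (hx : mink c x < 0) :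
    mink (lineNormal c e₁ e₂ ψ r) x = -mink c x *
      (Real.cos ψ * (mink e₁ x / -mink c x) + Real.sin ψ * (mink e₂ x / -mink c x) - r) := by
  have : mink c x ≠ 0 := hx.ne
  simp only [lineNormal, mink_add_left, mink_smul_left]
  field_simp
  ring

/-- The cyclic order of the sides of a convex polygon in a hyperbolic plane. The polygon is the
hull of the finite set `I` of timelike vectors in the plane `⟨m, ·⟩ = 0`. The vectors `n s`
represent its sides, modulo `m`: they support `I` along sides (`hsupp`, `hedge`, `hne`), different
ones along different sides (`hinj`), and every side is represented (`hlift`). Consecutive sides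
share a point of `I`, and their outward normals, read in the projective chart with center `c`,
enclose angles which add up to `2 π`. -/
theorem exists_cyclic_order_sides {c e₁ e₂ m : E} (fr : IsFrame c e₁ e₂ m) (I : Finset E)
    (hI : ∀ x ∈ I, mink m x = 0 ∧ mink c x < 0)
    (hfull : ∀ f, mink m f = 0 → (∀ x ∈ I, mink f x = 0) → f = 0)
    {T : Type*} [Finite T] (n : T → E) (hsupp : ∀ s, ∀ x ∈ I, mink (n s) x ≤ 0)
    (hedge : ∀ s, ∃ x ∈ I, ∃ y ∈ I, mink (n s) x = 0 ∧ mink (n s) y = 0 ∧ ∀ r : ℝ, y ≠ r • x)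
    (hne : ∀ s, ∃ x ∈ I, mink (n s) x ≠ 0)
    (hinj : ∀ s t (μ ν : ℝ), 0 < μ → n t = μ • n s + ν • m → s = t)
    (hlift : ∀ f, mink m f = 0 → f ≠ 0 → (∀ x ∈ I, mink f x ≤ 0) →
      (∃ x ∈ I, ∃ y ∈ I, mink f x = 0 ∧ mink f y = 0 ∧ ∀ r : ℝ, y ≠ r • x) →
      ∃ s, ∃ μ ν : ℝ, 0 < μ ∧ n s = μ • f + ν • m) :
    ∃ (k : ℕ) (F : Fin k → T) (gap : Fin k → ℝ), 3 ≤ k ∧ Function.Bijective F ∧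
      (∀ i, 0 < gap i ∧ gap i < Real.pi) ∧ ∑ i, gap i = 2 * Real.pi ∧
      (∀ i, ∃ x ∈ I, mink (n (F i)) x = 0 ∧ mink (n (F (finRotate k i))) x = 0) ∧
      ∀ i, mink e₁ (n (F i)) * mink e₁ (n (F (finRotate k i))) +
          mink e₂ (n (F i)) * mink e₂ (n (F (finRotate k i))) =
        √(mink e₁ (n (F i)) ^ 2 + mink e₂ (n (F i)) ^ 2) *
          √(mink e₁ (n (F (finRotate k i))) ^ 2 + mink e₂ (n (F (finRotate k i))) ^ 2) *
          Real.cos (gap i) := by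
  classical
  have hIc : ∀ x ∈ I, 0 < -mink c x := fun x hx => by linarith [(hI x hx).2]
  set α : E → ℝ := fun x => mink e₁ x / -mink c x with hα
  set β : E → ℝ := fun x => mink e₂ x / -mink c x with hβ
  set ω : T → ℂ := fun s => ⟨mink e₁ (n s), mink e₂ (n s)⟩ with hω
  set θ : T → ℝ := fun s => (ω s).arg with hθ
  set r : T → ℝ := fun s => -mink c (n s) / ‖ω s‖ with hr
  have hre : ∀ s, ‖ω s‖ * Real.cos (θ s) = mink e₁ (n s) := fun s =>
    Complex.norm_mul_cos_arg (ω s)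
  have him : ∀ s, ‖ω s‖ * Real.sin (θ s) = mink e₂ (n s) := fun s =>
    Complex.norm_mul_sin_arg (ω s)
  have hline : ∀ ψ t, ∀ x ∈ I, mink (lineNormal c e₁ e₂ ψ t) x =
      -mink c x * (Real.cos ψ * α x + Real.sin ψ * β x - t) := fun ψ t x hx =>
    mink_lineNormal c e₁ e₂ ψ t (hI x hx).2
  have hline_m : ∀ ψ t, mink m (lineNormal c e₁ e₂ ψ t) = 0 := by
    intro ψ t
    simp only [lineNormal, mink_add_right, mink_smul_right, mink_comm m e₁, mink_comm m e₂,
      mink_comm m c, fr.e1m, fr.e2m, fr.cm]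
    ring
  have hline_1 : ∀ ψ t, mink e₁ (lineNormal c e₁ e₂ ψ t) = Real.cos ψ := by
    intro ψ t
    simp only [lineNormal, mink_add_right, mink_smul_right, fr.e11, fr.e12, mink_comm e₁ c, fr.c1]
    ring
  have hline_2 : ∀ ψ t, mink e₂ (lineNormal c e₁ e₂ ψ t) = Real.sin ψ := by
    intro ψ t
    simp only [lineNormal, mink_add_right, mink_smul_right, fr.e22, mink_comm e₂ e₁, fr.e12,
      mink_comm e₂ c, fr.c2]
    ring
  have hline_0 : ∀ ψ t, lineNormal c e₁ e₂ ψ t ≠ 0 := by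
    intro ψ t h
    have h1 := hline_1 ψ t
    have h2 := hline_2 ψ t
    rw [h, mink_zero_right] at h1 h2
    have := Real.sin_sq_add_cos_sq ψ
    rw [← h1, ← h2] at this
    norm_num at this
  have hω0 : ∀ s, 0 < ‖ω s‖ := by
    intro s
    rw [norm_pos_iff]
    intro h0
    have h1 : mink e₁ (n s) = 0 := congrArg Complex.re h0
    have h2 : mink e₂ (n s) = 0 := congrArg Complex.im h0
    have hx' : ∀ x ∈ I, mink (n s) x = -(mink c (n s) * mink c x) := by
      intro x hx
      rw [fr.mink_eq (n s) x, h1, h2, (hI x hx).1]; ring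
    obtain ⟨x, hx, -, -, hx0, -⟩ := hedge s
    obtain ⟨y, hy, hy0⟩ := hne s
    rw [hx' x hx] at hx0
    rw [hx' y hy] at hy0
    have h3 : mink c (n s) = 0 := by
      rcases mul_eq_zero.1 (neg_eq_zero.1 hx0) with h | h
      · exact h
      · linarith [hIc x hx]
    apply hy0
    rw [h3]; ring
  have hn : ∀ s, n s = ‖ω s‖ • lineNormal c e₁ e₂ (θ s) (r s) + mink m (n s) • m := by
    intro s
    have h1 : ‖ω s‖ * r s = -mink c (n s) := by
      rw [hr]
      exact mul_div_cancel₀ _ (hω0 s).ne'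
    conv_lhs => rw [fr.expand (n s)]
    rw [lineNormal, smul_add, smul_add, smul_smul, smul_smul, smul_smul, hre, him, h1]
    abel
  have hmul : ∀ s, ∀ x ∈ I, mink (n s) x = ‖ω s‖ *
      (-mink c x * (Real.cos (θ s) * α x + Real.sin (θ s) * β x - r s)) := by
    intro s x hx
    conv_lhs => rw [hn s]
    rw [mink_add_left, mink_smul_left, mink_smul_left, hline _ _ x hx, (hI x hx).1]
    ring
  have hle : ∀ s, ∀ x ∈ I, Real.cos (θ s) * α x + Real.sin (θ s) * β x ≤ r s := by
    intro s x hx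
    by_contra hcon
    push Not at hcon
    have h1 : 0 < ‖ω s‖ * (-mink c x * (Real.cos (θ s) * α x + Real.sin (θ s) * β x - r s)) :=
      mul_pos (hω0 s) (mul_pos (hIc x hx) (by linarith))
    rw [← hmul s x hx] at h1
    linarith [hsupp s x hx]
  have heq : ∀ s, ∀ x ∈ I, mink (n s) x = 0 ↔
      Real.cos (θ s) * α x + Real.sin (θ s) * β x = r s := by
    intro s x hx
    rw [hmul s x hx, mul_eq_zero, mul_eq_zero]
    have h1 := (hω0 s).ne'
    have h2 := (hIc x hx).ne'
    constructor
    · rintro (h | h | h)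
      · exact absurd h h1
      · exact absurd h h2
      · linarith
    · intro h
      right; right; linarith
  have hpar : ∀ x ∈ I, ∀ y ∈ I, α x = α y → β x = β y → ∃ t : ℝ, y = t • x := by
    intro x hx y hy h1 h2
    refine ⟨mink c y / mink c x, ?_⟩
    have hcx := (hIc x hx).ne'
    have hcy := (hIc y hy).ne'
    have hcx' : mink c x ≠ 0 := by intro h; apply hcx; rw [h, neg_zero]
    simp only [hα, hβ] at h1 h2
    rw [div_eq_div_iff hcx hcy] at h1 h2
    apply fr.ext
    · rw [mink_smul_right]; field_simp
    · rw [mink_smul_right]; field_simp; linarith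
    · rw [mink_smul_right]; field_simp; linarith
    · rw [mink_smul_right, (hI x hx).1, (hI y hy).1, mul_zero]
  have hθinj : Function.Injective θ := by
    intro s t hst
    have hrr : r s = r t := by
      obtain ⟨x, hx, -, -, hx0, -⟩ := hedge s
      obtain ⟨y, hy, -, -, hy0, -⟩ := hedge t
      apply le_antisymm
      · rw [← (heq s x hx).1 hx0, hst]; exact hle t x hx
      · rw [← (heq t y hy).1 hy0, ← hst]; exact hle s y hy
    refine hinj s t (‖ω t‖ / ‖ω s‖) (mink m (n t) - ‖ω t‖ / ‖ω s‖ * mink m (n s))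
      (div_pos (hω0 t) (hω0 s)) ?_
    have h1 : (‖ω t‖ / ‖ω s‖) • n s = ‖ω t‖ • lineNormal c e₁ e₂ (θ t) (r t) +
        (‖ω t‖ / ‖ω s‖ * mink m (n s)) • m := by
      conv_lhs => rw [hn s]
      rw [smul_add, smul_smul, smul_smul, div_mul_cancel₀ _ (hω0 s).ne', hst, hrr]
    rw [h1, add_assoc, ← add_smul, add_sub_cancel, ← hn t]
  have hcol : ∀ ψ t, ∃ x ∈ I, Real.cos ψ * α x + Real.sin ψ * β x ≠ t := by
    intro ψ t
    by_contra hcon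
    push Not at hcon
    apply hline_0 ψ t
    apply hfull _ (hline_m ψ t)
    intro x hx
    rw [hline ψ t x hx, hcon x hx, sub_self, mul_zero]
  have hstep : ∀ ψ t, (∀ x ∈ I, Real.cos ψ * α x + Real.sin ψ * β x ≤ t) →
      (∃ x ∈ I, Real.cos ψ * α x + Real.sin ψ * β x = t) →
      ∃ s' φ, ∃ z : ℤ, 0 < φ ∧ φ < Real.pi ∧ θ s' = ψ + φ + 2 * Real.pi * z ∧
        (∃ x ∈ I, Real.cos ψ * α x + Real.sin ψ * β x = t ∧ mink (n s') x = 0) ∧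
        ∀ (s'' : T) (z' : ℤ),
          ¬ (ψ < θ s'' + 2 * Real.pi * z' ∧ θ s'' + 2 * Real.pi * z' < ψ + φ) := by
    intro ψ t h1 h2
    obtain ⟨φ, r', i, hi, j, hj, hφ0, hφπ, hs, hi1, hi2, hj2, hj1, hno⟩ :=
      exists_rotated_support I α β ψ t h1 h2 (hcol ψ t)
    obtain ⟨s', μ, ν, hμ, hs'⟩ := hlift (lineNormal c e₁ e₂ (ψ + φ) r') (hline_m _ _)
      (hline_0 _ _) (by
        intro x hx
        rw [hline _ _ x hx]
        have := hs x hx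
        have := hIc x hx
        nlinarith) (by
        refine ⟨i, hi, j, hj, ?_, ?_, ?_⟩
        · rw [hline _ _ i hi, hi2, sub_self, mul_zero]
        · rw [hline _ _ j hj, hj2, sub_self, mul_zero]
        · rintro u rfl
          apply hj1
          have hu : u ≠ 0 := by
            rintro rfl
            have := hIc _ hj
            rw [mink_smul_right] at this
            linarith
          rw [← hi1]
          have hci := (hIc i hi).ne'
          simp only [hα, hβ, mink_smul_right]
          rw [← mul_neg, mul_div_mul_left _ _ hu, mul_div_mul_left _ _ hu])
    have k1 : mink e₁ (n s') = μ * Real.cos (ψ + φ) := by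
      rw [hs', mink_add_right, mink_smul_right, mink_smul_right, hline_1, fr.e1m]; ring
    have k2 : mink e₂ (n s') = μ * Real.sin (ψ + φ) := by
      rw [hs', mink_add_right, mink_smul_right, mink_smul_right, hline_2, fr.e2m]; ring
    have kμ : ‖ω s'‖ = μ := by
      have h3 : ‖ω s'‖ ^ 2 = μ ^ 2 := by
        rw [Complex.sq_norm, Complex.normSq_apply]
        simp only [hω, k1, k2]
        linear_combination μ ^ 2 * Real.sin_sq_add_cos_sq (ψ + φ)
      exact (pow_left_inj₀ (norm_nonneg _) hμ.le two_ne_zero).1 h3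
    have kc : Real.cos (θ s') = Real.cos (ψ + φ) := by
      have := hre s'
      rw [k1, kμ] at this
      exact mul_left_cancel₀ hμ.ne' this
    have ks : Real.sin (θ s') = Real.sin (ψ + φ) := by
      have := him s'
      rw [k2, kμ] at this
      exact mul_left_cancel₀ hμ.ne' this
    obtain ⟨z, hz⟩ := Real.Angle.angle_eq_iff_two_pi_dvd_sub.1
      (Real.Angle.cos_sin_inj kc ks)
    refine ⟨s', φ, z, hφ0, hφπ, by linarith, ⟨i, hi, hi1, ?_⟩, ?_⟩
    · rw [hs', mink_add_left, mink_smul_left, mink_smul_left, hline _ _ i hi, hi2, (hI i hi).1]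
      ring
    · rintro s'' z' ⟨ha, hb⟩
      obtain ⟨x, hx, y, hy, hx0, hy0, hxy⟩ := hedge s''
      have e : ψ + (θ s'' + 2 * Real.pi * z' - ψ) = θ s'' + z' * (2 * Real.pi) := by ring
      have := hno (θ s'' + 2 * Real.pi * z' - ψ) (by linarith) (by linarith) (r s'')
      rw [e, Real.cos_add_int_mul_two_pi, Real.sin_add_int_mul_two_pi] at this
      have h5 := this (hle s'')
      obtain ⟨a1, a2⟩ := h5 x hx ((heq s'' x hx).1 hx0)
      obtain ⟨b1, b2⟩ := h5 y hy ((heq s'' y hy).1 hy0)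
      obtain ⟨u, hu⟩ := hpar x hx y hy (a1.trans b1.symm) (a2.trans b2.symm)
      exact hxy u hu
  have hT : Nonempty T := by
    obtain ⟨x₀, hx₀, -⟩ := hcol 0 0
    obtain ⟨x, hx, hmax⟩ := exists_max_image I (fun x => Real.cos 0 * α x + Real.sin 0 * β x)
      ⟨x₀, hx₀⟩
    obtain ⟨s, -⟩ := hstep 0 _ hmax ⟨x, hx, rfl⟩
    exact ⟨s⟩
  obtain ⟨k, F, gap, hk, hF, hgap, hsum, hR, hz⟩ := exists_cyclic_order θ hθinj
    (fun s => Complex.arg_mem_Ioc _) (fun s t => ∃ x ∈ I, mink (n s) x = 0 ∧ mink (n t) x = 0) (by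
      intro s
      obtain ⟨x, hx, -, -, hx0, -⟩ := hedge s
      obtain ⟨s', φ, z, h1, h2, h3, ⟨y, hy, hy1, hy2⟩, h5⟩ :=
        hstep (θ s) (r s) (hle s) ⟨x, hx, (heq s x hx).1 hx0⟩
      exact ⟨s', φ, z, h1, h2, h3, ⟨y, hy, (heq s y hy).2 hy1, hy2⟩, h5⟩)
  refine ⟨k, F, gap, hk, hF, hgap, hsum, hR, ?_⟩
  intro i
  obtain ⟨z, hz⟩ := hz i
  have hnorm : ∀ s, √(mink e₁ (n s) ^ 2 + mink e₂ (n s) ^ 2) = ‖ω s‖ := fun s =>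
    (Complex.norm_eq_sqrt_sq_add_sq (ω s)).symm
  have hcosgap : Real.cos (gap i) = Real.cos (θ (F (finRotate k i)) - θ (F i)) := by
    rw [hz, show θ (F i) + gap i + 2 * Real.pi * z - θ (F i) = gap i + z * (2 * Real.pi) by ring,
      Real.cos_add_int_mul_two_pi]
  rw [hnorm, hnorm, hcosgap, Real.cos_sub, ← hre, ← hre, ← him, ← him]
  ring

/-! ### Faces and edges -/

/-- A matrix with more rows than columns has linearly dependent rows. -/
theorem exists_linear_relation {k : ℕ} (M : Fin (k + 1) → Fin k → ℝ) :
    ∃ a : Fin (k + 1) → ℝ, a ≠ 0 ∧ ∀ j, ∑ i, a i * M i j = 0 := by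
  let Φ : (Fin (k + 1) → ℝ) →ₗ[ℝ] (Fin k → ℝ) := Matrix.vecMulLinear (Matrix.of M)
  have hker : LinearMap.ker Φ ≠ ⊥ := LinearMap.ker_ne_bot_of_finrank_lt (by
    simp [Module.finrank_fintype_fun_eq_card])
  obtain ⟨a, ha, ha0⟩ := Submodule.exists_mem_ne_zero_of_ne_bot hker
  refine ⟨a, ha0, fun j => ?_⟩
  have := congrFun (LinearMap.mem_ker.1 ha) j
  simpa [Φ, Matrix.vecMul, dotProduct] using this

theorem injective_vec_three {α : Type*} {a b c : α} (hab : a ≠ b) (hac : a ≠ c) (hbc : b ≠ c) :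
    Function.Injective ![a, b, c] := by
  intro p q h
  fin_cases p <;> fin_cases q
  · rfl
  · exact absurd h hab
  · exact absurd h hac
  · exact absurd h.symm hab
  · rfl
  · exact absurd h hbc
  · exact absurd h.symm hac
  · exact absurd h.symm hbc
  · rfl

/-- Three functionals that support a set in faces none of which contains another one are linearly
independent on that set: in a linear relation, one of them would be a nonnegative combination of
the others, and its face would be contained in theirs. -/
theorem relation_eq_zero_of_support (n : Fin 3 → E) (S : Set E)
    (hle : ∀ i, ∀ x ∈ S, mink (n i) x ≤ 0) (hnz : ∀ i, ∃ x ∈ S, mink (n i) x ≠ 0)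
    (hZ : ∀ i j, i ≠ j → ∃ x ∈ S, mink (n i) x = 0 ∧ mink (n j) x ≠ 0) (a : Fin 3 → ℝ)
    (ha : ∀ x ∈ S, ∑ i, a i * mink (n i) x = 0) : a = 0 := by
  have A : ∀ a : Fin 3 → ℝ, (∀ x ∈ S, ∑ i, a i * mink (n i) x = 0) →
      ∀ p, 0 < a p → (∀ j, j ≠ p → a j ≤ 0) → False := by
    intro a ha p hp hj
    by_cases hex : ∃ j, j ≠ p ∧ a j ≠ 0
    · obtain ⟨j, hjp, haj⟩ := hex
      obtain ⟨x, hx, hx0, hxj⟩ := hZ p j hjp.symm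
      have h1 := (Finset.sum_eq_zero_iff_of_nonneg (by
        intro i _
        rcases eq_or_ne i p with rfl | hi
        · rw [hx0, mul_zero]
        · exact mul_nonneg_of_nonpos_of_nonpos (hj i hi) (hle i x hx))).1 (ha x hx) j (mem_univ j)
      exact (mul_ne_zero haj hxj) h1
    · push Not at hex
      obtain ⟨x, hx, hx0⟩ := hnz p
      have h1 := ha x hx
      rw [Finset.sum_eq_single p (fun i _ hi => by rw [hex i hi, zero_mul])
        (fun h => absurd (mem_univ p) h)] at h1
      exact (mul_ne_zero hp.ne' hx0) h1
  have B : ∀ a : Fin 3 → ℝ, (∀ x ∈ S, ∑ i, a i * mink (n i) x = 0) → (∀ j, 0 ≤ a j) →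
      a = 0 := by
    intro a ha h0
    ext p
    obtain ⟨x, hx, hx0⟩ := hnz p
    have h1 := (Finset.sum_eq_zero_iff_of_nonpos (fun i _ =>
      mul_nonpos_of_nonneg_of_nonpos (h0 i) (hle i x hx))).1 (ha x hx) p (mem_univ p)
    exact (mul_eq_zero.1 h1).resolve_right hx0
  have hna : ∀ x ∈ S, ∑ i, (-a) i * mink (n i) x = 0 := by
    intro x hx
    simp only [Pi.neg_apply, neg_mul, Finset.sum_neg_distrib, ha x hx, neg_zero]
  have A' : ∀ p, a p < 0 → (∀ j, j ≠ p → 0 ≤ a j) → False := fun p hp hj =>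
    A (-a) hna p (by simpa using hp) (fun j hjp => by simpa using hj j hjp)
  by_cases hP : ∃ p, 0 < a p
  · by_cases hN : ∃ p, a p < 0
    · exfalso
      have hthird : ∀ p q : Fin 3, p ≠ q → ∃ r, ∀ j, j = p ∨ j = q ∨ j = r := by decide
      obtain ⟨p, hp⟩ := hP
      obtain ⟨q, hq⟩ := hN
      have hpq : p ≠ q := by rintro rfl; linarith
      obtain ⟨r, hr⟩ := hthird p q hpq
      rcases le_or_gt (a r) 0 with h | h
      · refine A a ha p hp fun j hj => ?_
        rcases hr j with rfl | rfl | rfl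
        · exact absurd rfl hj
        · exact hq.le
        · exact h
      · refine A' q hq fun j hj => ?_
        rcases hr j with rfl | rfl | rfl
        · exact hp.le
        · exact absurd rfl hj
        · exact h.le
    · push Not at hN
      exact B a ha hN
  · push Not at hP
    have := B (-a) hna (fun j => by simpa using hP j)
    simpa using this

namespace ConvexPolyhedron

variable {X : ConvexPolyhedron}

theorem exists_weights_of_mem_carrier {x : E} (hx : x ∈ X.carrier) :
    ∃ (r : ℝ) (w : E → ℝ), 0 < r ∧ (∀ v ∈ X.vertices, 0 ≤ w v) ∧ ∑ v ∈ X.vertices, w v = 1 ∧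
      ∑ v ∈ X.vertices, w v • v = r • x := by
  obtain ⟨-, r, hr, h⟩ := hx
  rw [Finset.mem_convexHull'] at h
  obtain ⟨w, h0, h1, h2⟩ := h
  exact ⟨r, w, hr, h0, h1, h2⟩

theorem mem_carrier_of_mem_vertices {v : E} (hv : v ∈ X.vertices) : v ∈ X.carrier :=
  ⟨X.mem_H3 v hv, 1, one_pos, by rw [one_smul]; exact subset_convexHull ℝ _ hv⟩

theorem mink_nonpos_of_mem_carrier {n x : E} (hn : ∀ v ∈ X.vertices, mink n v ≤ 0)
    (hx : x ∈ X.carrier) : mink n x ≤ 0 := by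
  obtain ⟨r, w, hr, h0, -, h2⟩ := exists_weights_of_mem_carrier hx
  have h3 := congrArg (mink n) h2
  rw [mink_sum_right, mink_smul_right] at h3
  have h4 : ∑ v ∈ X.vertices, mink n (w v • v) ≤ 0 := by
    apply Finset.sum_nonpos
    intro v hv
    rw [mink_smul_right]
    exact mul_nonpos_of_nonneg_of_nonpos (h0 v hv) (hn v hv)
  rw [h3] at h4
  exact nonpos_of_mul_nonpos_right h4 hr

/-- A point of the polyhedron on a supporting plane is in the hull of the vertices on that plane;
if a functional vanishes at that point, it does not have a strict sign on these vertices. -/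
theorem exists_vertex_mink_nonneg {n m x : E} (hn : ∀ v ∈ X.vertices, mink n v ≤ 0)
    (hx : x ∈ X.carrier) (hnx : mink n x = 0) (hmx : 0 ≤ mink m x) :
    ∃ v ∈ X.vertices, mink n v = 0 ∧ 0 ≤ mink m v := by
  obtain ⟨r, w, hr, h0, h1, h2⟩ := exists_weights_of_mem_carrier hx
  by_contra hcon
  push Not at hcon
  have h3 := congrArg (mink n) h2
  rw [mink_sum_right, mink_smul_right, hnx, mul_zero] at h3
  have h4 : ∀ v ∈ X.vertices, w v * mink n v = 0 := by
    have := (Finset.sum_eq_zero_iff_of_nonpos (fun v hv => by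
      rw [mink_smul_right]
      exact mul_nonpos_of_nonneg_of_nonpos (h0 v hv) (hn v hv))).1 h3
    intro v hv
    rw [← mink_smul_right]
    exact this v hv
  have h5 := congrArg (mink m) h2
  rw [mink_sum_right, mink_smul_right] at h5
  obtain ⟨u, hu, hu0⟩ : ∃ u ∈ X.vertices, w u ≠ 0 := by
    by_contra hall
    push Not at hall
    rw [Finset.sum_eq_zero hall] at h1
    exact zero_ne_one h1
  have hvan : ∀ v ∈ X.vertices, w v ≠ 0 → mink m v < 0 := fun v hv hv0 =>
    hcon v hv ((mul_eq_zero.1 (h4 v hv)).resolve_left hv0)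
  have h6 : ∑ v ∈ X.vertices, mink m (w v • v) < ∑ v ∈ X.vertices, (0 : ℝ) := by
    apply Finset.sum_lt_sum
    · intro v hv
      rw [mink_smul_right]
      rcases eq_or_ne (w v) 0 with h | h
      · rw [h, zero_mul]
      · exact mul_nonpos_of_nonneg_of_nonpos (h0 v hv) (hvan v hv h).le
    · refine ⟨u, hu, ?_⟩
      rw [mink_smul_right]
      exact mul_neg_of_pos_of_neg (lt_of_le_of_ne (h0 u hu) hu0.symm) (hvan u hu hu0)
  rw [h5, Finset.sum_const_zero] at h6
  have := mul_nonneg hr.le hmx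
  linarith

theorem exists_vertex_mink_ne_zero {n : E} (hn : n ≠ 0) : ∃ v ∈ X.vertices, mink n v ≠ 0 := by
  by_contra hcon
  push Not at hcon
  exact hn (eq_zero_of_span_eq_top X.full hcon)

theorem vertices_nonempty (X : ConvexPolyhedron) : X.vertices.Nonempty := by
  obtain ⟨v, hv, -⟩ := X.exists_vertex_mink_ne_zero (n := ![1, 0, 0, 0]) (by
    intro h
    simpa using congrFun h 0)
  exact ⟨v, hv⟩

namespace Face

theorem normal_ne_zero (F : X.Face) : F.normal ≠ 0 := by
  intro h
  have := F.unit
  rw [h, mink_zero_left] at this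
  norm_num at this

theorem exists_vertex (F : X.Face) : ∃ v ∈ X.vertices, mink F.normal v = 0 := by
  by_contra hcon
  push Not at hcon
  have h := F.dim
  rw [show {v : E | v ∈ X.vertices ∧ mink F.normal v = 0} = ∅ by
    ext v; simp only [Set.mem_ofPred_eq, Set.mem_empty_iff_false, iff_false]
    rintro ⟨h1, h2⟩; exact hcon v h1 h2] at h
  rw [Submodule.span_empty, finrank_bot] at h
  omega

/-- A functional that vanishes at the vertices of a face is a multiple of its normal. -/
theorem exists_eq_smul_normal (F : X.Face) {f : E}
    (hf : ∀ v ∈ X.vertices, mink F.normal v = 0 → mink f v = 0) : ∃ r : ℝ, f = r • F.normal := by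
  obtain ⟨v₀, hv₀, hne⟩ := X.exists_vertex_mink_ne_zero F.normal_ne_zero
  refine ⟨mink f v₀ / mink F.normal v₀, ?_⟩
  rw [← sub_eq_zero]
  set g := f - (mink f v₀ / mink F.normal v₀) • F.normal with hg
  set V := Submodule.span ℝ {v : E | v ∈ X.vertices ∧ mink F.normal v = 0}
  have hV : V < ⊤ := by
    apply lt_top_iff_ne_top.2
    intro h
    have := F.dim
    change Module.finrank ℝ V = 3 at this
    rw [h, finrank_top, Module.finrank_fintype_fun_eq_card] at this
    simp at this
  have hker : V ≤ LinearMap.ker (minkLin g) := by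
    rw [Submodule.span_le]
    rintro v ⟨hv, hv0⟩
    simp [hg, mink_sub_left, mink_smul_left, hv0, hf v hv hv0]
  have hlt : V < LinearMap.ker (minkLin g) := by
    refine lt_of_le_of_ne hker ?_
    intro h
    have h1 : v₀ ∈ LinearMap.ker (minkLin g) := by
      simp only [LinearMap.mem_ker, minkLin_apply, hg, mink_sub_left, mink_smul_left]
      field_simp
      ring
    rw [← h] at h1
    exact hne (mink_eq_zero_of_mem_span (fun v hv => hv.2) h1)
  have h3 := Submodule.finrank_lt_finrank_of_lt hlt
  rw [show Module.finrank ℝ V = 3 from F.dim] at h3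
  have h4 : LinearMap.ker (minkLin g) = ⊤ := by
    apply Submodule.eq_top_of_finrank_eq
    have := Submodule.finrank_le (LinearMap.ker (minkLin g))
    rw [Module.finrank_fintype_fun_eq_card] at this ⊢
    simp at this ⊢
    omega
  apply eq_zero_of_mink_eq_zero
  intro x
  have : x ∈ LinearMap.ker (minkLin g) := h4 ▸ Submodule.mem_top
  simpa using this

theorem eq_of_smul {F G : X.Face} {r : ℝ} (h : G.normal = r • F.normal) : F = G := by
  obtain ⟨v, hv, hne⟩ := X.exists_vertex_mink_ne_zero F.normal_ne_zero
  have h1 := F.supporting v hv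
  have h2 := G.supporting v hv
  have h3 := G.unit
  rw [h, mink_smul_left] at h2
  rw [h, mink_smul_left, mink_smul_right, F.unit] at h3
  have h4 : mink F.normal v < 0 := lt_of_le_of_ne h1 hne
  have h5 : r = 1 := by nlinarith
  apply Face.ext
  rw [h, h5, one_smul]

theorem eq_of_forall_vertex {F G : X.Face}
    (h : ∀ v ∈ X.vertices, mink F.normal v = 0 → mink G.normal v = 0) : F = G := by
  obtain ⟨r, hr⟩ := F.exists_eq_smul_normal h
  exact eq_of_smul hr

theorem exists_vertex_ne {F G : X.Face} (h : F ≠ G) :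
    ∃ v ∈ X.vertices, mink F.normal v = 0 ∧ mink G.normal v ≠ 0 := by
  by_contra hcon
  push Not at hcon
  exact h (eq_of_forall_vertex hcon)

theorem injective_vertexSet : Function.Injective (fun F : X.Face =>
    (⟨{v ∈ X.vertices | mink F.normal v = 0}, by simp⟩ : X.vertices.powerset)) := by
  intro F G h
  apply eq_of_forall_vertex
  intro v hv hv0
  have h1 := congrArg Subtype.val h
  have h2 : v ∈ {v ∈ X.vertices | mink F.normal v = 0} := mem_filter.2 ⟨hv, hv0⟩
  simp only at h1
  rw [h1] at h2
  exact (mem_filter.1 h2).2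

instance : Finite X.Face := Finite.of_injective _ injective_vertexSet

theorem card_le (X : ConvexPolyhedron) : Nat.card X.Face ≤ 2 ^ X.vertices.card := by
  have := Nat.card_le_card_of_injective _ (injective_vertexSet (X := X))
  rwa [Nat.card_eq_fintype_card (α := X.vertices.powerset), Fintype.card_coe, card_powerset]
    at this

/-- A supporting functional whose zeros among the vertices span three dimensions is, up to scale,
the normal of a face. -/
theorem exists_of_support {n v : E} (hn : n ≠ 0) (hle : ∀ v ∈ X.vertices, mink n v ≤ 0)
    (hv : v ∈ X.vertices) (hnv : mink n v = 0) (y : Fin 3 → E) (hy : LinearIndependent ℝ y)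
    (hspan : ∀ i, y i ∈ Submodule.span ℝ {v : E | v ∈ X.vertices ∧ mink n v = 0}) :
    ∃ (G : X.Face) (μ : ℝ), 0 < μ ∧ G.normal = μ • n := by
  have hpos := mink_self_pos_of_orth (mink_self_lt_zero (X.mem_H3 v hv))
    (mink_comm v n ▸ hnv : mink v n = 0) hn
  obtain ⟨r, hr, hrn⟩ := exists_unit_scale hpos
  have hset : {v : E | v ∈ X.vertices ∧ mink (r • n) v = 0} =
      {v : E | v ∈ X.vertices ∧ mink n v = 0} := by
    ext v
    simp only [Set.mem_ofPred_eq, mink_smul_left, mul_eq_zero, hr.ne', false_or]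
  refine ⟨⟨r • n, by rw [mink_smul_left, mink_smul_right, hrn], ?_, ?_⟩, r, hr, rfl⟩
  · intro v hv
    rw [mink_smul_left]
    exact mul_nonpos_of_nonneg_of_nonpos hr.le (hle v hv)
  · rw [hset]
    set V := Submodule.span ℝ {v : E | v ∈ X.vertices ∧ mink n v = 0} with hV
    have h1 : 3 ≤ Module.finrank ℝ V := by
      have h2 : LinearIndependent ℝ (fun i => (⟨y i, hspan i⟩ : V)) :=
        LinearIndependent.of_comp V.subtype hy
      simpa using h2.fintype_card_le_finrank
    have h2 : V < ⊤ := by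
      apply lt_top_iff_ne_top.2
      intro h
      apply hn
      apply eq_zero_of_mink_eq_zero
      intro x
      exact mink_eq_zero_of_mem_span (fun v hv => hv.2)
        (show x ∈ V from h ▸ Submodule.mem_top)
    have h3 := Submodule.finrank_lt h2.ne
    rw [Module.finrank_fintype_fun_eq_card] at h3
    simp at h3
    omega

theorem Adj.symm {F G : X.Face} (h : F.Adj G) : G.Adj F := by
  rw [Adj] at h ⊢
  rw [← h, show {v : E | v ∈ X.vertices ∧ mink G.normal v = 0 ∧ mink F.normal v = 0} =
    {v : E | v ∈ X.vertices ∧ mink F.normal v = 0 ∧ mink G.normal v = 0} by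
      ext v; exact and_congr_right fun _ => and_comm]

theorem Adj.ne {F G : X.Face} (h : F.Adj G) : F ≠ G := by
  rintro rfl
  have h1 := F.dim
  rw [Adj, show {v : E | v ∈ X.vertices ∧ mink F.normal v = 0 ∧ mink F.normal v = 0} =
    {v : E | v ∈ X.vertices ∧ mink F.normal v = 0} by
      ext v; exact and_congr_right fun _ => and_self_iff] at h
  omega

theorem Adj.exists_vertex_ne {F G : X.Face} (h : F.Adj G) (v : E) :
    ∃ w ∈ X.vertices, w ≠ v ∧ mink F.normal w = 0 ∧ mink G.normal w = 0 := by
  by_contra hcon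
  push Not at hcon
  have h1 : Submodule.span ℝ {v : E | v ∈ X.vertices ∧ mink F.normal v = 0 ∧
      mink G.normal v = 0} ≤ Submodule.span ℝ {v} := by
    apply Submodule.span_mono
    rintro w ⟨hw, hF, hG⟩
    by_contra hne
    exact hcon w hw hne hF hG
  have h2 := Submodule.finrank_mono h1
  have h3 := finrank_span_le_card (R := ℝ) ({v} : Set E)
  rw [h] at h2
  simp at h3
  omega

theorem adj_of_vertices {F G : X.Face} (hne : F ≠ G) {v w : E} (hv : v ∈ X.vertices)
    (hw : w ∈ X.vertices) (hvw : v ≠ w) (hFv : mink F.normal v = 0) (hFw : mink F.normal w = 0)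
    (hGv : mink G.normal v = 0) (hGw : mink G.normal w = 0) : F.Adj G := by
  rw [Adj]
  set W := Submodule.span ℝ {v : E | v ∈ X.vertices ∧ mink F.normal v = 0 ∧
    mink G.normal v = 0} with hW
  have hv' : v ∈ W := Submodule.subset_span ⟨hv, hFv, hGv⟩
  have hw' : w ∈ W := Submodule.subset_span ⟨hw, hFw, hGw⟩
  have h1 : 2 ≤ Module.finrank ℝ W := by
    have hv0 : v ≠ 0 := by
      rintro rfl
      exact absurd (X.mem_H3 0 hv).2 (by simp)
    have h2 : LinearIndependent ℝ ![(⟨v, hv'⟩ : W), ⟨w, hw'⟩] := by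
      rw [LinearIndependent.pair_iff' (by simpa [Subtype.ext_iff] using hv0)]
      intro a ha
      exact ne_smul_of_ne (X.mem_H3 v hv) (X.mem_H3 w hw) hvw a (congrArg Subtype.val ha).symm
    simpa using h2.fintype_card_le_finrank
  obtain ⟨u, hu, hFu, hGu⟩ := exists_vertex_ne hne
  have h2 : W < Submodule.span ℝ {v : E | v ∈ X.vertices ∧ mink F.normal v = 0} := by
    refine lt_of_le_of_ne (Submodule.span_mono fun x hx => ⟨hx.1, hx.2.1⟩) ?_
    intro h
    have : u ∈ W := h ▸ Submodule.subset_span ⟨hu, hFu⟩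
    exact hGu (mink_eq_zero_of_mem_span (fun x hx => hx.2.2) this)
  have h3 := Submodule.finrank_lt_finrank_of_lt h2
  rw [F.dim] at h3
  omega

/-- Three different faces do not share two vertices. -/
theorem false_of_three_faces (F : Fin 3 → X.Face) (hF : Function.Injective F) {v w : E}
    (hv : v ∈ X.vertices) (hw : w ∈ X.vertices) (hvw : v ≠ w)
    (hFv : ∀ i, mink (F i).normal v = 0) (hFw : ∀ i, mink (F i).normal w = 0) : False := by
  have Hv := X.mem_H3 v hv
  have Hw := X.mem_H3 w hw
  obtain ⟨r, hr, hrr⟩ := exists_unit_scale (mink_self_pos_of_orth (mink_self_lt_zero Hv)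
    (mink_proj_right Hv w) (proj_ne_zero Hv Hw hvw))
  obtain ⟨e₁, e₂, fr⟩ := exists_isFrame (c := v) (m := r • proj v w) Hv.1
    (by rw [mink_smul_left, mink_smul_right, hrr])
    (by rw [mink_smul_right, mink_proj_right Hv, mul_zero])
  obtain ⟨a, ha0, ha⟩ := exists_linear_relation
    (fun i : Fin 3 => ![mink e₁ (F i).normal, mink e₂ (F i).normal])
  apply ha0
  apply relation_eq_zero_of_support (fun i => (F i).normal) (X.vertices : Set E)
  · exact fun i x hx => (F i).supporting x hx
  · exact fun i => X.exists_vertex_mink_ne_zero (F i).normal_ne_zero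
  · intro i j hij
    exact exists_vertex_ne (hF.ne hij)
  · intro x _
    have h1 := ha 0
    have h2 := ha 1
    simp only [Matrix.cons_val_zero, Matrix.cons_val_one] at h1 h2
    have h3 : ∀ i, mink (F i).normal x = mink e₁ (F i).normal * mink e₁ x +
        mink e₂ (F i).normal * mink e₂ x := by
      intro i
      rw [fr.mink_eq, mink_comm v, hFv i, mink_smul_left, mink_comm (proj v w),
        mink_proj_of_orth (hFv i), hFw i]
      ring
    simp only [h3, mul_add, Finset.sum_add_distrib, ← mul_assoc, ← Finset.sum_mul, h1, h2,
      zero_mul, add_zero]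

/-- Three different edges of a face do not share a vertex. -/
theorem false_of_three_edges {F : X.Face} (G : Fin 3 → X.Face) (hG : Function.Injective G)
    (hadj : ∀ i, F.Adj (G i)) {v : E} (hv : v ∈ X.vertices) (hFv : mink F.normal v = 0)
    (hGv : ∀ i, mink (G i).normal v = 0) : False := by
  have Hv := X.mem_H3 v hv
  obtain ⟨e₁, e₂, fr⟩ := exists_isFrame (c := v) (m := F.normal) Hv.1 F.unit
    (mink_comm v _ ▸ hFv)
  obtain ⟨a, ha0, ha⟩ := exists_linear_relation
    (fun i : Fin 3 => ![mink e₁ (G i).normal, mink e₂ (G i).normal])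
  apply ha0
  apply relation_eq_zero_of_support (fun i => (G i).normal)
    {v : E | v ∈ X.vertices ∧ mink F.normal v = 0}
  · exact fun i x hx => (G i).supporting x hx.1
  · intro i
    obtain ⟨u, hu, h1, h2⟩ := exists_vertex_ne (hadj i).ne
    exact ⟨u, ⟨hu, h1⟩, h2⟩
  · intro i j hij
    by_contra hcon
    push Not at hcon
    obtain ⟨w, hw, hwv, h1, h2⟩ := (hadj i).exists_vertex_ne v
    refine false_of_three_faces ![F, G i, G j] (injective_vec_three (hadj i).ne (hadj j).ne
      (hG.ne hij)) hv hw hwv.symm ?_ ?_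
    · intro p
      fin_cases p <;> simp [hFv, hGv]
    · intro p
      fin_cases p <;> simp [h1, h2, hcon w ⟨hw, h1⟩ h2]
  · intro x hx
    have h1 := ha 0
    have h2 := ha 1
    simp only [Matrix.cons_val_zero, Matrix.cons_val_one] at h1 h2
    have h3 : ∀ i, mink (G i).normal x = mink e₁ (G i).normal * mink e₁ x +
        mink e₂ (G i).normal * mink e₂ x := by
      intro i
      rw [fr.mink_eq, mink_comm v, hGv i, hx.2]
      ring
    simp only [h3, mul_add, Finset.sum_add_distrib, ← mul_assoc, ← Finset.sum_mul, h1, h2,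
      zero_mul, add_zero]

end Face

end ConvexPolyhedron

/-! ### Slabs without vertices and the faces that cross them -/

theorem linearIndependent_of_ne_smul {x y z m : E} (hx : x ≠ 0) (hxy : ∀ r : ℝ, y ≠ r • x)
    (hmx : mink m x = 0) (hmy : mink m y = 0) (hmz : mink m z ≠ 0) :
    LinearIndependent ℝ ![x, y, z] := by
  rw [Fintype.linearIndependent_iff]
  intro g hg
  rw [Fin.sum_univ_three] at hg
  simp only [Matrix.cons_val_zero, Matrix.cons_val_one, Matrix.cons_val] at hg
  have h1 := congrArg (mink m) hg
  simp only [mink_add_right, mink_smul_right, hmx, hmy, mul_zero, zero_add, mink_zero_right] at h1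
  have h2 : g 2 = 0 := (mul_eq_zero.1 h1).resolve_right hmz
  rw [h2, zero_smul, add_zero] at hg
  have h3 : g 1 = 0 := by
    by_contra h
    apply hxy (-(g 0) / g 1)
    have h4 : g 1 • y = -(g 0) • x := by
      rw [neg_smul, eq_neg_iff_add_eq_zero, add_comm]; exact hg
    rw [div_eq_inv_mul, mul_smul, ← h4, smul_smul, inv_mul_cancel₀ h, one_smul]
  rw [h3, zero_smul, add_zero] at hg
  have h4 : g 0 = 0 := (smul_eq_zero.1 hg).resolve_right hx
  intro i
  fin_cases i <;> assumption

/-- A positive multiple of the point where the segment from `t` to `b` crosses the plane with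
normal `m`, for points `t`, `b` on different sides of the plane. -/
def cross (m t b : E) : E := mink m t • b - mink m b • t

theorem mink_cross (n m t b : E) :
    mink n (cross m t b) = mink m t * mink n b - mink m b * mink n t := by
  rw [cross, mink_sub_right, mink_smul_right, mink_smul_right]

theorem mink_cross_self (m t b : E) : mink m (cross m t b) = 0 := by
  rw [mink_cross]; ring

theorem mink_cross_neg {n m t b : E} (ht : 0 < mink m t) (hb : mink m b < 0)
    (hnt : mink n t < 0) (hnb : mink n b < 0) : mink n (cross m t b) < 0 := by
  rw [mink_cross]
  nlinarith [mul_pos ht (neg_pos.2 hnb), mul_pos (neg_pos.2 hb) (neg_pos.2 hnt)]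

theorem mink_cross_nonpos {n m t b : E} (ht : 0 < mink m t) (hb : mink m b < 0)
    (hnt : mink n t ≤ 0) (hnb : mink n b ≤ 0) : mink n (cross m t b) ≤ 0 := by
  rw [mink_cross]
  nlinarith [mul_nonneg ht.le (neg_nonneg.2 hnb), mul_nonneg (neg_pos.2 hb).le (neg_nonneg.2 hnt)]

theorem mink_cross_eq_zero {n m t b : E} (ht : 0 < mink m t) (hb : mink m b < 0)
    (hnt : mink n t ≤ 0) (hnb : mink n b ≤ 0) (h : mink n (cross m t b) = 0) :
    mink n t = 0 ∧ mink n b = 0 := by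
  rw [mink_cross] at h
  have h1 := mul_nonneg ht.le (neg_nonneg.2 hnb)
  have h2 := mul_nonneg (neg_pos.2 hb).le (neg_nonneg.2 hnt)
  have h3 : mink m t * mink n b = 0 := by linarith
  have h4 : mink m b * mink n t = 0 := by linarith
  exact ⟨(mul_eq_zero.1 h4).resolve_left hb.ne, (mul_eq_zero.1 h3).resolve_left ht.ne'⟩

namespace ConvexPolyhedron

variable {X : ConvexPolyhedron}

/-- The plane through `c` with unit normal `m` cuts the polyhedron, and no vertex lies strictly
within the slab between the two planes orthogonal to the common perpendicular `(c, m)` at distance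
`h` from it. In terms of `c` and `m`, a point `v` is outside the slab if
`|⟨m, v⟩| ≥ tanh h * (-⟨c, v⟩)`. -/
structure IsEmptySlab (X : ConvexPolyhedron) (c m : E) (h : ℝ) : Prop where
  center : c ∈ H3
  unit : mink m m = 1
  orth : mink c m = 0
  pos : 0 < h
  empty : ∀ v ∈ X.vertices, Real.sinh h * -mink c v ≤ Real.cosh h * |mink m v|
  above : ∃ v ∈ X.vertices, 0 < mink m v
  below : ∃ v ∈ X.vertices, mink m v < 0

/-- The face has vertices on both sides of the plane with normal `m`. -/
def Face.Crosses (F : X.Face) (m : E) : Prop :=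
  (∃ v ∈ X.vertices, mink F.normal v = 0 ∧ 0 < mink m v) ∧
    ∃ v ∈ X.vertices, mink F.normal v = 0 ∧ mink m v < 0

/-- The edge shared by two faces has vertices on both sides of the plane with normal `m`. -/
def Face.EdgeCrosses (F G : X.Face) (m : E) : Prop :=
  (∃ v ∈ X.vertices, mink F.normal v = 0 ∧ mink G.normal v = 0 ∧ 0 < mink m v) ∧
    ∃ v ∈ X.vertices, mink F.normal v = 0 ∧ mink G.normal v = 0 ∧ mink m v < 0

theorem Face.EdgeCrosses.symm {F G : X.Face} {m : E} (h : F.EdgeCrosses G m) :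
    G.EdgeCrosses F m := by
  obtain ⟨⟨t, h1, h2, h3, h4⟩, b, h5, h6, h7, h8⟩ := h
  exact ⟨⟨t, h1, h3, h2, h4⟩, b, h5, h7, h6, h8⟩

theorem Face.EdgeCrosses.neg {F G : X.Face} {m : E} (h : F.EdgeCrosses G m) :
    F.EdgeCrosses G (-m) := by
  obtain ⟨⟨t, h1, h2, h3, h4⟩, b, h5, h6, h7, h8⟩ := h
  exact ⟨⟨b, h5, h6, h7, by rw [mink_neg_left]; linarith⟩,
    t, h1, h2, h3, by rw [mink_neg_left]; linarith⟩

/-- A convex combination of two vertices on different sides of a plane lies on it. -/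
theorem exists_mem_carrier_cross {m t b : E} (ht : t ∈ X.vertices) (hb : b ∈ X.vertices)
    (hmt : 0 < mink m t) (hmb : mink m b < 0) :
    ∃ x ∈ X.carrier, ∃ r : ℝ, 0 < r ∧ x = r • cross m t b := by
  have Ht := X.mem_H3 t ht
  have Hb := X.mem_H3 b hb
  have h1 : mink t (cross m t b) < 0 :=
    mink_cross_neg hmt hmb (mink_self_lt_zero Ht) (mink_lt_zero Ht Hb)
  have h2 : mink b (cross m t b) < 0 :=
    mink_cross_neg hmt hmb (mink_lt_zero Hb Ht) (mink_self_lt_zero Hb)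
  have h3 : mink (cross m t b) (cross m t b) < 0 :=
    mink_cross_neg hmt hmb (by rwa [mink_comm]) (by rwa [mink_comm])
  obtain ⟨r, hr, hrx⟩ := exists_smul_mem_H3 Ht h3 h1
  refine ⟨_, ⟨hrx, (r * (mink m t - mink m b))⁻¹, inv_pos.2 (mul_pos hr (by linarith)), ?_⟩,
    r, hr, rfl⟩
  have hd : 0 < mink m t - mink m b := by linarith
  have h4 : (r * (mink m t - mink m b))⁻¹ • r • cross m t b =
      (mink m t / (mink m t - mink m b)) • b + (-mink m b / (mink m t - mink m b)) • t := by
    rw [cross, smul_smul, mul_inv, mul_comm r⁻¹, mul_assoc, inv_mul_cancel₀ hr.ne', mul_one,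
      smul_sub, smul_smul, smul_smul, sub_eq_add_neg, ← neg_smul, div_eq_inv_mul, div_eq_inv_mul,
      mul_neg]
  rw [h4]
  apply convex_convexHull ℝ _ (subset_convexHull ℝ _ hb) (subset_convexHull ℝ _ ht)
  · exact div_nonneg hmt.le hd.le
  · exact div_nonneg (by linarith) hd.le
  · field_simp; ring

namespace IsEmptySlab

variable {c m : E} {h : ℝ}

theorem neg (S : X.IsEmptySlab c m h) : X.IsEmptySlab c (-m) h where
  center := S.center
  unit := by rw [mink_neg_left, mink_neg_right, neg_neg, S.unit]
  orth := by rw [mink_neg_right, S.orth, neg_zero]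
  pos := S.pos
  empty v hv := by rw [mink_neg_left, abs_neg]; exact S.empty v hv
  above := by
    obtain ⟨v, hv, hmv⟩ := S.below
    exact ⟨v, hv, by rw [mink_neg_left]; linarith⟩
  below := by
    obtain ⟨v, hv, hmv⟩ := S.above
    exact ⟨v, hv, by rw [mink_neg_left]; linarith⟩

theorem center_neg (S : X.IsEmptySlab c m h) {v : E} (hv : v ∈ X.vertices) : mink c v < 0 :=
  mink_lt_zero S.center (X.mem_H3 v hv)

theorem ne_zero (S : X.IsEmptySlab c m h) {v : E} (hv : v ∈ X.vertices) : mink m v ≠ 0 := by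
  intro h0
  have h1 := S.empty v hv
  rw [h0, abs_zero, mul_zero] at h1
  have h2 := Real.sinh_pos_iff.2 S.pos
  have h3 := S.center_neg hv
  nlinarith

theorem above_le (S : X.IsEmptySlab c m h) {v : E} (hv : v ∈ X.vertices) (hmv : 0 < mink m v) :
    Real.sinh h * -mink c v ≤ Real.cosh h * mink m v := by
  have := S.empty v hv
  rwa [abs_of_pos hmv] at this

theorem le_below (S : X.IsEmptySlab c m h) {v : E} (hv : v ∈ X.vertices) (hmv : mink m v < 0) :
    Real.cosh h * mink m v ≤ Real.sinh h * mink c v := by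
  have := S.empty v hv
  rw [abs_of_neg hmv] at this
  linarith

theorem crosses_iff (S : X.IsEmptySlab c m h) (G : X.Face) :
    G.Crosses m ↔ ∃ x ∈ G.carrier, mink m x = 0 := by
  constructor
  · rintro ⟨⟨t, ht, hGt, hmt⟩, b, hb, hGb, hmb⟩
    obtain ⟨x, hx, r, -, rfl⟩ := exists_mem_carrier_cross ht hb hmt hmb
    refine ⟨_, ⟨hx, ?_⟩, ?_⟩
    · rw [mink_smul_right, mink_cross, hGt, hGb]; ring
    · rw [mink_smul_right, mink_cross_self, mul_zero]
  · rintro ⟨x, ⟨hx, hGx⟩, hmx⟩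
    obtain ⟨t, ht, hGt, hmt⟩ := exists_vertex_mink_nonneg G.supporting hx hGx hmx.ge
    obtain ⟨b, hb, hGb, hmb⟩ := exists_vertex_mink_nonneg (m := -m) G.supporting hx hGx
      (by rw [mink_neg_left, hmx, neg_zero])
    rw [mink_neg_left] at hmb
    exact ⟨⟨t, ht, hGt, lt_of_le_of_ne hmt (S.ne_zero ht).symm⟩,
      b, hb, hGb, lt_of_le_of_ne (by linarith) (S.ne_zero hb)⟩

/-- A functional that vanishes at all crossing points differs from one that vanishes at all
vertices by a multiple of `⟨m, ·⟩`. -/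
theorem eq_zero_of_cross (S : X.IsEmptySlab c m h) {f : E} (hf : mink m f = 0)
    (h0 : ∀ t ∈ X.vertices, ∀ b ∈ X.vertices, 0 < mink m t → mink m b < 0 →
      mink f (cross m t b) = 0) : f = 0 := by
  obtain ⟨t₀, ht₀, hmt₀⟩ := S.above
  obtain ⟨b₀, hb₀, hmb₀⟩ := S.below
  set r := -mink f t₀ / mink m t₀ with hr
  have hb : ∀ b ∈ X.vertices, mink m b < 0 → mink f b + r * mink m b = 0 := by
    intro b hb hmb
    have h1 := h0 t₀ ht₀ b hb hmt₀ hmb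
    rw [mink_cross] at h1
    rw [hr]
    field_simp
    linarith
  have ht : ∀ t ∈ X.vertices, 0 < mink m t → mink f t + r * mink m t = 0 := by
    intro t ht hmt
    have h1 := h0 t ht b₀ hb₀ hmt hmb₀
    have h2 := hb b₀ hb₀ hmb₀
    rw [mink_cross] at h1
    have h3 : mink m b₀ * (mink f t + r * mink m t) = 0 := by
      linear_combination mink m t * h2 - h1
    exact (mul_eq_zero.1 h3).resolve_left hmb₀.ne
  have hg : f + r • m = 0 := by
    apply eq_zero_of_span_eq_top X.full
    intro v hv
    rw [mink_add_left, mink_smul_left]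
    rcases lt_or_gt_of_ne (S.ne_zero hv) with h | h
    · exact hb v hv h
    · exact ht v hv h
  have h1 := congrArg (mink m) hg
  rw [mink_add_right, mink_smul_right, hf, S.unit, mink_zero_right] at h1
  have h2 : r = 0 := by linarith
  rwa [h2, zero_smul, add_zero] at hg

/-- A supporting line of the section of the polyhedron by the middle plane of the slab extends to a
supporting plane of the polyhedron. -/
theorem exists_supporting_extension (S : X.IsEmptySlab c m h) {f : E}
    (hf : ∀ t ∈ X.vertices, ∀ b ∈ X.vertices, 0 < mink m t → mink m b < 0 →
      mink f (cross m t b) ≤ 0) : ∃ r : ℝ, ∀ v ∈ X.vertices, mink (f + r • m) v ≤ 0 := by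
  classical
  obtain ⟨b, hb, hmax⟩ := exists_max_image (X.vertices.filter fun v => mink m v < 0)
    (fun v => mink f v / -mink m v) (by
      obtain ⟨v, hv, hmv⟩ := S.below
      exact ⟨v, mem_filter.2 ⟨hv, hmv⟩⟩)
  obtain ⟨hbv, hmb⟩ := mem_filter.1 hb
  refine ⟨mink f b / -mink m b, ?_⟩
  intro v hv
  rw [mink_add_left, mink_smul_left]
  rcases lt_or_gt_of_ne (S.ne_zero hv) with h1 | h1
  · have h2 := hmax v (mem_filter.2 ⟨hv, h1⟩)
    rw [div_le_iff₀ (by linarith)] at h2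
    linarith
  · have h2 := hf v hv b hbv h1 hmb
    rw [mink_cross] at h2
    have h3 : 0 < -mink m b := by linarith
    have h4 : -mink m b * (mink f v + mink f b / -mink m b * mink m v) =
        mink m v * mink f b - mink m b * mink f v := by
      have : mink m b ≠ 0 := hmb.ne
      field_simp
      ring
    exact nonpos_of_mul_nonpos_right (h4 ▸ h2) h3

theorem exists_two_cross (S : X.IsEmptySlab c m h) {F : X.Face} (hF : F.Crosses m) :
    ∃ t₁ ∈ X.vertices, ∃ b₁ ∈ X.vertices, ∃ t₂ ∈ X.vertices, ∃ b₂ ∈ X.vertices,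
      0 < mink m t₁ ∧ mink m b₁ < 0 ∧ 0 < mink m t₂ ∧ mink m b₂ < 0 ∧
      mink F.normal t₁ = 0 ∧ mink F.normal b₁ = 0 ∧ mink F.normal t₂ = 0 ∧
      mink F.normal b₂ = 0 ∧ ∀ r : ℝ, cross m t₂ b₂ ≠ r • cross m t₁ b₁ := by
  classical
  obtain ⟨⟨t, ht, hFt, hmt⟩, b, hb, hFb, hmb⟩ := hF
  by_contra hcon
  push Not at hcon
  have hall : ∀ t' ∈ X.vertices, ∀ b' ∈ X.vertices, 0 < mink m t' → mink m b' < 0 →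
      mink F.normal t' = 0 → mink F.normal b' = 0 → ∃ r : ℝ, cross m t' b' = r • cross m t b :=
    fun t' ht' b' hb' h1 h2 h3 h4 => hcon t ht b hb t' ht' b' hb' hmt hmb h1 h2 hFt hFb h3 h4
  have hspan : Submodule.span ℝ {v : E | v ∈ X.vertices ∧ mink F.normal v = 0} ≤
      Submodule.span ℝ (({t, b} : Finset E) : Set E) := by
    rw [Submodule.span_le]
    rintro v ⟨hv, hFv⟩
    have hts : t ∈ Submodule.span ℝ (({t, b} : Finset E) : Set E) :=
      Submodule.subset_span (by simp)
    have hbs : b ∈ Submodule.span ℝ (({t, b} : Finset E) : Set E) :=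
      Submodule.subset_span (by simp)
    have hx : cross m t b ∈ Submodule.span ℝ (({t, b} : Finset E) : Set E) :=
      Submodule.sub_mem _ (Submodule.smul_mem _ _ hbs) (Submodule.smul_mem _ _ hts)
    rcases lt_or_gt_of_ne (S.ne_zero hv) with h1 | h1
    · obtain ⟨r, hr⟩ := hall t ht v hv hmt h1 hFt hFv
      have : v = (mink m t)⁻¹ • (r • cross m t b + mink m v • t) := by
        rw [← hr, cross, sub_add_cancel, smul_smul, inv_mul_cancel₀ hmt.ne', one_smul]
      rw [this]
      exact Submodule.smul_mem _ _ (Submodule.add_mem _ (Submodule.smul_mem _ _ hx)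
        (Submodule.smul_mem _ _ hts))
    · obtain ⟨r, hr⟩ := hall v hv b hb h1 hmb hFv hFb
      have : v = (mink m b)⁻¹ • (mink m v • b - r • cross m t b) := by
        rw [← hr, cross, sub_sub_cancel, smul_smul, inv_mul_cancel₀ hmb.ne, one_smul]
      rw [this]
      exact Submodule.smul_mem _ _ (Submodule.sub_mem _ (Submodule.smul_mem _ _ hbs)
        (Submodule.smul_mem _ _ hx))
  have h1 := Submodule.finrank_mono hspan
  have h2 := finrank_span_finset_le_card (R := ℝ) ({t, b} : Finset E)
  have h3 : #({t, b} : Finset E) ≤ 2 := card_le_two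
  rw [F.dim] at h1
  have h4 : Set.finrank ℝ (({t, b} : Finset E) : Set E) =
    Module.finrank ℝ (Submodule.span ℝ (({t, b} : Finset E) : Set E)) := rfl
  omega

/-- The faces that cross the middle plane of the slab in their cyclic order; the angles between
consecutive ones, measured in the projective chart of this plane centered at `c`, add up to
`2 π`. -/
theorem exists_cycle (S : X.IsEmptySlab c m h) {e₁ e₂ : E} (fr : IsFrame c e₁ e₂ m) :
    ∃ (k : ℕ) (F : Fin k → X.Face) (gap : Fin k → ℝ), 3 ≤ k ∧ Function.Injective F ∧
      (∀ G, (∃ i, F i = G) ↔ G.Crosses m) ∧ (∀ i, 0 < gap i ∧ gap i < Real.pi) ∧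
      ∑ i, gap i = 2 * Real.pi ∧ (∀ i, (F i).EdgeCrosses (F (finRotate k i)) m) ∧
      ∀ i, mink e₁ (F i).normal * mink e₁ (F (finRotate k i)).normal +
          mink e₂ (F i).normal * mink e₂ (F (finRotate k i)).normal =
        √(mink e₁ (F i).normal ^ 2 + mink e₂ (F i).normal ^ 2) *
          √(mink e₁ (F (finRotate k i)).normal ^ 2 + mink e₂ (F (finRotate k i)).normal ^ 2) *
          Real.cos (gap i) := by
  classical
  let I : Finset E := ((X.vertices.filter fun v => 0 < mink m v) ×ˢ
    (X.vertices.filter fun v => mink m v < 0)).image fun p => cross m p.1 p.2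
  have memI : ∀ x, x ∈ I ↔ ∃ t ∈ X.vertices, ∃ b ∈ X.vertices, 0 < mink m t ∧ mink m b < 0 ∧
      cross m t b = x := by
    intro x
    simp only [I, mem_image, mem_product, mem_filter, Prod.exists]
    constructor
    · rintro ⟨t, b, ⟨⟨h1, h2⟩, h3, h4⟩, h5⟩
      exact ⟨t, h1, b, h3, h2, h4, h5⟩
    · rintro ⟨t, h1, b, h3, h2, h4, h5⟩
      exact ⟨t, b, ⟨⟨h1, h2⟩, h3, h4⟩, h5⟩
  have hI : ∀ x ∈ I, mink m x = 0 ∧ mink c x < 0 := by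
    intro x hx
    obtain ⟨t, ht, b, hb, hmt, hmb, rfl⟩ := (memI x).1 hx
    exact ⟨mink_cross_self m t b, mink_cross_neg hmt hmb (S.center_neg ht) (S.center_neg hb)⟩
  obtain ⟨k, F, gap, hk, hF, hgap, hsum, hR, hcos⟩ := exists_cyclic_order_sides fr I hI
    (by
      intro f hf h0
      exact S.eq_zero_of_cross hf fun t ht b hb hmt hmb =>
        h0 _ ((memI _).2 ⟨t, ht, b, hb, hmt, hmb, rfl⟩))
    (T := {G : X.Face // G.Crosses m}) (fun G => G.1.normal)
    (by
      intro G x hx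
      obtain ⟨t, ht, b, hb, hmt, hmb, rfl⟩ := (memI x).1 hx
      exact mink_cross_nonpos hmt hmb (G.1.supporting t ht) (G.1.supporting b hb))
    (by
      rintro ⟨G, hG⟩
      obtain ⟨t₁, ht₁, b₁, hb₁, t₂, ht₂, b₂, hb₂, h1, h2, h3, h4, h5, h6, h7, h8, h9⟩ :=
        S.exists_two_cross hG
      refine ⟨_, (memI _).2 ⟨t₁, ht₁, b₁, hb₁, h1, h2, rfl⟩,
        _, (memI _).2 ⟨t₂, ht₂, b₂, hb₂, h3, h4, rfl⟩, ?_, ?_, h9⟩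
      · rw [mink_cross, h5, h6]; ring
      · rw [mink_cross, h7, h8]; ring)
    (by
      rintro ⟨G, hG⟩
      by_contra hcon
      push Not at hcon
      obtain ⟨v, hv, hne⟩ := X.exists_vertex_mink_ne_zero G.normal_ne_zero
      obtain ⟨t₀, ht₀, hmt₀⟩ := S.above
      obtain ⟨b₀, hb₀, hmb₀⟩ := S.below
      rcases lt_or_gt_of_ne (S.ne_zero hv) with h1 | h1
      · exact hne (mink_cross_eq_zero hmt₀ h1 (G.supporting _ ht₀) (G.supporting _ hv)
          (hcon _ ((memI _).2 ⟨t₀, ht₀, v, hv, hmt₀, h1, rfl⟩))).2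
      · exact hne (mink_cross_eq_zero h1 hmb₀ (G.supporting _ hv) (G.supporting _ hb₀)
          (hcon _ ((memI _).2 ⟨v, hv, b₀, hb₀, h1, hmb₀, rfl⟩))).1)
    (by
      rintro ⟨F, hF⟩ ⟨G, hG⟩ μ ν hμ h1
      obtain ⟨⟨t, ht, hFt, hmt⟩, b, hb, hFb, hmb⟩ := hF
      have h2 := G.supporting t ht
      have h3 := G.supporting b hb
      simp only at h1
      rw [h1, mink_add_left, mink_smul_left, mink_smul_left] at h2 h3
      rw [hFt] at h2
      rw [hFb] at h3
      have h4 : ν = 0 := by nlinarith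
      rw [h4, zero_smul, add_zero] at h1
      exact Subtype.ext (Face.eq_of_smul h1))
    (by
      rintro f hmf hf0 hle ⟨x, hx, y, hy, hfx, hfy, hxy⟩
      obtain ⟨t₁, ht₁, b₁, hb₁, hmt₁, hmb₁, rfl⟩ := (memI x).1 hx
      obtain ⟨t₂, ht₂, b₂, hb₂, hmt₂, hmb₂, rfl⟩ := (memI y).1 hy
      obtain ⟨r, hr⟩ := S.exists_supporting_extension (f := f) fun t ht b hb hmt hmb =>
        hle _ ((memI _).2 ⟨t, ht, b, hb, hmt, hmb, rfl⟩)
      have hn0 : f + r • m ≠ 0 := by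
        intro h0
        have h1 := congrArg (mink m) h0
        rw [mink_add_right, mink_smul_right, hmf, S.unit, mink_zero_right] at h1
        have h2 : r = 0 := by linarith
        rw [h2, zero_smul, add_zero] at h0
        exact hf0 h0
      have hx1 : mink (f + r • m) (cross m t₁ b₁) = 0 := by
        rw [mink_add_left, mink_smul_left, hfx, mink_cross_self]; ring
      have hx2 : mink (f + r • m) (cross m t₂ b₂) = 0 := by
        rw [mink_add_left, mink_smul_left, hfy, mink_cross_self]; ring
      obtain ⟨z1, z2⟩ := mink_cross_eq_zero hmt₁ hmb₁ (hr _ ht₁) (hr _ hb₁) hx1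
      obtain ⟨z3, z4⟩ := mink_cross_eq_zero hmt₂ hmb₂ (hr _ ht₂) (hr _ hb₂) hx2
      have sp : ∀ {v : E}, v ∈ X.vertices → mink (f + r • m) v = 0 →
          v ∈ Submodule.span ℝ {v : E | v ∈ X.vertices ∧ mink (f + r • m) v = 0} :=
        fun h1 h2 => Submodule.subset_span ⟨h1, h2⟩
      have spc : ∀ {t b : E}, t ∈ X.vertices → b ∈ X.vertices → mink (f + r • m) t = 0 →
          mink (f + r • m) b = 0 → cross m t b ∈
            Submodule.span ℝ {v : E | v ∈ X.vertices ∧ mink (f + r • m) v = 0} :=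
        fun h1 h2 h3 h4 => Submodule.sub_mem _ (Submodule.smul_mem _ _ (sp h2 h4))
          (Submodule.smul_mem _ _ (sp h1 h3))
      obtain ⟨G, μ, hμ, hG⟩ := Face.exists_of_support hn0 hr ht₁ z1
        ![cross m t₁ b₁, cross m t₂ b₂, t₁]
        (linearIndependent_of_ne_smul (m := m) (by
            intro h0
            have := (hI _ hx).2
            rw [h0, mink_zero_right] at this
            exact lt_irrefl _ this) hxy (mink_cross_self _ _ _)
          (mink_cross_self _ _ _) hmt₁.ne')
        (by
          intro i
          fin_cases i
          · exact spc ht₁ hb₁ z1 z2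
          · exact spc ht₂ hb₂ z3 z4
          · exact sp ht₁ z1)
      refine ⟨⟨G, ⟨t₁, ht₁, ?_, hmt₁⟩, b₁, hb₁, ?_, hmb₁⟩, μ, μ * r, hμ, ?_⟩
      · rw [hG, mink_smul_left, z1, mul_zero]
      · rw [hG, mink_smul_left, z2, mul_zero]
      · simp only [hG, smul_add, smul_smul])
  refine ⟨k, fun i => (F i).1, gap, hk, fun i j hij => hF.1 (Subtype.ext hij), ?_, hgap, hsum,
    ?_, hcos⟩
  · intro G
    constructor
    · rintro ⟨i, rfl⟩
      exact (F i).2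
    · intro hG
      obtain ⟨i, hi⟩ := hF.2 ⟨G, hG⟩
      exact ⟨i, congrArg Subtype.val hi⟩
  · intro i
    obtain ⟨x, hx, h1, h2⟩ := hR i
    obtain ⟨t, ht, b, hb, hmt, hmb, rfl⟩ := (memI x).1 hx
    obtain ⟨a1, a2⟩ := mink_cross_eq_zero hmt hmb ((F i).1.supporting t ht)
      ((F i).1.supporting b hb) h1
    obtain ⟨a3, a4⟩ := mink_cross_eq_zero hmt hmb ((F (finRotate k i)).1.supporting t ht)
      ((F (finRotate k i)).1.supporting b hb) h2
    exact ⟨⟨t, ht, a1, a3, hmt⟩, b, hb, a2, a4, hmb⟩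

/-- A face does not have three different edges that cross the middle plane of the slab. -/
theorem false_of_three_crossing_edges (S : X.IsEmptySlab c m h) {F : X.Face} (G : Fin 3 → X.Face)
    (hG : Function.Injective G) (hFG : ∀ i, F ≠ G i) (hcr : ∀ i, F.EdgeCrosses (G i) m) :
    False := by
  obtain ⟨e₁, e₂, fr⟩ := exists_isFrame S.center.1 S.unit S.orth
  obtain ⟨a, ha0, ha⟩ := exists_linear_relation (k := 3)
    (Fin.cons ![mink c F.normal, mink e₁ F.normal, mink e₂ F.normal]
      (fun i : Fin 3 => ![mink c (G i).normal, mink e₁ (G i).normal, mink e₂ (G i).normal]))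
  have h0 := ha 0
  have h1 := ha 1
  have h2 := ha 2
  simp only [Fin.sum_univ_succ (n := 3), Fin.cons_zero, Fin.cons_succ, Matrix.cons_val_zero,
    Matrix.cons_val_one, Matrix.cons_val] at h0 h1 h2
  set b : Fin 3 → ℝ := fun i => a i.succ with hb
  have key : ∀ x, mink m x = 0 →
      a 0 * mink F.normal x + ∑ i, b i * mink (G i).normal x = 0 := by
    intro x hx
    have hexp : ∀ n, mink n x =
        mink c n * (-mink c x) + mink e₁ n * mink e₁ x + mink e₂ n * mink e₂ x := by
      intro n
      rw [fr.mink_eq n x, hx]; ring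
    have hexp' : ∀ i, mink (G i).normal x = _ := fun i => hexp (G i).normal
    rw [hexp F.normal]
    simp only [hexp', mul_add, Finset.sum_add_distrib, ← mul_assoc, ← Finset.sum_mul]
    linear_combination (-mink c x) * h0 + mink e₁ x * h1 + mink e₂ x * h2
  obtain ⟨⟨t₀, ht₀, hFt₀, -, hmt₀⟩, b₀, hb₀, hFb₀, -, hmb₀⟩ := hcr 0
  have hb0 : b = 0 := by
    apply relation_eq_zero_of_support (fun i => (G i).normal)
      {x : E | ∃ t ∈ X.vertices, ∃ b ∈ X.vertices, mink F.normal t = 0 ∧ mink F.normal b = 0 ∧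
        0 < mink m t ∧ mink m b < 0 ∧ x = cross m t b}
    · rintro i x ⟨t, ht, b, hb, -, -, hmt, hmb, rfl⟩
      exact mink_cross_nonpos hmt hmb ((G i).supporting t ht) ((G i).supporting b hb)
    · intro i
      by_contra hcon
      push Not at hcon
      obtain ⟨u, hu, hFu, hGu⟩ := Face.exists_vertex_ne (hFG i)
      rcases lt_or_gt_of_ne (S.ne_zero hu) with h3 | h3
      · exact hGu (mink_cross_eq_zero hmt₀ h3 ((G i).supporting _ ht₀) ((G i).supporting _ hu)
          (hcon _ ⟨t₀, ht₀, u, hu, hFt₀, hFu, hmt₀, h3, rfl⟩)).2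
      · exact hGu (mink_cross_eq_zero h3 hmb₀ ((G i).supporting _ hu) ((G i).supporting _ hb₀)
          (hcon _ ⟨u, hu, b₀, hb₀, hFu, hFb₀, h3, hmb₀, rfl⟩)).1
    · intro i j hij
      obtain ⟨⟨t, ht, hFt, hGt, hmt⟩, b', hb', hFb, hGb, hmb⟩ := hcr i
      refine ⟨_, ⟨t, ht, b', hb', hFt, hFb, hmt, hmb, rfl⟩, ?_, ?_⟩
      · rw [mink_cross, hGt, hGb]; ring
      · intro h3
        obtain ⟨h4, h5⟩ := mink_cross_eq_zero hmt hmb ((G j).supporting _ ht)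
          ((G j).supporting _ hb') h3
        refine Face.false_of_three_faces ![F, G i, G j] (injective_vec_three (hFG i) (hFG j)
          (hG.ne hij)) ht hb' (by rintro rfl; linarith) ?_ ?_
        · intro p
          fin_cases p <;> simp [hFt, hGt, h4]
        · intro p
          fin_cases p <;> simp [hFb, hGb, h5]
    · rintro x ⟨t, -, b', -, hFt, hFb, -, -, rfl⟩
      have h3 := key _ (mink_cross_self m t b')
      rw [mink_cross F.normal, hFt, hFb] at h3
      linarith
  have ha00 : a 0 ≠ 0 := by
    intro h3
    apply ha0
    ext i
    refine Fin.cases h3 (fun j => ?_) i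
    exact congrFun hb0 j
  -- the remaining relation makes the normal of `F` a multiple of `m`
  have h3 : F.normal = mink m F.normal • m := by
    have z : ∀ i : Fin 3, a i.succ = 0 := fun i => congrFun hb0 i
    simp only [z, zero_mul, Finset.sum_const_zero, add_zero, mul_eq_zero, ha00,
      false_or] at h0 h1 h2
    conv_lhs => rw [fr.expand F.normal]
    rw [h0, h1, h2]
    simp
  have h4 : mink m F.normal = 0 := by
    rw [h3, mink_smul_left] at hFt₀
    exact (mul_eq_zero.1 hFt₀).resolve_right hmt₀.ne'
  rw [h4, zero_smul] at h3
  exact F.normal_ne_zero h3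

end IsEmptySlab

/-! ### The link of the Gaussian image at the normal of a face -/

namespace Face

/-- A line supporting a face within its plane extends to a supporting plane of the polyhedron that
contains a vertex outside the face. -/
theorem exists_supporting_extension (F : X.Face) {f : E}
    (hf : ∀ v ∈ X.vertices, mink F.normal v = 0 → mink f v ≤ 0) :
    ∃ r : ℝ, (∀ v ∈ X.vertices, mink (f + r • F.normal) v ≤ 0) ∧
      ∃ v ∈ X.vertices, mink F.normal v ≠ 0 ∧ mink (f + r • F.normal) v = 0 := by
  classical
  obtain ⟨v, hv, hmax⟩ := exists_max_image (X.vertices.filter fun v => mink F.normal v ≠ 0)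
    (fun v => mink f v / -mink F.normal v) (by
      obtain ⟨v, hv, h⟩ := X.exists_vertex_mink_ne_zero F.normal_ne_zero
      exact ⟨v, mem_filter.2 ⟨hv, h⟩⟩)
  obtain ⟨hvX, hFv⟩ := mem_filter.1 hv
  refine ⟨mink f v / -mink F.normal v, ?_, v, hvX, hFv, ?_⟩
  · intro w hw
    rw [mink_add_left, mink_smul_left]
    by_cases h : mink F.normal w = 0
    · rw [h, mul_zero, add_zero]
      exact hf w hw h
    · have h1 := hmax w (mem_filter.2 ⟨hw, h⟩)
      have h2 : mink F.normal w < 0 := lt_of_le_of_ne (F.supporting w hw) h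
      rw [div_le_iff₀ (by linarith)] at h1
      linarith
  · rw [mink_add_left, mink_smul_left]
    field_simp
    ring

theorem Adj.eq_of_vertices {F G G' : X.Face} (hG : F.Adj G) (hG' : F.Adj G') {v w : E}
    (hv : v ∈ X.vertices) (hw : w ∈ X.vertices) (hvw : v ≠ w) (hFv : mink F.normal v = 0)
    (hFw : mink F.normal w = 0) (hGv : mink G.normal v = 0) (hGw : mink G.normal w = 0)
    (hGv' : mink G'.normal v = 0) (hGw' : mink G'.normal w = 0) : G = G' := by
  by_contra hne
  refine false_of_three_faces ![F, G, G'] (injective_vec_three hG.ne hG'.ne hne) hv hw hvw ?_ ?_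
  · intro p
    fin_cases p <;> assumption
  · intro p
    fin_cases p <;> assumption

/-- The edges of a face in their cyclic order. -/
theorem exists_cycle_of_edges (F : X.Face) :
    ∃ (k : ℕ) (G : Fin k → X.Face), 3 ≤ k ∧ Function.Injective G ∧
      (∀ H, (∃ i, G i = H) ↔ F.Adj H) ∧
      ∀ i, ∃ v ∈ X.vertices, mink F.normal v = 0 ∧ mink (G i).normal v = 0 ∧
        mink (G (finRotate k i)).normal v = 0 := by
  classical
  obtain ⟨v₀, hv₀, hFv₀⟩ := F.exists_vertex
  obtain ⟨e₁, e₂, fr⟩ := exists_isFrame (X.mem_H3 v₀ hv₀).1 F.unit (mink_comm v₀ _ ▸ hFv₀)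
  have memI : ∀ x, x ∈ X.vertices.filter (fun v => mink F.normal v = 0) ↔
      x ∈ X.vertices ∧ mink F.normal x = 0 := fun x => mem_filter
  obtain ⟨k, G, gap, hk, hG, -, -, hR, -⟩ := exists_cyclic_order_sides fr
    (X.vertices.filter fun v => mink F.normal v = 0)
    (fun x hx => ⟨((memI x).1 hx).2, mink_lt_zero (X.mem_H3 v₀ hv₀) (X.mem_H3 x ((memI x).1 hx).1)⟩)
    (by
      intro f hf h0
      obtain ⟨r, rfl⟩ := F.exists_eq_smul_normal (f := f) fun v hv hFv =>
        h0 v ((memI v).2 ⟨hv, hFv⟩)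
      rw [mink_smul_right, F.unit, mul_one] at hf
      rw [hf, zero_smul])
    (T := {G : X.Face // F.Adj G}) (fun G => G.1.normal)
    (fun G x hx => G.1.supporting x ((memI x).1 hx).1)
    (by
      rintro ⟨G, hG⟩
      obtain ⟨v, hv, -, hFv, hGv⟩ := hG.exists_vertex_ne 0
      obtain ⟨w, hw, hwv, hFw, hGw⟩ := hG.exists_vertex_ne v
      exact ⟨v, (memI v).2 ⟨hv, hFv⟩, w, (memI w).2 ⟨hw, hFw⟩, hGv, hGw,
        ne_smul_of_ne (X.mem_H3 v hv) (X.mem_H3 w hw) hwv.symm⟩)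
    (by
      rintro ⟨G, hG⟩
      obtain ⟨v, hv, hFv, hGv⟩ := Face.exists_vertex_ne hG.ne
      exact ⟨v, (memI v).2 ⟨hv, hFv⟩, hGv⟩)
    (by
      rintro ⟨G, hG⟩ ⟨G', hG'⟩ μ ν hμ h1
      simp only at h1
      obtain ⟨v, hv, -, hFv, hGv⟩ := hG.exists_vertex_ne 0
      obtain ⟨w, hw, hwv, hFw, hGw⟩ := hG.exists_vertex_ne v
      refine Subtype.ext (hG.eq_of_vertices hG' hv hw hwv.symm hFv hFw hGv hGw ?_ ?_)
      · rw [h1, mink_add_left, mink_smul_left, mink_smul_left, hGv, hFv]; ring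
      · rw [h1, mink_add_left, mink_smul_left, mink_smul_left, hGw, hFw]; ring)
    (by
      rintro f hmf hf0 hle ⟨x, hx, y, hy, hfx, hfy, hxy⟩
      obtain ⟨hxv, hFx⟩ := (memI x).1 hx
      obtain ⟨hyv, hFy⟩ := (memI y).1 hy
      obtain ⟨r, hr, z, hz, hFz, hz0⟩ := F.exists_supporting_extension (f := f)
        fun v hv hFv => hle v ((memI v).2 ⟨hv, hFv⟩)
      have hn0 : f + r • F.normal ≠ 0 := by
        intro h0
        have h1 := congrArg (mink F.normal) h0
        rw [mink_add_right, mink_smul_right, hmf, F.unit, mink_zero_right] at h1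
        have h2 : r = 0 := by linarith
        rw [h2, zero_smul, add_zero] at h0
        exact hf0 h0
      have hx0 : mink (f + r • F.normal) x = 0 := by
        rw [mink_add_left, mink_smul_left, hfx, hFx]; ring
      have hy0 : mink (f + r • F.normal) y = 0 := by
        rw [mink_add_left, mink_smul_left, hfy, hFy]; ring
      obtain ⟨G, μ, hμ, hG⟩ := Face.exists_of_support hn0 hr hxv hx0 ![x, y, z]
        (linearIndependent_of_ne_smul (m := F.normal) (by
          rintro rfl
          exact absurd (X.mem_H3 0 hxv).2 (by simp)) hxy hFx hFy hFz)
        (by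
          intro i
          fin_cases i
          · exact Submodule.subset_span ⟨hxv, hx0⟩
          · exact Submodule.subset_span ⟨hyv, hy0⟩
          · exact Submodule.subset_span ⟨hz, hz0⟩)
      have hGe : ∀ v, mink (f + r • F.normal) v = 0 → mink G.normal v = 0 := by
        intro v hv
        rw [hG, mink_smul_left, hv, mul_zero]
      refine ⟨⟨G, adj_of_vertices ?_ hxv hyv ?_ hFx hFy (hGe x hx0) (hGe y hy0)⟩, μ, μ * r, hμ, ?_⟩
      · rintro rfl
        exact hFz (hGe z hz0)
      · intro hxy'
        exact hxy 1 (by rw [one_smul, hxy'])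
      · simp only [hG, smul_add, smul_smul])
  refine ⟨k, fun i => (G i).1, hk, fun i j hij => hG.1 (Subtype.ext hij), ?_, ?_⟩
  · intro H
    constructor
    · rintro ⟨i, rfl⟩
      exact (G i).2
    · intro hH
      obtain ⟨i, hi⟩ := hG.2 ⟨H, hH⟩
      exact ⟨i, congrArg Subtype.val hi⟩
  · intro i
    obtain ⟨v, hv, h1, h2⟩ := hR i
    obtain ⟨hvX, hFv⟩ := (memI v).1 hv
    exact ⟨v, hvX, hFv, h1, h2⟩

end Face

/-- The link is connected. -/
theorem exists_linkPath {F G G' : X.Face} (hG : F.Adj G) (hG' : F.Adj G') :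
    ∃ ℓ, LinkPath F G G' ℓ := by
  obtain ⟨k, H, hk, hH, hadj, hcom⟩ := F.exists_cycle_of_edges
  have hrot : ∀ n : ℕ, ∀ i, ∃ ℓ, LinkPath F (H i) (H ((finRotate k ^ n) i)) ℓ := by
    intro n
    induction n with
    | zero => exact fun i => ⟨0, LinkPath.nil _ ((hadj _).1 ⟨i, rfl⟩)⟩
    | succ n ih =>
      intro i
      obtain ⟨ℓ, hℓ⟩ := ih (finRotate k i)
      rw [← Equiv.Perm.mul_apply, ← pow_succ] at hℓ
      obtain ⟨v, hv, hF, h1, h2⟩ := hcom i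
      refine ⟨_, LinkPath.cons _ _ _ ℓ v ((hadj _).1 ⟨i, rfl⟩) ((hadj _).1 ⟨_, rfl⟩) ?_ hv hF
        h1 h2 hℓ⟩
      intro h
      have h3 := hH h
      obtain ⟨n, rfl⟩ : ∃ n, k = n + 2 := ⟨k - 2, by omega⟩
      have h4 : i ∈ (finRotate (n + 2)).support := by rw [support_finRotate]; exact mem_univ _
      exact Equiv.Perm.mem_support.1 h4 h3.symm
  obtain ⟨i, rfl⟩ := (hadj G).2 hG
  obtain ⟨j, rfl⟩ := (hadj G').2 hG'
  obtain ⟨n, rfl⟩ : ∃ n, k = n + 2 := ⟨k - 2, by omega⟩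
  have hmem : ∀ i, finRotate (n + 2) i ≠ i := by
    intro i
    have h4 : i ∈ (finRotate (n + 2)).support := by rw [support_finRotate]; exact mem_univ _
    exact Equiv.Perm.mem_support.1 h4
  obtain ⟨p, hp⟩ := isCycle_finRotate.exists_pow_eq (hmem i) (hmem j)
  rw [← hp]
  exact hrot p i

/-- A path in the link can be shortened to one that visits every node at most once. The path has
nodes `g 0, …, g n`, and `w i` is the vertex of the corner between `g i` and `g (i + 1)`. -/
theorem LinkPath.exists_simple {F G G' : X.Face} {ℓ : ℝ} (h : LinkPath F G G' ℓ) :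
    ∃ (n : ℕ) (g : ℕ → X.Face) (w : ℕ → E), g 0 = G ∧ g n = G' ∧
      (∀ i ≤ n, ∀ j ≤ n, g i = g j → i = j) ∧ (∀ i ≤ n, F.Adj (g i)) ∧
      (∀ i < n, w i ∈ X.vertices ∧ mink F.normal (w i) = 0 ∧ mink (g i).normal (w i) = 0 ∧
        mink (g (i + 1)).normal (w i) = 0) ∧
      ∑ i ∈ range n, dualAngle F (g i) (g (i + 1)) ≤ ℓ := by
  induction h with
  | nil G hG =>
    exact ⟨0, fun _ => G, fun _ => 0, rfl, rfl, fun i hi j hj _ => by omega, fun _ _ => hG,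
      fun i hi => absurd hi (Nat.not_lt_zero i), by simp⟩
  | cons G₀ G₁ G₂ ℓ v hG hG' hne hv hF hvG hvG' _ ih =>
    obtain ⟨n, g, w, h0, hn, hinj, hadj, hw, hsum⟩ := ih
    by_cases hex : ∃ j ≤ n, g j = G₀
    · obtain ⟨j, hj, hgj⟩ := hex
      refine ⟨n - j, fun i => g (j + i), fun i => w (j + i), hgj, ?_, ?_, ?_, ?_, ?_⟩
      · simp only [Nat.add_sub_cancel' hj, hn]
      · intro a ha b hb hab
        have := hinj (j + a) (by omega) (j + b) (by omega) hab
        omega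
      · exact fun i hi => hadj _ (by omega)
      · exact fun i hi => hw _ (by omega)
      · have h1 := Finset.sum_range_add (fun i => dualAngle F (g i) (g (i + 1))) j (n - j)
        rw [Nat.add_sub_cancel' hj] at h1
        have h2 : 0 ≤ ∑ i ∈ range j, dualAngle F (g i) (g (i + 1)) :=
          Finset.sum_nonneg fun i _ => Real.arccos_nonneg _
        have h3 : 0 ≤ dualAngle F G₀ G₁ := Real.arccos_nonneg _
        simp only [← add_assoc] at h1 ⊢
        linarith
    · push Not at hex
      refine ⟨n + 1, fun i => Nat.casesOn i G₀ g, fun i => Nat.casesOn i v w, rfl, hn, ?_, ?_, ?_,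
        ?_⟩
      · rintro (_ | a) ha (_ | b) hb hab
        · rfl
        · exact absurd hab.symm (hex b (by omega))
        · exact absurd hab (hex a (by omega))
        · rw [hinj a (by omega) b (by omega) hab]
      · rintro (_ | a) ha
        · exact hG
        · exact hadj a (by omega)
      · rintro (_ | a) ha
        · refine ⟨hv, hF, hvG, ?_⟩
          simp only [h0]
          exact hvG'
        · exact hw a (by omega)
      · rw [Finset.sum_range_succ']
        change _ + dualAngle F G₀ (g 0) ≤ _
        rw [h0, add_comm]
        exact add_le_add le_rfl hsum

theorem mink_direction {F : X.Face} (G : X.Face) {x : E} (hx : mink F.normal x = 0) :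
    mink (direction F G) x = mink G.normal x := by
  rw [direction, mink_sub_left, mink_smul_left, hx, mul_zero, sub_zero]

theorem mink_normal_direction (F G : X.Face) : mink F.normal (direction F G) = 0 := by
  rw [direction, mink_sub_right, mink_smul_right, F.unit]; ring

theorem direction_ne_zero {F G : X.Face} (h : F ≠ G) : direction F G ≠ 0 := by
  obtain ⟨v, -, hF, hG⟩ := Face.exists_vertex_ne h
  intro h0
  rw [← mink_direction G hF, h0, mink_zero_left] at hG
  exact hG rfl

/-- At a vertex `v` of a face, the length of the corner of the dual tile is the exterior angle of
the face. Here `w` and `w'` are the neighbors of `v` on the boundary of the face. -/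
theorem dualAngle_eq_pi_sub_hangle {F G G' : X.Face} {v w w' : E} (hG : F.Adj G) (hG' : F.Adj G')
    (hne : G ≠ G') (hv : v ∈ X.vertices) (hw : w ∈ X.vertices) (hw' : w' ∈ X.vertices)
    (hvw : v ≠ w) (hvw' : v ≠ w') (hFv : mink F.normal v = 0) (hFw : mink F.normal w = 0)
    (hFw' : mink F.normal w' = 0) (hGv : mink G.normal v = 0) (hGv' : mink G'.normal v = 0)
    (hGw : mink G.normal w = 0) (hGw' : mink G'.normal w' = 0) :
    dualAngle F G G' = Real.pi - hangle v w w' := by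
  have Hv := X.mem_H3 v hv
  have Hw := X.mem_H3 w hw
  have Hw' := X.mem_H3 w' hw'
  have dv : ∀ H : X.Face, mink H.normal v = 0 → mink (direction F H) v = 0 := fun H h => by
    rw [mink_direction H hFv, h]
  have hlt : mink G'.normal w < 0 := by
    refine lt_of_le_of_ne (G'.supporting w hw) fun h => hne ?_
    exact hG.eq_of_vertices hG' hv hw hvw hFv hFw hGv hGw hGv' h
  have pr : ∀ (H : X.Face), mink H.normal v = 0 → ∀ y, mink F.normal y = 0 →
      mink (direction F H) (proj v y) = mink H.normal y := by
    intro H hH y hy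
    rw [mink_proj_of_orth (dv H hH), mink_direction H hy]
  refine mangle_normals_eq Hv F.unit (mink_comm v _ ▸ hFv) (mink_normal_direction F G)
    (mink_normal_direction F G') ?_ ?_ ?_ ?_ (mink_proj_right Hv w) (mink_proj_right Hv w')
    (proj_ne_zero Hv Hw hvw) (proj_ne_zero Hv Hw' hvw') (direction_ne_zero hG.ne)
    (direction_ne_zero hG'.ne) ?_ ?_ ?_ ?_
  · rw [mink_proj_of_orth hFv, hFw]
  · rw [mink_proj_of_orth hFv, hFw']
  · rw [mink_comm, dv G hGv]
  · rw [mink_comm, dv G' hGv']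
  · rw [pr G hGv w hFw, hGw]
  · rw [pr G' hGv' w' hFw', hGw']
  · rw [pr G hGv w' hFw']; exact G.supporting w' hw'
  · rw [pr G' hGv' w hFw]; exact hlt

namespace IsEmptySlab

variable {c m : E} {h : ℝ}

theorem hangle_le (S : X.IsEmptySlab c m h) {t b b' : E} (ht : t ∈ X.vertices)
    (hb : b ∈ X.vertices) (hb' : b' ∈ X.vertices) (hmt : 0 < mink m t) (hmb : mink m b < 0)
    (hmb' : mink m b' < 0) : hangle t b b' ≤ 2 * (Real.sinh (2 * h))⁻¹ :=
  hangle_le_across_slab S.pos S.center S.unit S.orth (X.mem_H3 t ht) (X.mem_H3 b hb)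
    (X.mem_H3 b' hb') (S.above_le ht hmt) (S.le_below hb hmb) (S.le_below hb' hmb')

/-- A simple path in the link between two edges that cross the slab, starting at the upper end of
the first edge, stays above the slab. By the Gauss–Bonnet inequality its length, a sum of exterior
angles, is almost `π`. -/
theorem le_sum_of_simple (S : X.IsEmptySlab c m h) {F : X.Face} {n : ℕ} {g : ℕ → X.Face}
    {w : ℕ → E} (hinj : ∀ i ≤ n + 1, ∀ j ≤ n + 1, g i = g j → i = j)
    (hadj : ∀ i ≤ n + 1, F.Adj (g i))
    (hw : ∀ i < n + 1, w i ∈ X.vertices ∧ mink F.normal (w i) = 0 ∧ mink (g i).normal (w i) = 0 ∧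
      mink (g (i + 1)).normal (w i) = 0)
    (h0 : F.EdgeCrosses (g 0) m) (hn : F.EdgeCrosses (g (n + 1)) m) (hw0 : 0 < mink m (w 0)) :
    Real.pi - 2 * (Real.sinh (2 * h))⁻¹ ≤
      ∑ i ∈ range (n + 1), dualAngle F (g i) (g (i + 1)) := by
  have habove : ∀ i < n + 1, 0 < mink m (w i) := by
    intro i
    induction i with
    | zero => exact fun _ => hw0
    | succ i ih =>
      intro hi
      have h1 := ih (by omega)
      obtain ⟨a1, a2, a3, a4⟩ := hw i (by omega)
      obtain ⟨b1, b2, b3, b4⟩ := hw (i + 1) hi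
      by_contra hcon
      have h2 : mink m (w (i + 1)) < 0 := lt_of_le_of_ne (not_lt.1 hcon) (S.ne_zero b1)
      have n1 : g 0 ≠ g (i + 1) := fun h => by
        have := hinj _ (by omega) _ (by omega) h
        omega
      have n2 : g 0 ≠ g (n + 1) := fun h => by
        have := hinj _ (by omega) _ (by omega) h
        omega
      have n3 : g (i + 1) ≠ g (n + 1) := fun h => by
        have := hinj _ (by omega) _ (by omega) h
        omega
      refine S.false_of_three_crossing_edges (F := F) ![g 0, g (i + 1), g (n + 1)]
        (injective_vec_three n1 n2 n3) ?_ ?_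
      · intro p
        fin_cases p
        · exact (hadj 0 (by omega)).ne
        · exact (hadj (i + 1) (by omega)).ne
        · exact (hadj (n + 1) le_rfl).ne
      · intro p
        fin_cases p
        · exact h0
        · exact ⟨⟨w i, a1, a2, a4, h1⟩, w (i + 1), b1, b2, b3, h2⟩
        · exact hn
  obtain ⟨-, b, hb, hFb, hGb, hmb⟩ := h0
  obtain ⟨-, b', hb', hFb', hGb', hmb'⟩ := hn
  have hdist : ∀ i j, i < j → j < n + 1 → w i ≠ w j := by
    intro i j hij hj hww
    obtain ⟨a1, a2, a3, a4⟩ := hw i (by omega)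
    have n1 : g i ≠ g (i + 1) := fun h => by
      have := hinj _ (by omega) _ (by omega) h
      omega
    have n2 : g i ≠ g (j + 1) := fun h => by
      have := hinj _ (by omega) _ (by omega) h
      omega
    have n3 : g (i + 1) ≠ g (j + 1) := fun h => by
      have := hinj _ (by omega) _ (by omega) h
      omega
    refine Face.false_of_three_edges (F := F) ![g i, g (i + 1), g (j + 1)]
      (injective_vec_three n1 n2 n3) ?_ a1 a2 ?_
    · intro p
      fin_cases p
      · exact hadj i (by omega)
      · exact hadj (i + 1) (by omega)
      · exact hadj (j + 1) (by omega)
    · intro p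
      fin_cases p
      · exact a3
      · exact a4
      · change mink (g (j + 1)).normal (w i) = 0
        rw [hww]
        exact (hw j hj).2.2.2
  -- the vertices of the path, together with the lower ends of the first and the last edge
  set v : ℕ → E := fun i => Nat.casesOn i b (fun i => if i < n + 1 then w i else b') with hvdef
  have v0 : v 0 = b := rfl
  have vs : ∀ i < n + 1, v (i + 1) = w i := fun i hi => if_pos hi
  have v1 : v 1 = w 0 := vs 0 (by omega)
  have ve : v (n + 2) = b' := if_neg (lt_irrefl _)
  have hvX : ∀ i, i ≤ n + 2 → v i ∈ X.vertices ∧ mink F.normal (v i) = 0 := by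
    rintro (_ | i) hi
    · exact ⟨hb, hFb⟩
    · rcases Nat.lt_or_ge i (n + 1) with h | h
      · rw [vs i h]
        exact ⟨(hw i h).1, (hw i h).2.1⟩
      · obtain rfl : i = n + 1 := by omega
        rw [ve]
        exact ⟨hb', hFb'⟩
  have hprev : ∀ i < n + 1, mink (g i).normal (v i) = 0 := by
    rintro (_ | i) hi
    · exact hGb
    · rw [vs i (by omega)]
      exact (hw i (by omega)).2.2.2
  have hnext : ∀ i < n + 1, mink (g (i + 1)).normal (v (i + 2)) = 0 := by
    intro i hi
    rcases Nat.lt_or_ge (i + 1) (n + 1) with h | h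
    · rw [vs (i + 1) h]
      exact (hw (i + 1) h).2.2.1
    · obtain rfl : i = n := by omega
      rw [ve]
      exact hGb'
  have hbot : ∀ {t u : E}, 0 < mink m t → mink m u < 0 → t ≠ u := by
    rintro t u h1 h2 rfl
    linarith
  have hvne : ∀ i < n + 1, v (i + 1) ≠ v (i + 2) := by
    intro i hi
    rw [vs i hi]
    rcases Nat.lt_or_ge (i + 1) (n + 1) with h | h
    · rw [vs (i + 1) h]
      exact hdist i (i + 1) (by omega) h
    · obtain rfl : i = n := by omega
      rw [ve]
      exact hbot (habove _ hi) hmb'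
  have hvne' : ∀ i < n + 1, v i ≠ v (i + 1) := by
    rintro (_ | i) hi
    · rw [v0, vs 0 hi]
      exact (hbot (habove _ hi) hmb).symm
    · exact hvne i (by omega)
  have hv1 : ∀ i ≤ n, v (i + 2) ≠ v 1 := by
    intro i hi
    rw [v1]
    rcases Nat.lt_or_ge (i + 1) (n + 1) with h | h
    · rw [vs (i + 1) h]
      exact (hdist 0 (i + 1) (by omega) h).symm
    · obtain rfl : i = n := by omega
      rw [ve]
      exact (hbot hw0 hmb').symm
  have hsum := sum_exterior_angle_ge (v := v) n (fun i hi => X.mem_H3 _ (hvX i hi).1)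
    (hvne' 0 (by omega)) (fun i hi => hvne i (by omega)) hv1
  have hang : hangle (v 1) (v 0) (v (n + 2)) ≤ 2 * (Real.sinh (2 * h))⁻¹ := by
    rw [ve, v0, v1]
    exact S.hangle_le (hw 0 (by omega)).1 hb hb' hw0 hmb hmb'
  have heq : ∀ i ∈ range (n + 1), dualAngle F (g i) (g (i + 1)) =
      Real.pi - hangle (v (i + 1)) (v i) (v (i + 2)) := by
    intro i hi
    rw [mem_range] at hi
    have n1 : g i ≠ g (i + 1) := fun h => by
      have := hinj _ (by omega) _ (by omega) h
      omega
    obtain ⟨p1, q1⟩ := hvX i (by omega)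
    obtain ⟨p2, q2⟩ := hvX (i + 1) (by omega)
    obtain ⟨p3, q3⟩ := hvX (i + 2) (by omega)
    refine dualAngle_eq_pi_sub_hangle (hadj i (by omega)) (hadj (i + 1) (by omega)) n1
      p2 p1 p3 (hvne' i hi).symm (hvne i hi) q2 q1 q3 ?_ ?_
      (hprev i hi) (hnext i hi)
    · rw [vs i hi]
      exact (hw i hi).2.2.1
    · rw [vs i hi]
      exact (hw i hi).2.2.2
  rw [Finset.sum_congr rfl heq]
  linarith

/-- The geodesic curvature at the normal of a face, between two edges that cross the slab, is small:
every path in the link contains a simple one, to which the preceding estimate applies, after a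
reflection of the slab if the path runs below it. -/
theorem turning_le (S : X.IsEmptySlab c m h) {F G G' : X.Face} (hG : F.Adj G) (hG' : F.Adj G')
    (hne : G ≠ G') (hc : F.EdgeCrosses G m) (hc' : F.EdgeCrosses G' m) :
    turning G F G' ≤ 2 * (Real.sinh (2 * h))⁻¹ := by
  have hpos : 0 ≤ 2 * (Real.sinh (2 * h))⁻¹ := by
    have := Real.sinh_pos_iff.2 (by linarith [S.pos] : 0 < 2 * h)
    positivity
  have key : Real.pi - 2 * (Real.sinh (2 * h))⁻¹ ≤ linkDist F G G' := by
    apply le_csInf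
    · obtain ⟨ℓ, hℓ⟩ := exists_linkPath hG hG'
      exact ⟨ℓ, hℓ⟩
    · rintro ℓ hℓ
      obtain ⟨n, g, w, h0, hn, hinj, hadj, hw, hsum⟩ := hℓ.exists_simple
      refine le_trans ?_ hsum
      rcases n with _ | n
      · exact absurd (h0.symm.trans hn) hne
      obtain ⟨a1, -⟩ := hw 0 (by omega)
      rw [← h0] at hc
      rw [← hn] at hc'
      rcases lt_or_gt_of_ne (S.ne_zero a1) with h1 | h1
      · exact S.neg.le_sum_of_simple hinj hadj hw hc.neg hc'.neg
          (by rw [mink_neg_left]; linarith)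
      · exact S.le_sum_of_simple hinj hadj hw hc hc' h1
  exact max_le hpos (by linarith)

end IsEmptySlab

end ConvexPolyhedron

/-! ### The angle between the lines of two crossing edges -/

/-- If two lines of a hyperbolic plane with normal `n` have unit normals `u`, `u'` with
`|⟨u, u'⟩| < 1`, and `t`, `b` are points of the first line, then the vector of the first line
orthogonal to `u'` is timelike, so that the lines meet. -/
theorem mink_self_lt_zero_of_lines_meet {n u u' t b : E} (Ht : t ∈ H3) (Hb : b ∈ H3) (htb : t ≠ b)
    (nn : mink n n = 1) (nt : mink n t = 0) (nb : mink n b = 0) (uu : mink u u = 1)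
    (uu' : mink u' u' = 1) (nu : mink n u = 0) (nu' : mink n u' = 0) (ut : mink u t = 0)
    (ub : mink u b = 0) (h1 : -1 < mink u u') (h2 : mink u u' < 1) :
    mink (mink u' b • t - mink u' t • b) (mink u' b • t - mink u' t • b) < 0 := by
  obtain ⟨ρ, -, hρ⟩ := exists_unit_scale (mink_self_pos_of_orth (mink_self_lt_zero Ht)
    (mink_proj_right Ht b) (proj_ne_zero Ht Hb htb))
  have tu : mink t u = 0 := by rw [mink_comm, ut]
  have fr : IsFrame t u (ρ • proj t b) n := by
    refine ⟨Ht.1, tu, ?_, mink_comm t _ ▸ nt, uu, ?_, ?_, ?_, ?_, nn⟩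
    · rw [mink_smul_right, mink_proj_right Ht, mul_zero]
    · rw [mink_smul_right, mink_proj_of_orth ut, ub, mul_zero]
    · rw [mink_comm, nu]
    · rw [mink_smul_left, mink_smul_right, hρ]
    · rw [mink_smul_left, mink_comm, mink_proj_of_orth nt, nb, mul_zero]
  have e1 := fr.mink_eq u' u'
  have e2 : mink (proj t b) u' = mink u' b + mink t b * mink u' t := by
    rw [proj, mink_add_left, mink_smul_left, mink_comm b, mink_comm t u']
  rw [mink_smul_left, e2, nu', uu', mink_comm t u'] at e1
  rw [mink_proj_self Ht Hb] at hρ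
  have h3 := mink_lt_neg_one Ht Hb htb
  have e3 : mink (mink u' b • t - mink u' t • b) (mink u' b • t - mink u' t • b) =
      -(mink u' b ^ 2 + 2 * mink t b * mink u' b * mink u' t + mink u' t ^ 2) := by
    simp only [mink_sub_left, mink_sub_right, mink_smul_left, mink_smul_right, Ht.1, Hb.1,
      mink_comm b t]
    ring
  rw [e3]
  generalize mink t b = γ at *
  generalize mink u' b = β at *
  generalize mink u' t = τ at *
  generalize mink u u' = κ at *
  have h4 : β ^ 2 + 2 * γ * β * τ + τ ^ 2 = (γ ^ 2 - 1) * (1 - κ ^ 2) := by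
    linear_combination (1 - γ ^ 2) * e1 - (β + γ * τ) ^ 2 * hρ
  have h5 : 0 < (γ ^ 2 - 1) * (1 - κ ^ 2) := mul_pos (by nlinarith) (by nlinarith)
  linarith

namespace ConvexPolyhedron

variable {X : ConvexPolyhedron}

namespace IsEmptySlab

variable {c m : E} {h : ℝ}

/-- If the lines of two crossing edges meet in a point `q` above the slab, they meet at a small
angle. -/
theorem pi_sub_dualAngle_le_of_meet (S : X.IsEmptySlab c m h) {F G G' : X.Face} (hG : F ≠ G)
    (hG' : F ≠ G') {q b b' : E} (hq : q ∈ H3) (hFq : mink F.normal q = 0)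
    (hGq : mink G.normal q = 0) (hGq' : mink G'.normal q = 0)
    (hqs : Real.sinh h * -mink c q ≤ Real.cosh h * mink m q)
    (hb : b ∈ X.vertices) (hb' : b' ∈ X.vertices) (hFb : mink F.normal b = 0)
    (hFb' : mink F.normal b' = 0) (hGb : mink G.normal b = 0) (hGb' : mink G'.normal b' = 0)
    (hmb : mink m b < 0) (hmb' : mink m b' < 0) (hlt : mink G'.normal b < 0) :
    Real.pi - dualAngle F G G' ≤ 2 * (Real.sinh (2 * h))⁻¹ := by
  have Hb := X.mem_H3 b hb
  have Hb' := X.mem_H3 b' hb'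
  have hmq : 0 < mink m q := by
    have h1 := Real.sinh_pos_iff.2 S.pos
    have h2 := mink_lt_zero S.center hq
    have h3 := Real.cosh_pos h
    have h4 : 0 < Real.cosh h * mink m q := lt_of_lt_of_le (mul_pos h1 (by linarith)) hqs
    exact pos_of_mul_pos_right h4 h3.le
  have hqb : q ≠ b := by rintro rfl; linarith
  have hqb' : q ≠ b' := by rintro rfl; linarith
  have dq : ∀ H : X.Face, mink H.normal q = 0 → mink (direction F H) q = 0 := fun H h => by
    rw [mink_direction H hFq, h]
  have pr : ∀ H : X.Face, mink H.normal q = 0 → ∀ y, mink F.normal y = 0 →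
      mink (direction F H) (proj q y) = mink H.normal y := by
    intro H hH y hy
    rw [mink_proj_of_orth (dq H hH), mink_direction H hy]
  have key : dualAngle F G G' = Real.pi - hangle q b b' := by
    refine mangle_normals_eq hq F.unit (mink_comm q _ ▸ hFq) (mink_normal_direction F G)
      (mink_normal_direction F G') ?_ ?_ ?_ ?_ (mink_proj_right hq b) (mink_proj_right hq b')
      (proj_ne_zero hq Hb hqb) (proj_ne_zero hq Hb' hqb') (direction_ne_zero hG)
      (direction_ne_zero hG') ?_ ?_ ?_ ?_
    · rw [mink_proj_of_orth hFq, hFb]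
    · rw [mink_proj_of_orth hFq, hFb']
    · rw [mink_comm, dq G hGq]
    · rw [mink_comm, dq G' hGq']
    · rw [pr G hGq b hFb, hGb]
    · rw [pr G' hGq' b' hFb', hGb']
    · rw [pr G hGq b' hFb']; exact G.supporting b' hb'
    · rw [pr G' hGq' b hFb]; exact hlt
  have := hangle_le_across_slab S.pos S.center S.unit S.orth hq Hb Hb' hqs (S.le_below hb hmb)
    (S.le_below hb' hmb')
  linarith

/-- The lines containing two edges of a face that cross the slab meet at a small angle, or do not
meet: a common point lies outside the slab, from where the far ends of the edges are seen under a
small angle. -/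
theorem edgeLineAngle_le (S : X.IsEmptySlab c m h) {F G G' : X.Face} (hG : F.Adj G)
    (hG' : F.Adj G') (hne : G ≠ G') (hc : F.EdgeCrosses G m) (hc' : F.EdgeCrosses G' m) :
    edgeLineAngle G F G' ≤ 2 * (Real.sinh (2 * h))⁻¹ := by
  have hpos : 0 ≤ 2 * (Real.sinh (2 * h))⁻¹ := by
    have := Real.sinh_pos_iff.2 (by linarith [S.pos] : 0 < 2 * h)
    positivity
  obtain ⟨⟨t, ht, hFt, hGt, hmt⟩, b, hb, hFb, hGb, hmb⟩ := hc
  obtain ⟨⟨t', ht', hFt', hGt', hmt'⟩, b', hb', hFb', hGb', hmb'⟩ := hc'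
  have Ht := X.mem_H3 t ht
  have Hb := X.mem_H3 b hb
  have htb : t ≠ b := by rintro rfl; linarith
  have hpu : ∀ H : X.Face, F ≠ H → ∀ x ∈ X.vertices, mink F.normal x = 0 →
      mink H.normal x = 0 → 0 < mink (direction F H) (direction F H) := by
    intro H hH x hx hFx hHx
    refine mink_self_pos_of_orth (mink_self_lt_zero (X.mem_H3 x hx)) ?_ (direction_ne_zero hH)
    rw [mink_comm, mink_direction H hFx, hHx]
  have huu := hpu G hG.ne t ht hFt hGt
  have huu' := hpu G' hG'.ne t' ht' hFt' hGt'
  obtain ⟨r, hr, hr1⟩ := exists_unit_scale huu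
  obtain ⟨r', hr', hr1'⟩ := exists_unit_scale huu'
  obtain ⟨u, hu⟩ : ∃ u, u = r • direction F G := ⟨_, rfl⟩
  obtain ⟨u', hu'⟩ : ∃ u', u' = r' • direction F G' := ⟨_, rfl⟩
  have uu : mink u u = 1 := by rw [hu, mink_smul_left, mink_smul_right, hr1]
  have uu' : mink u' u' = 1 := by rw [hu', mink_smul_left, mink_smul_right, hr1']
  have ux : ∀ x, mink F.normal x = 0 → mink u x = r * mink G.normal x := fun x hx => by
    rw [hu, mink_smul_left, mink_direction G hx]
  have ux' : ∀ x, mink F.normal x = 0 → mink u' x = r' * mink G'.normal x := fun x hx => by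
    rw [hu', mink_smul_left, mink_direction G' hx]
  have hangle_eq : dualAngle F G G' = Real.arccos (mink u u') := by
    have h1 : dualAngle F G G' = mangle u u' := by
      rw [hu, hu', mangle_smul_left hr, mangle_smul_right hr']
      rfl
    rw [h1, mangle, uu, uu', mul_one, Real.sqrt_one, div_one]
  obtain ⟨κ, hκ⟩ : ∃ κ, κ = mink u u' := ⟨_, rfl⟩
  rw [← hκ] at hangle_eq
  have hnotboth : ¬ (mink G'.normal t = 0 ∧ mink G'.normal b = 0) := fun hh =>
    hne (hG.eq_of_vertices hG' ht hb htb hFt hFb hGt hGb hh.1 hh.2)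
  have hτ : mink u' t ≤ 0 := by
    rw [ux' t hFt]
    exact mul_nonpos_of_nonneg_of_nonpos hr'.le (G'.supporting t ht)
  have hβ : mink u' b ≤ 0 := by
    rw [ux' b hFb]
    exact mul_nonpos_of_nonneg_of_nonpos hr'.le (G'.supporting b hb)
  rw [edgeLineAngle]
  rcases le_or_gt κ (-1) with hκ1 | hκ1
  · -- the lines are disjoint
    rw [hangle_eq, Real.arccos_eq_pi.2 hκ1, sub_self]
    exact hpos
  rcases le_or_gt 1 κ with hκ2 | hκ2
  · -- half-planes of disjoint lines bounding the same face are not nested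
    exfalso
    have hw : mink (u - u') (u - u') ≤ 0 := by
      rw [mink_sub_left, mink_sub_right, mink_sub_right, uu, uu', mink_comm u' u, ← hκ]
      linarith
    by_cases hw0 : u - u' = 0
    · apply hnotboth
      rw [sub_eq_zero] at hw0
      have h1 := ux' t hFt
      have h2 := ux' b hFb
      rw [← hw0, ux t hFt, hGt, mul_zero] at h1
      rw [← hw0, ux b hFb, hGb, mul_zero] at h2
      exact ⟨(mul_eq_zero.1 h1.symm).resolve_left hr'.ne',
        (mul_eq_zero.1 h2.symm).resolve_left hr'.ne'⟩
    · have h1 := mul_pos_of_causal hw hw0 Ht (X.mem_H3 t' ht')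
      rw [mink_sub_left, mink_sub_left, ux t hFt, hGt, ux' t' hFt', hGt', ux t' hFt'] at h1
      have h2 := mul_nonpos_of_nonneg_of_nonpos hr.le (G.supporting t' ht')
      nlinarith
  -- the lines meet in the point proportional to `⟨u', b⟩ t - ⟨u', t⟩ b`
  obtain ⟨τ, hτd⟩ : ∃ τ, τ = mink u' t := ⟨_, rfl⟩
  obtain ⟨β, hβd⟩ : ∃ β, β = mink u' b := ⟨_, rfl⟩
  obtain ⟨q, hq⟩ : ∃ q : E, q = β • t - τ • b := ⟨_, rfl⟩
  rw [← hτd] at hτ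
  rw [← hβd] at hβ
  have hxq : ∀ x, mink x q = β * mink x t - τ * mink x b := fun x => by
    rw [hq, mink_sub_right, mink_smul_right, mink_smul_right]
  have hFq : mink F.normal q = 0 := by rw [hxq, hFt, hFb]; ring
  have hGq : mink G.normal q = 0 := by rw [hxq, hGt, hGb]; ring
  have hGq' : mink G'.normal q = 0 := by
    have h1 := ux' q hFq
    rw [hxq, ← hτd, ← hβd] at h1
    have h2 : r' * mink G'.normal q = 0 := by linarith
    exact (mul_eq_zero.1 h2).resolve_left hr'.ne'
  have hqq : mink q q < 0 := by
    rw [hq, hτd, hβd]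
    refine mink_self_lt_zero_of_lines_meet Ht Hb htb F.unit hFt hFb uu uu' ?_ ?_ ?_ ?_
      (hκ ▸ hκ1) (hκ ▸ hκ2)
    · rw [hu, mink_smul_right, mink_normal_direction, mul_zero]
    · rw [hu', mink_smul_right, mink_normal_direction, mul_zero]
    · rw [ux t hFt, hGt, mul_zero]
    · rw [ux b hFb, hGb, mul_zero]
  have hq0 : q ≠ 0 := by
    intro h0
    rw [h0, mink_zero_left] at hqq
    exact lt_irrefl _ hqq
  have hcq := mul_pos_of_causal hqq.le hq0 S.center S.center
  have hcq0 : mink c q ≠ 0 := by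
    rw [mink_comm q c] at hcq
    intro h0
    rw [h0] at hcq
    norm_num at hcq
  have hct := S.center_neg ht
  have hcb := S.center_neg hb
  have hs := Real.sinh_pos_iff.2 S.pos
  have hch := Real.cosh_pos h
  have a1 := S.above_le ht hmt
  have a2 := S.le_below hb hmb
  have a3 : Real.sinh h * mink c t ≤ Real.cosh h * mink m t := by
    linarith [mul_pos hs (neg_pos.2 hct), mul_pos hch hmt]
  have a4 : Real.cosh h * mink m b ≤ -(Real.sinh h * mink c b) := by
    linarith [mul_pos hs (neg_pos.2 hcb), mul_pos hch (neg_pos.2 hmb)]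
  have hcqe := hxq c
  have hmqe := hxq m
  rcases lt_or_gt_of_ne hcq0 with hlt | hlt
  · obtain ⟨ρ, hρ, hρq⟩ := exists_smul_mem_H3 S.center hqq hlt
    refine S.neg.pi_sub_dualAngle_le_of_meet (q := ρ • q) (b := t) (b' := t') hG.ne hG'.ne hρq
      ?_ ?_ ?_ ?_ ht ht' hFt hFt' hGt hGt' ?_ ?_ ?_
    · rw [mink_smul_right, hFq, mul_zero]
    · rw [mink_smul_right, hGq, mul_zero]
    · rw [mink_smul_right, hGq', mul_zero]
    · rw [mink_neg_left, mink_smul_right, mink_smul_right, hcqe, hmqe]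
      have h1 : β * (Real.cosh h * mink m t - Real.sinh h * mink c t) ≤ 0 :=
        mul_nonpos_of_nonpos_of_nonneg hβ (by linarith)
      have h2 : τ * (Real.cosh h * mink m b - Real.sinh h * mink c b) ≥ 0 :=
        mul_nonneg_of_nonpos_of_nonpos hτ (by linarith)
      have h3 : 0 ≤ ρ * (τ * (Real.cosh h * mink m b - Real.sinh h * mink c b) -
          β * (Real.cosh h * mink m t - Real.sinh h * mink c t)) :=
        mul_nonneg hρ.le (by linarith)
      linarith
    · rw [mink_neg_left]; linarith
    · rw [mink_neg_left]; linarith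
    · refine lt_of_le_of_ne (G'.supporting t ht) fun h0 => ?_
      have h1 : τ = 0 := by rw [hτd, ux' t hFt, h0, mul_zero]
      rw [h1, zero_mul, sub_zero] at hcqe
      linarith [mul_nonneg_of_nonpos_of_nonpos hβ hct.le]
  · have hqn : mink (-q) (-q) < 0 := by rw [mink_neg_left, mink_neg_right, neg_neg]; exact hqq
    obtain ⟨ρ, hρ, hρq⟩ := exists_smul_mem_H3 S.center hqn
      (by rw [mink_neg_right]; linarith)
    refine S.pi_sub_dualAngle_le_of_meet (q := ρ • -q) (b := b) (b' := b') hG.ne hG'.ne hρq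
      ?_ ?_ ?_ ?_ hb hb' hFb hFb' hGb hGb' hmb hmb' ?_
    · rw [mink_smul_right, mink_neg_right, hFq, neg_zero, mul_zero]
    · rw [mink_smul_right, mink_neg_right, hGq, neg_zero, mul_zero]
    · rw [mink_smul_right, mink_neg_right, hGq', neg_zero, mul_zero]
    · rw [mink_smul_right, mink_smul_right, mink_neg_right, mink_neg_right, hcqe, hmqe]
      have h1 : β * (Real.cosh h * mink m t + Real.sinh h * mink c t) ≤ 0 :=
        mul_nonpos_of_nonpos_of_nonneg hβ (by linarith)
      have h2 : τ * (Real.cosh h * mink m b + Real.sinh h * mink c b) ≥ 0 :=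
        mul_nonneg_of_nonpos_of_nonpos hτ (by linarith)
      have h3 : 0 ≤ ρ * (τ * (Real.cosh h * mink m b + Real.sinh h * mink c b) -
          β * (Real.cosh h * mink m t + Real.sinh h * mink c t)) :=
        mul_nonneg hρ.le (by linarith)
      linarith
    · refine lt_of_le_of_ne (G'.supporting b hb) fun h0 => ?_
      have h1 : β = 0 := by rw [hβd, ux' b hFb, h0, mul_zero]
      rw [h1, zero_mul, zero_sub] at hcqe
      linarith [mul_nonneg_of_nonpos_of_nonpos hτ hcb.le]

end IsEmptySlab

end ConvexPolyhedron

/-! ### The exterior dihedral angles along the cycle -/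

/-- An angle whose cosine is not much below `cos g` is not much above `g`. The loss is quadratic in
`η` because the cosine is critical at `0`. -/
theorem arccos_le_add_of_cos_sub_le {x g η : ℝ} (hg0 : 0 ≤ g) (hgπ : g ≤ Real.pi) (hη : 0 ≤ η)
    (h : Real.cos g - 6 * η ^ 2 ≤ x) : Real.arccos x ≤ g + 6 * η := by
  rcases le_or_gt (Real.arccos x) g with h1 | h1
  · linarith
  have hx1 : x ≤ 1 := by
    by_contra hc
    rw [Real.arccos_eq_zero.2 (not_le.1 hc).le] at h1
    linarith
  have hcos : Real.cos g - 6 * η ^ 2 ≤ Real.cos (Real.arccos x) := by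
    rcases le_or_gt x (-1) with h2 | h2
    · rw [Real.arccos_eq_pi.2 h2, Real.cos_pi]; linarith
    · rw [Real.cos_arccos h2.le hx1]; exact h
  have hπ := Real.arccos_le_pi x
  generalize Real.arccos x = θ at *
  have hid : Real.cos g - Real.cos θ = 2 * Real.sin ((θ + g) / 2) * Real.sin ((θ - g) / 2) := by
    rw [Real.cos_sub_cos, ← neg_sub θ g, neg_div, Real.sin_neg, add_comm g]
    ring
  have hs2 : 2 / Real.pi * ((θ - g) / 2) ≤ Real.sin ((θ - g) / 2) :=
    Real.mul_le_sin (by linarith) (by linarith)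
  have hs1 : Real.sin ((θ - g) / 2) ≤ Real.sin ((θ + g) / 2) := by
    rcases le_or_gt ((θ + g) / 2) (Real.pi / 2) with h2 | h2
    · exact Real.sin_le_sin_of_le_of_le_pi_div_two (by linarith) h2 (by linarith)
    · rw [← Real.sin_pi_sub ((θ + g) / 2)]
      exact Real.sin_le_sin_of_le_of_le_pi_div_two (by linarith) (by linarith) (by linarith)
  have hpi := Real.pi_pos
  obtain ⟨y, hy⟩ : ∃ y, y = 2 / Real.pi * ((θ - g) / 2) := ⟨_, rfl⟩
  have hyv : θ - g = Real.pi * y := by rw [hy]; field_simp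
  rw [← hy] at hs2
  have hy0 : 0 < y := by
    by_contra hc
    nlinarith
  have hy3 : y ^ 2 ≤ 3 * η ^ 2 := by nlinarith
  have hpi2 : Real.pi ^ 2 < 12 := by nlinarith [Real.pi_lt_d2]
  have : (θ - g) ^ 2 ≤ (6 * η) ^ 2 := by
    rw [hyv]
    nlinarith [sq_nonneg y, sq_nonneg η]
  linarith [abs_le_of_sq_le_sq this (by positivity), le_abs_self (θ - g),
    (abs_le.1 (abs_le_of_sq_le_sq this (by positivity))).2]

/-- Two affine functions `p + q x`, `p - q y` with small values at two points `x`, `y` that are not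
small have small coefficients. -/
theorem abs_le_of_two_equations {p q x y d d' w s k : ℝ} (hs : 0 < s) (hsk : s ≤ k)
    (h1 : p + d + q * x = 0) (h2 : p + d' - q * y = 0) (hd : |k * d| ≤ w) (hd' : |k * d'| ≤ w)
    (hx : s ≤ k * x) (hy : s ≤ k * y) : |s * p| ≤ w ∧ |s * q| ≤ w := by
  have hk : 0 < k := by linarith
  have hx0 : 0 < x := pos_of_mul_pos_right (by linarith) hk.le
  have hy0 : 0 < y := pos_of_mul_pos_right (by linarith) hk.le
  have hw : 0 ≤ w := (abs_nonneg _).trans hd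
  constructor
  · have h3 : |k * p| * (x + y) ≤ w * (x + y) := by
      rw [← abs_of_pos (by linarith : 0 < x + y), ← abs_mul,
        show k * p * (x + y) = -(y * (k * d) + x * (k * d')) by
          linear_combination k * y * h1 + k * x * h2, abs_neg, abs_of_pos (by linarith : 0 < x + y)]
      refine (abs_add_le _ _).trans ?_
      rw [abs_mul y, abs_mul x, abs_of_pos hx0, abs_of_pos hy0]
      linarith [mul_le_mul_of_nonneg_left hd hy0.le, mul_le_mul_of_nonneg_left hd' hx0.le]
    have h4 := le_of_mul_le_mul_right h3 (by linarith)
    rw [abs_mul, abs_of_pos hk] at h4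
    rw [abs_mul, abs_of_pos hs]
    exact (mul_le_mul_of_nonneg_right hsk (abs_nonneg p)).trans h4
  · have h3 : |q| * (k * x + k * y) ≤ 2 * w := by
      rw [← abs_of_pos (by linarith : 0 < k * x + k * y), ← abs_mul,
        show q * (k * x + k * y) = k * d' - k * d by linear_combination k * h1 - k * h2]
      exact (abs_sub _ _).trans (by linarith)
    rw [abs_mul, abs_of_pos hs]
    nlinarith [abs_nonneg q]

/-- Two lengths whose squares are within about `ε` of `1` have a product within `2 ε` of `1`. -/
theorem abs_mul_sub_one_le {r r' ε : ℝ} (hε0 : 0 ≤ ε) (hε : ε ≤ 1 / 2) (hr : 0 ≤ r) (hr' : 0 ≤ r')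
    (h1 : (1 - ε) * r ^ 2 ≤ 1) (h2 : 1 ≤ (1 + ε) * r ^ 2) (h3 : (1 - ε) * r' ^ 2 ≤ 1)
    (h4 : 1 ≤ (1 + ε) * r' ^ 2) : r * r' ≤ 2 ∧ |r * r' - 1| ≤ 2 * ε := by
  have h0 : 0 ≤ r * r' := mul_nonneg hr hr'
  have h5 : (1 - ε) * (r * r') ≤ 1 := by
    refine (abs_le_of_sq_le_sq' ?_ zero_le_one).2
    have := mul_le_mul h1 h3 (mul_nonneg (by linarith) (sq_nonneg r')) zero_le_one
    calc ((1 - ε) * (r * r')) ^ 2 = (1 - ε) * r ^ 2 * ((1 - ε) * r' ^ 2) := by ring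
      _ ≤ 1 * 1 := this
      _ = 1 ^ 2 := by norm_num
  have h6 : 1 ≤ (1 + ε) * (r * r') := by
    refine (abs_le_of_sq_le_sq' ?_ (by positivity)).2
    have := mul_le_mul h2 h4 zero_le_one (by positivity)
    calc (1 : ℝ) ^ 2 = 1 * 1 := by norm_num
      _ ≤ (1 + ε) * r ^ 2 * ((1 + ε) * r' ^ 2) := this
      _ = ((1 + ε) * (r * r')) ^ 2 := by ring
  have h7 : r * r' ≤ 2 := by
    linarith [mul_nonneg (by linarith : 0 ≤ 1 / 2 - ε) h0]
  have h8 := mul_le_mul_of_nonneg_left h7 hε0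
  exact ⟨h7, abs_le.2 ⟨by linarith, by linarith⟩⟩

namespace ConvexPolyhedron

variable {X : ConvexPolyhedron}

namespace IsEmptySlab

variable {c m e₁ e₂ : E} {h : ℝ}

/-- Seen from `c`, the vertices are close to the common perpendicular of the slab: in the projective
chart centered at `c`, their distance from it is at most `1 / cosh h`. -/
theorem sq_add_sq_le (S : X.IsEmptySlab c m h) (fr : IsFrame c e₁ e₂ m) {v : E}
    (hv : v ∈ X.vertices) :
    Real.cosh h ^ 2 * (mink e₁ v ^ 2 + mink e₂ v ^ 2) ≤ mink c v ^ 2 := by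
  have h1 := fr.mink_eq v v
  rw [(X.mem_H3 v hv).1] at h1
  have h2 := S.empty v hv
  have h3 := S.center_neg hv
  have h4 : (Real.sinh h * -mink c v) ^ 2 ≤ (Real.cosh h * |mink m v|) ^ 2 :=
    pow_le_pow_left₀ (mul_nonneg (Real.sinh_pos_iff.2 S.pos).le (by linarith)) h2 2
  rw [mul_pow, mul_pow, sq_abs] at h4
  have h5 := Real.cosh_sq h
  have h6 := sq_nonneg (Real.cosh h)
  nlinarith

/-- The normal of a face that crosses the slab is almost orthogonal to the common perpendicular:
its components along `c` and `m` are small in comparison to the remaining ones. -/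
theorem normal_components_le (S : X.IsEmptySlab c m h) (fr : IsFrame c e₁ e₂ m) {F : X.Face}
    (hF : F.Crosses m) :
    Real.sinh h ^ 2 * mink c F.normal ^ 2 ≤ mink e₁ F.normal ^ 2 + mink e₂ F.normal ^ 2 ∧
      Real.sinh h ^ 2 * mink m F.normal ^ 2 ≤ mink e₁ F.normal ^ 2 + mink e₂ F.normal ^ 2 := by
  obtain ⟨⟨t, ht, hFt, hmt⟩, b, hb, hFb, hmb⟩ := hF
  have hs := Real.sinh_pos_iff.2 S.pos
  have hc := Real.cosh_pos h
  have hcs := Real.cosh_sq h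
  have t1 := S.sq_add_sq_le fr ht
  have b1 := S.sq_add_sq_le fr hb
  have t2 := S.above_le ht hmt
  have b2 := S.le_below hb hmb
  have t3 := S.center_neg ht
  have b3 := S.center_neg hb
  rw [fr.mink_eq F.normal t] at hFt
  rw [fr.mink_eq F.normal b] at hFb
  obtain ⟨w, hw⟩ : ∃ w, w = √(mink e₁ F.normal ^ 2 + mink e₂ F.normal ^ 2) := ⟨_, rfl⟩
  have hw2 : mink e₁ F.normal ^ 2 + mink e₂ F.normal ^ 2 = w ^ 2 := by
    rw [hw, Real.sq_sqrt (by positivity)]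
  have hw0 : 0 ≤ w := hw ▸ Real.sqrt_nonneg _
  -- Cauchy-Schwarz for the components along `e₁`, `e₂`
  have cs : ∀ v, Real.cosh h ^ 2 * (mink e₁ v ^ 2 + mink e₂ v ^ 2) ≤ mink c v ^ 2 → mink c v < 0 →
      |Real.cosh h * ((mink e₁ F.normal * mink e₁ v + mink e₂ F.normal * mink e₂ v) / -mink c v)|
        ≤ w := by
    intro v h1 h0
    have h0' : 0 < -mink c v := by linarith
    rw [← mul_div_assoc, abs_div, abs_of_pos h0', div_le_iff₀ h0']
    refine abs_le_of_sq_le_sq ?_ (mul_nonneg hw0 h0'.le)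
    have h2 := mul_le_mul_of_nonneg_left h1 (sq_nonneg w)
    have h3 : (mink e₁ F.normal * mink e₁ v + mink e₂ F.normal * mink e₂ v) ^ 2 ≤
        w ^ 2 * (mink e₁ v ^ 2 + mink e₂ v ^ 2) := by
      rw [← hw2]
      linarith [sq_nonneg (mink e₁ F.normal * mink e₂ v - mink e₂ F.normal * mink e₁ v)]
    have h4 := mul_le_mul_of_nonneg_left h3 (sq_nonneg (Real.cosh h))
    linarith
  rw [hw2]
  have key := abs_le_of_two_equations (p := mink c F.normal) (q := mink m F.normal)
    (x := mink m t / -mink c t) (y := -mink m b / -mink c b) hs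
    (by linarith [Real.sinh_lt_cosh h]) ?_ ?_ (cs t t1 t3) (cs b b1 b3) ?_ ?_
  · rw [← mul_pow, ← mul_pow]
    exact ⟨sq_le_sq' (abs_le.1 key.1).1 (abs_le.1 key.1).2,
      sq_le_sq' (abs_le.1 key.2).1 (abs_le.1 key.2).2⟩
  · have : mink c t ≠ 0 := t3.ne
    field_simp
    linarith
  · have : mink c b ≠ 0 := b3.ne
    field_simp
    linarith
  · rw [← mul_div_assoc, le_div_iff₀ (by linarith)]
    exact t2
  · rw [← mul_div_assoc, le_div_iff₀ (by linarith)]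
    linarith

/-- The exterior dihedral angle of two faces with a common crossing edge exceeds the angle between
their traces in the middle plane, seen from `c`, by a small amount only. -/
theorem extDihedral_le (S : X.IsEmptySlab c m h) (fr : IsFrame c e₁ e₂ m) {F G : X.Face}
    (hF : F.Crosses m) (hG : G.Crosses m) (hh : 2 ≤ Real.sinh h ^ 2) {g : ℝ} (hg0 : 0 ≤ g)
    (hgπ : g ≤ Real.pi)
    (hg : mink e₁ F.normal * mink e₁ G.normal + mink e₂ F.normal * mink e₂ G.normal =
      √(mink e₁ F.normal ^ 2 + mink e₂ F.normal ^ 2) *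
        √(mink e₁ G.normal ^ 2 + mink e₂ G.normal ^ 2) * Real.cos g) :
    extDihedral F G ≤ g + 6 * (Real.sinh h)⁻¹ := by
  have hs := Real.sinh_pos_iff.2 S.pos
  have w : ∀ {F : X.Face}, F.Crosses m →
      ∃ r, r = √(mink e₁ F.normal ^ 2 + mink e₂ F.normal ^ 2) ∧ 0 ≤ r ∧
        r ^ 2 = 1 + mink c F.normal ^ 2 - mink m F.normal ^ 2 ∧
        |mink c F.normal| ≤ (Real.sinh h)⁻¹ * r ∧ |mink m F.normal| ≤ (Real.sinh h)⁻¹ * r := by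
    intro F hF
    obtain ⟨h1, h2⟩ := S.normal_components_le fr hF
    have h3 := fr.mink_eq F.normal F.normal
    rw [F.unit] at h3
    have h4 : 0 ≤ mink e₁ F.normal ^ 2 + mink e₂ F.normal ^ 2 := by positivity
    have h5 : ∀ z : ℝ, Real.sinh h ^ 2 * z ^ 2 ≤ mink e₁ F.normal ^ 2 + mink e₂ F.normal ^ 2 →
        |z| ≤ (Real.sinh h)⁻¹ * √(mink e₁ F.normal ^ 2 + mink e₂ F.normal ^ 2) := by
      intro z hz
      rw [inv_mul_eq_div, le_div_iff₀ hs]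
      apply Real.le_sqrt_of_sq_le
      rw [mul_pow, sq_abs]
      linarith
    refine ⟨_, rfl, Real.sqrt_nonneg _, ?_, h5 _ h1, h5 _ h2⟩
    rw [Real.sq_sqrt h4]
    linarith
  obtain ⟨r, hr, hr0, hr1, hr2, hr3⟩ := w hF
  obtain ⟨r', hr', hr0', hr1', hr2', hr3'⟩ := w hG
  rw [← hr, ← hr'] at hg
  rw [extDihedral]
  refine arccos_le_add_of_cos_sub_le hg0 hgπ (inv_pos.2 hs).le ?_
  rw [fr.mink_eq F.normal G.normal]
  have hη : (Real.sinh h)⁻¹ ^ 2 ≤ 1 / 2 := by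
    rw [inv_pow, inv_le_comm₀ (by positivity) (by norm_num)]
    norm_num
    exact hh
  have hη0 := (inv_pos.2 hs).le
  have hc1 := Real.cos_le_one g
  have hc2 := Real.neg_one_le_cos g
  generalize (Real.sinh h)⁻¹ = η at *
  generalize Real.cos g = κ at *
  have sq : ∀ {z ρ : ℝ}, |z| ≤ η * ρ → z ^ 2 ≤ η ^ 2 * ρ ^ 2 := by
    intro z ρ hz
    rw [← mul_pow, ← sq_abs z]
    exact pow_le_pow_left₀ (abs_nonneg z) hz 2
  -- the products of the small components
  have hp : |mink c F.normal * mink c G.normal| ≤ η ^ 2 * (r * r') := by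
    rw [abs_mul]
    calc _ ≤ (η * r) * (η * r') := mul_le_mul hr2 hr2' (abs_nonneg _) (by positivity)
      _ = _ := by ring
  have hq : |mink m F.normal * mink m G.normal| ≤ η ^ 2 * (r * r') := by
    rw [abs_mul]
    calc _ ≤ (η * r) * (η * r') := mul_le_mul hr3 hr3' (abs_nonneg _) (by positivity)
      _ = _ := by ring
  have hp' := (abs_le.1 hp).2
  have hq' := (abs_le.1 hq).1
  have a1 := sq hr2
  have a2 := sq hr3
  have a3 := sq hr2'
  have a4 := sq hr3'
  have hrl : ∀ ρ z z' : ℝ, 0 ≤ ρ → ρ ^ 2 = 1 + z ^ 2 - z' ^ 2 → z ^ 2 ≤ η ^ 2 * ρ ^ 2 →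
      z' ^ 2 ≤ η ^ 2 * ρ ^ 2 → (1 - η ^ 2) * ρ ^ 2 ≤ 1 ∧ 1 ≤ (1 + η ^ 2) * ρ ^ 2 := by
    intro ρ z z' h0 h1 h2 h3
    constructor
    · linarith [sq_nonneg z']
    · linarith [sq_nonneg z]
  obtain ⟨b1, b2⟩ := hrl r _ _ hr0 hr1 a1 a2
  obtain ⟨b3, b4⟩ := hrl r' _ _ hr0' hr1' a3 a4
  have hη2 : 0 ≤ η ^ 2 := sq_nonneg η
  obtain ⟨hR3, hR4⟩ := abs_mul_sub_one_le hη2 hη hr0 hr0' b1 b2 b3 b4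
  have hR5 : |(r * r' - 1) * κ| ≤ 2 * η ^ 2 := by
    rw [abs_mul]
    exact (mul_le_of_le_one_right (abs_nonneg _) (abs_le.2 ⟨hc2, hc1⟩)).trans hR4
  have hR6 := (abs_le.1 hR5).1
  have hR7 := mul_le_mul_of_nonneg_left hR3 hη2
  linarith

end IsEmptySlab

/-! ### Dual arcs and the transverse cycle -/

/-- The dual arc of two faces with a common vertex lies in the Gaussian image: its points are
positive multiples of convex combinations of the two normals, and the planes orthogonal to them
support the polyhedron at the common vertex. -/
theorem dualArc_mem_gaussianImage {F G : X.Face} (hFG : F ≠ G) {v : E} (hv : v ∈ X.vertices)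
    (hFv : mink F.normal v = 0) (hGv : mink G.normal v = 0) :
    dualArc F G 0 = F.normal ∧ dualArc F G 1 = G.normal ∧
      ContinuousOn (dualArc F G) (Set.Icc 0 1) ∧
      Set.MapsTo (dualArc F G) (Set.Icc 0 1) X.gaussianImage := by
  have hpos : ∀ s ∈ Set.Icc (0 : ℝ) 1,
      0 < mink ((1 - s) • F.normal + s • G.normal) ((1 - s) • F.normal + s • G.normal) := by
    rintro s ⟨h0, h1⟩
    refine mink_self_pos_of_orth (mink_self_lt_zero (X.mem_H3 v hv)) ?_ ?_
    · rw [mink_comm, mink_add_left, mink_smul_left, mink_smul_left, hFv, hGv]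
      ring
    · intro h2
      -- a vertex on only one of the two faces shows that `s` is `0` or `1`
      have key : ∀ u : E, (1 - s) * mink F.normal u + s * mink G.normal u = 0 := fun u => by
        rw [← mink_smul_left, ← mink_smul_left, ← mink_add_left, h2, mink_zero_left]
      obtain ⟨u, hu, hFu, hGu⟩ := Face.exists_vertex_ne hFG
      have h3 := key u
      rw [hFu, mul_zero, zero_add] at h3
      have h4 : s = 0 := (mul_eq_zero.1 h3).resolve_right hGu
      have h5 := key F.normal
      rw [h4, F.unit] at h5
      norm_num at h5
  refine ⟨?_, ?_, ?_, ?_⟩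
  · simp [dualArc, F.unit]
  · simp [dualArc, G.unit]
  · have hw : Continuous fun s : ℝ => (1 - s) • F.normal + s • G.normal := by fun_prop
    have hm : Continuous fun s : ℝ =>
        mink ((1 - s) • F.normal + s • G.normal) ((1 - s) • F.normal + s • G.normal) := by
      unfold mink
      fun_prop
    refine ContinuousOn.smul (ContinuousOn.inv₀ hm.sqrt.continuousOn fun s hs => ?_)
      hw.continuousOn
    exact (Real.sqrt_pos.2 (hpos s hs)).ne'
  · intro s hs
    have h1 := hpos s hs
    have h2 := Real.sqrt_pos.2 h1
    have h3 := Real.sq_sqrt h1.le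
    have hmw : ∀ x, mink ((1 - s) • F.normal + s • G.normal) x =
        (1 - s) * mink F.normal x + s * mink G.normal x := fun x => by
      rw [mink_add_left, mink_smul_left, mink_smul_left]
    simp only [dualArc]
    refine ⟨?_, ?_, v, mem_carrier_of_mem_vertices hv, ?_⟩
    · rw [mink_smul_left, mink_smul_right, ← mul_assoc, ← mul_inv, ← pow_two, h3,
        inv_mul_cancel₀ h1.ne']
    · intro x hx
      rw [mink_smul_left, hmw x]
      exact mul_nonpos_of_nonneg_of_nonpos (inv_pos.2 h2).le (add_nonpos
        (mul_nonpos_of_nonneg_of_nonpos (by linarith [hs.2])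
          (mink_nonpos_of_mem_carrier F.supporting hx))
        (mul_nonpos_of_nonneg_of_nonpos hs.1 (mink_nonpos_of_mem_carrier G.supporting hx)))
    · rw [mink_smul_left, hmw v, hFv, hGv]
      ring

theorem Face.EdgeCrosses.adj {F G : X.Face} {m : E} (h : F.EdgeCrosses G m) (hne : F ≠ G) :
    F.Adj G := by
  obtain ⟨⟨t, ht, hFt, hGt, hmt⟩, b, hb, hFb, hGb, hmb⟩ := h
  exact Face.adj_of_vertices hne ht hb (by rintro rfl; linarith) hFt hFb hGt hGb

theorem Face.EdgeCrosses.exists_mem {F G : X.Face} {m : E} (h : F.EdgeCrosses G m) :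
    ∃ x ∈ F.carrier ∩ G.carrier, mink m x = 0 := by
  obtain ⟨⟨t, ht, hFt, hGt, hmt⟩, b, hb, hFb, hGb, hmb⟩ := h
  obtain ⟨x, hx, r, -, rfl⟩ := exists_mem_carrier_cross ht hb hmt hmb
  refine ⟨_, ⟨⟨hx, ?_⟩, hx, ?_⟩, ?_⟩
  · rw [mink_smul_right, mink_cross, hFt, hFb]; ring
  · rw [mink_smul_right, mink_cross, hGt, hGb]; ring
  · rw [mink_smul_right, mink_cross_self, mul_zero]

end ConvexPolyhedron

theorem finRotate_ne {k : ℕ} (hk : 2 ≤ k) (i : Fin k) : finRotate k i ≠ i := by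
  obtain ⟨n, rfl⟩ : ∃ n, k = n + 2 := ⟨k - 2, by omega⟩
  rw [finRotate_apply]
  intro h
  rw [add_eq_left] at h
  exact one_ne_zero h

theorem finRotate_ne_symm {k : ℕ} (hk : 3 ≤ k) (i : Fin k) :
    (finRotate k).symm i ≠ finRotate k i := by
  obtain ⟨n, rfl⟩ : ∃ n, k = n + 3 := ⟨k - 3, by omega⟩
  intro h
  rw [Equiv.symm_apply_eq, finRotate_apply, finRotate_apply, add_assoc] at h
  have h1 : (1 + 1 : Fin (n + 3)) = 0 := left_eq_add.1 h
  have h2 := congrArg Fin.val h1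
  simp only [Fin.val_add, Fin.val_one, Fin.val_zero] at h2
  rw [Nat.mod_eq_of_lt (by omega)] at h2
  omega

namespace ConvexPolyhedron

variable {X : ConvexPolyhedron}

/-- The cycle of faces around a vertex-free slab, with the estimates for its dual curve in terms of
the half-width `h` of the slab and the number of faces. -/
theorem IsEmptySlab.exists_transverseCycle {c m : E} {h : ℝ} (S : X.IsEmptySlab c m h)
    (hh : 2 ≤ Real.sinh h ^ 2) :
    ∃ (k : ℕ) (F : Fin k → X.Face), k ≤ 2 ^ #X.vertices ∧ IsTransverseCycle F m ∧
      ∑ i, extDihedral (F i) (F (finRotate k i)) ≤ 2 * Real.pi + k * (6 * (Real.sinh h)⁻¹) ∧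
      IsCurveInGaussianImage F ∧
      geodesicCurvature F ≤ k * (2 * (Real.sinh (2 * h))⁻¹) ∧
      ∑ i, edgeLineAngle (F ((finRotate k).symm i)) (F i) (F (finRotate k i))
        ≤ k * (2 * (Real.sinh (2 * h))⁻¹) := by
  obtain ⟨e₁, e₂, fr⟩ := exists_isFrame S.center.1 S.unit S.orth
  obtain ⟨k, F, gap, hk, hinj, hF, hgap, hsum, hcr, hcos⟩ := S.exists_cycle fr
  have hne : ∀ i, F i ≠ F (finRotate k i) := fun i hi =>
    finRotate_ne (by omega) i (hinj hi).symm
  have hadj := fun i => (hcr i).adj (hne i)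
  have hcr' : ∀ i, (F i).EdgeCrosses (F ((finRotate k).symm i)) m := fun i => by
    have := hcr ((finRotate k).symm i)
    rw [Equiv.apply_symm_apply] at this
    exact this.symm
  have hadj' : ∀ i, (F i).Adj (F ((finRotate k).symm i)) := fun i => by
    have := hadj ((finRotate k).symm i)
    rw [Equiv.apply_symm_apply] at this
    exact this.symm
  have hne' : ∀ i, F ((finRotate k).symm i) ≠ F (finRotate k i) := fun i hi =>
    finRotate_ne_symm hk i (hinj hi)
  refine ⟨k, F, ?_, ⟨hk, hinj, fun G => (hF G).trans (S.crosses_iff G),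
    fun i => ⟨hadj i, (hcr i).exists_mem⟩⟩, ?_, ?_, ?_, ?_⟩
  · have h1 := Nat.card_le_card_of_injective F hinj
    rw [Nat.card_fin] at h1
    exact h1.trans (Face.card_le X)
  · rw [← hsum]
    calc _ ≤ ∑ i, (gap i + 6 * (Real.sinh h)⁻¹) := sum_le_sum fun i _ =>
          S.extDihedral_le fr ((hF _).1 ⟨i, rfl⟩) ((hF _).1 ⟨_, rfl⟩) hh (hgap i).1.le
            (hgap i).2.le (hcos i)
      _ = _ := by rw [sum_add_distrib, sum_const, card_univ, Fintype.card_fin, nsmul_eq_mul]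
  · intro i
    obtain ⟨⟨t, ht, hFt, hGt, -⟩, -⟩ := hcr i
    exact dualArc_mem_gaussianImage (hne i) ht hFt hGt
  · refine (sum_le_card_nsmul _ _ _ fun i _ =>
      S.turning_le (hadj' i) (hadj i) (hne' i) (hcr' i) (hcr i)).trans_eq ?_
    rw [card_univ, Fintype.card_fin, nsmul_eq_mul]
  · refine (sum_le_card_nsmul _ _ _ fun i _ =>
      S.edgeLineAngle_le (hadj' i) (hadj i) (hne' i) (hcr' i) (hcr i)).trans_eq ?_
    rw [card_univ, Fintype.card_fin, nsmul_eq_mul]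

/-! ### Diameters -/

/-- The distance to a fixed point of hyperbolic space is not maximal on the polyhedron at points
that are not vertices. -/
theorem exists_vertex_mink_lt {x y : E} (hx : x ∈ X.carrier) (hxv : x ∉ X.vertices) (hy : y ∈ H3) :
    ∃ v ∈ X.vertices, mink v y < mink x y := by
  obtain ⟨r, w, hr, h0, h1, h2⟩ := exists_weights_of_mem_carrier hx
  -- the point of the chord is well inside the hyperboloid
  have hr1 : 1 < r := by
    have h3 := congrArg (mink x) h2
    rw [mink_sum_right, mink_smul_right, hx.1.1] at h3
    simp only [mink_smul_right] at h3
    have h4 : ∑ v ∈ X.vertices, w v * mink x v < ∑ v ∈ X.vertices, w v * -1 := by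
      obtain ⟨v, hv, hwv⟩ : ∃ v ∈ X.vertices, w v ≠ 0 := by
        by_contra hcon
        push Not at hcon
        rw [sum_eq_zero hcon] at h1
        norm_num at h1
      refine sum_lt_sum (fun u hu => mul_le_mul_of_nonneg_left
        (mink_le_neg_one hx.1 (X.mem_H3 u hu)) (h0 u hu)) ⟨v, hv, ?_⟩
      exact mul_lt_mul_of_pos_left (mink_lt_neg_one hx.1 (X.mem_H3 v hv)
        (by rintro rfl; exact hxv hv))
        (lt_of_le_of_ne (h0 v hv) hwv.symm)
    rw [← sum_mul, h1] at h4
    linarith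
  by_contra hcon
  push Not at hcon
  have h3 := congrArg (mink y) h2
  rw [mink_sum_right, mink_smul_right] at h3
  simp only [mink_smul_right] at h3
  have h4 : ∑ v ∈ X.vertices, w v * mink y x ≤ ∑ v ∈ X.vertices, w v * mink y v :=
    sum_le_sum fun v hv => mul_le_mul_of_nonneg_left
      (by rw [mink_comm y x, mink_comm y v]; exact hcon v hv) (h0 v hv)
  rw [← sum_mul, h1, one_mul, h3] at h4
  have h5 := mink_lt_zero hy hx.1
  nlinarith

theorem exists_vertex_mink_le {x y : E} (hx : x ∈ X.carrier) (hy : y ∈ H3) :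
    ∃ v ∈ X.vertices, mink v y ≤ mink x y := by
  by_cases hxv : x ∈ X.vertices
  · exact ⟨x, hxv, le_rfl⟩
  · obtain ⟨v, hv, h⟩ := exists_vertex_mink_lt hx hxv hy
    exact ⟨v, hv, h.le⟩

theorem hdist_le_hdist_iff {x y z w : E} (hx : x ∈ H3) (hy : y ∈ H3) (hz : z ∈ H3) (hw : w ∈ H3) :
    hdist x y ≤ hdist z w ↔ mink z w ≤ mink x y := by
  have h1 := mink_le_neg_one hx hy
  have h2 := mink_le_neg_one hz hw
  rw [hdist, hdist, Real.arcosh_le_arcosh (by linarith) (by linarith), neg_le_neg_iff]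

/-- The distance of points of the polyhedron takes a maximum, at a pair of vertices. -/
theorem exists_forall_hdist_le (X : ConvexPolyhedron) : ∃ a ∈ X.carrier, ∃ b ∈ X.carrier,
    ∀ x ∈ X.carrier, ∀ y ∈ X.carrier, hdist x y ≤ hdist a b := by
  obtain ⟨⟨a, b⟩, hab, hmin⟩ := exists_min_image (X.vertices ×ˢ X.vertices)
    (fun p => mink p.1 p.2) (X.vertices_nonempty.product X.vertices_nonempty)
  obtain ⟨ha, hb⟩ := mem_product.1 hab
  refine ⟨a, mem_carrier_of_mem_vertices ha, b, mem_carrier_of_mem_vertices hb, ?_⟩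
  intro x hx y hy
  rw [hdist_le_hdist_iff hx.1 hy.1 (X.mem_H3 a ha) (X.mem_H3 b hb)]
  obtain ⟨v, hv, h1⟩ := exists_vertex_mink_le hx hy.1
  obtain ⟨w, hw, h2⟩ := exists_vertex_mink_le hy (X.mem_H3 v hv)
  have h3 := hmin (v, w) (mem_product.2 ⟨hv, hw⟩)
  rw [mink_comm w v, mink_comm y v] at h2
  simp only at h3
  linarith

theorem exists_isDiameter (X : ConvexPolyhedron) : ∃ a b, X.IsDiameter a b := by
  obtain ⟨a, ha, b, hb, h⟩ := X.exists_forall_hdist_le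
  have hg : IsGreatest {d | ∃ x ∈ X.carrier, ∃ y ∈ X.carrier, d = hdist x y} (hdist a b) := by
    refine ⟨⟨a, ha, b, hb, rfl⟩, ?_⟩
    rintro d ⟨x, hx, y, hy, rfl⟩
    exact h x hx y hy
  exact ⟨a, b, ha, hb, hg.csSup_eq.symm⟩

namespace IsDiameter

variable {a b : E}

theorem mink_le (D : X.IsDiameter a b) {x y : E} (hx : x ∈ X.carrier) (hy : y ∈ X.carrier) :
    mink a b ≤ mink x y := by
  obtain ⟨a', ha', b', hb', h⟩ := X.exists_forall_hdist_le
  rw [← hdist_le_hdist_iff hx.1 hy.1 D.1.1 D.2.1.1, D.2.2]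
  refine le_csSup ⟨hdist a' b', ?_⟩ ⟨x, hx, y, hy, rfl⟩
  rintro d ⟨x, hx, y, hy, rfl⟩
  exact h x hx y hy

theorem symm (D : X.IsDiameter a b) : X.IsDiameter b a :=
  ⟨D.2.1, D.1, by rw [← D.2.2, hdist, hdist, mink_comm]⟩

theorem left_mem_vertices (D : X.IsDiameter a b) : a ∈ X.vertices := by
  by_contra ha
  obtain ⟨v, hv, h⟩ := exists_vertex_mink_lt D.1 ha D.2.1.1
  exact absurd (D.mink_le (mem_carrier_of_mem_vertices hv) D.2.1) (not_le.2 h)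

theorem right_mem_vertices (D : X.IsDiameter a b) : b ∈ X.vertices := D.symm.left_mem_vertices

theorem ne (D : X.IsDiameter a b) (h : 0 < X.diam) : a ≠ b := by
  rintro rfl
  rw [← D.2.2, hdist, D.1.1.1, neg_neg, Real.arcosh_zero] at h
  exact lt_irrefl _ h

end IsDiameter

end ConvexPolyhedron

/-! ### The planes orthogonal to a geodesic -/

/-- The unit tangent vector at `a` of the geodesic from `a` to `b`. -/
noncomputable def unitTangent (a b : E) : E :=
  (Real.sinh (hdist a b))⁻¹ • (b - Real.cosh (hdist a b) • a)

/-- The point at distance `s` from `a` on the geodesic from `a` to `b`. -/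
noncomputable def geodesicPoint (a b : E) (s : ℝ) : E :=
  Real.cosh s • a + Real.sinh s • unitTangent a b

theorem orthNormal_eq (a b : E) (s : ℝ) :
    orthNormal a b s = Real.sinh s • a + Real.cosh s • unitTangent a b := rfl

section Geodesic

variable {a b : E}

theorem cosh_hdist (ha : a ∈ H3) (hb : b ∈ H3) : Real.cosh (hdist a b) = -mink a b :=
  Real.cosh_arcosh (by linarith [mink_le_neg_one ha hb])

theorem hdist_pos (ha : a ∈ H3) (hb : b ∈ H3) (hab : a ≠ b) : 0 < hdist a b :=
  Real.arcosh_pos (by linarith [mink_lt_neg_one ha hb hab])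

theorem mink_left_unitTangent (ha : a ∈ H3) (hb : b ∈ H3) : mink a (unitTangent a b) = 0 := by
  rw [unitTangent, mink_smul_right, mink_sub_right, mink_smul_right, ha.1, cosh_hdist ha hb]
  ring

theorem mink_right_unitTangent (ha : a ∈ H3) (hb : b ∈ H3) (hab : a ≠ b) :
    mink b (unitTangent a b) = Real.sinh (hdist a b) := by
  have h1 := Real.sinh_pos_iff.2 (hdist_pos ha hb hab)
  have h2 := Real.cosh_sq (hdist a b)
  have h3 := cosh_hdist ha hb
  rw [unitTangent, mink_smul_right, mink_sub_right, mink_smul_right, hb.1, mink_comm b a]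
  rw [inv_mul_eq_iff_eq_mul₀ h1.ne', show mink a b = -Real.cosh (hdist a b) by linarith]
  linarith

theorem mink_unitTangent_self (ha : a ∈ H3) (hb : b ∈ H3) (hab : a ≠ b) :
    mink (unitTangent a b) (unitTangent a b) = 1 := by
  have h1 := Real.sinh_pos_iff.2 (hdist_pos ha hb hab)
  have h2 : ∀ w, mink (unitTangent a b) w =
      (Real.sinh (hdist a b))⁻¹ * (mink b w - Real.cosh (hdist a b) * mink a w) := fun w => by
    rw [unitTangent, mink_smul_left, mink_sub_left, mink_smul_left]
  rw [h2, mink_left_unitTangent ha hb, mink_right_unitTangent ha hb hab, mul_zero, sub_zero,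
    inv_mul_cancel₀ h1.ne']

theorem mink_orthNormal_left (ha : a ∈ H3) (hb : b ∈ H3) (s : ℝ) :
    mink (orthNormal a b s) a = -Real.sinh s := by
  rw [mink_comm, orthNormal_eq, mink_add_right, mink_smul_right, mink_smul_right, ha.1,
    mink_left_unitTangent ha hb]
  ring

theorem mink_orthNormal_right (ha : a ∈ H3) (hb : b ∈ H3) (hab : a ≠ b) (s : ℝ) :
    mink (orthNormal a b s) b = Real.sinh (hdist a b - s) := by
  rw [mink_comm, orthNormal_eq, mink_add_right, mink_smul_right, mink_smul_right,
    mink_right_unitTangent ha hb hab, Real.sinh_sub, cosh_hdist ha hb, mink_comm b a]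
  ring

theorem mink_orthNormal_self (ha : a ∈ H3) (hb : b ∈ H3) (hab : a ≠ b) (s : ℝ) :
    mink (orthNormal a b s) (orthNormal a b s) = 1 := by
  have h1 := Real.cosh_sq s
  simp only [orthNormal_eq, mink_add_left, mink_add_right, mink_smul_left, mink_smul_right, ha.1,
    mink_left_unitTangent ha hb, mink_comm (unitTangent a b) a, mink_unitTangent_self ha hb hab]
  linarith

theorem mink_geodesicPoint_orthNormal (ha : a ∈ H3) (hb : b ∈ H3) (hab : a ≠ b) (s : ℝ) :
    mink (geodesicPoint a b s) (orthNormal a b s) = 0 := by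
  simp only [geodesicPoint, orthNormal_eq, mink_add_left, mink_add_right, mink_smul_left,
    mink_smul_right, ha.1, mink_left_unitTangent ha hb, mink_comm (unitTangent a b) a,
    mink_unitTangent_self ha hb hab]
  ring

theorem geodesicPoint_mem_H3 (ha : a ∈ H3) (hb : b ∈ H3) (hab : a ≠ b) (s : ℝ) :
    geodesicPoint a b s ∈ H3 := by
  have h0 : mink (geodesicPoint a b s) (geodesicPoint a b s) = -1 := by
    have h1 := Real.cosh_sq s
    simp only [geodesicPoint, mink_add_left, mink_add_right, mink_smul_left, mink_smul_right, ha.1,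
      mink_left_unitTangent ha hb, mink_comm (unitTangent a b) a, mink_unitTangent_self ha hb hab]
    linarith
  obtain ⟨r, hr, h⟩ := exists_smul_mem_H3 (q := geodesicPoint a b s) ha (by rw [h0]; norm_num) (by
    rw [geodesicPoint, mink_add_right, mink_smul_right, mink_smul_right, ha.1,
      mink_left_unitTangent ha hb]
    linarith [Real.cosh_pos s])
  exact ⟨h0, pos_of_mul_pos_right h.2 hr.le⟩

theorem mink_orthNormal_add (a b v : E) (s d : ℝ) : mink (orthNormal a b (s + d)) v =
    Real.cosh d * mink (orthNormal a b s) v + Real.sinh d * mink (geodesicPoint a b s) v := by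
  simp only [orthNormal_eq, geodesicPoint, mink_add_left, mink_smul_left, Real.sinh_add,
    Real.cosh_add]
  ring

theorem mink_orthNormal_neg_of_le (ha : a ∈ H3) (hb : b ∈ H3) (hab : a ≠ b) {v : E} (hv : v ∈ H3)
    {s t : ℝ} (hst : s ≤ t) (h : mink (orthNormal a b s) v < 0) :
    mink (orthNormal a b t) v < 0 := by
  have h1 := mink_orthNormal_add a b v s (t - s)
  rw [add_sub_cancel] at h1
  have h2 := mink_lt_zero (geodesicPoint_mem_H3 ha hb hab s) hv
  have h3 := mul_neg_of_pos_of_neg (Real.cosh_pos (t - s)) h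
  have h4 := mul_nonpos_of_nonneg_of_nonpos (Real.sinh_nonneg_iff.2 (sub_nonneg.2 hst)) h2.le
  linarith

end Geodesic

namespace ConvexPolyhedron

variable {X : ConvexPolyhedron}

/-- A slab of width `2 h` around a plane orthogonal to a diameter that contains no vertex. -/
theorem IsDiameter.isEmptySlab {a b : E} (D : X.IsDiameter a b) {s h : ℝ} (hs : 0 < s)
    (hsd : s < X.diam) (hh : 0 < h) (hV : X.VertexFree a b (s - h) (s + h)) :
    X.IsEmptySlab (geodesicPoint a b s) (orthNormal a b s) h := by
  have ha := D.1.1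
  have hb := D.2.1.1
  have hab := D.ne (hs.trans hsd)
  refine ⟨geodesicPoint_mem_H3 ha hb hab s, mink_orthNormal_self ha hb hab s,
    mink_geodesicPoint_orthNormal ha hb hab s, hh, ?_, ⟨b, D.right_mem_vertices, ?_⟩,
    ⟨a, D.left_mem_vertices, ?_⟩⟩
  · intro v hv
    have h1 := hV v hv
    rw [sub_eq_add_neg, mink_orthNormal_add, mink_orthNormal_add, Real.cosh_neg, Real.sinh_neg,
      not_and_or, not_lt, not_lt] at h1
    have hc := Real.cosh_pos h
    rcases h1 with h1 | h1
    · have := mul_le_mul_of_nonneg_left (neg_abs_le (mink (orthNormal a b s) v)) hc.le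
      linarith
    · have := mul_le_mul_of_nonneg_left (le_abs_self (mink (orthNormal a b s) v)) hc.le
      linarith
  · rw [mink_orthNormal_right ha hb hab, Real.sinh_pos_iff, D.2.2]
    linarith
  · rw [mink_orthNormal_left ha hb, neg_lt_zero]
    exact Real.sinh_pos_iff.2 hs

/-- Since the two endpoints of a diameter are vertices, one of the slabs between consecutive
division points contains none of the other vertices. -/
theorem IsDiameter.exists_vertexFree {a b : E} (D : X.IsDiameter a b) (hd : 0 < X.diam)
    {p : ℕ → ℝ} (hp : Monotone p) (h0 : 0 ≤ p 0) (h1 : p (#X.vertices - 1) ≤ X.diam) :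
    ∃ j, j + 1 < #X.vertices ∧ X.VertexFree a b (p j) (p (j + 1)) := by
  classical
  have ha := D.1.1
  have hb := D.2.1.1
  have hab := D.ne hd
  have hsub : ({a, b} : Finset E) ⊆ X.vertices := by
    intro v hv
    rcases mem_insert.1 hv with rfl | hv
    · exact D.left_mem_vertices
    · rw [mem_singleton.1 hv]; exact D.right_mem_vertices
  have hcard : #(X.vertices \ {a, b}) = #X.vertices - 2 := by
    rw [card_sdiff_of_subset hsub, card_pair hab]
  have h2 := card_le_card hsub
  rw [card_pair hab] at h2
  by_contra hcon
  push Not at hcon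
  simp only [VertexFree, not_forall, not_not] at hcon
  have hex : ∀ j : Fin (#X.vertices - 1), ∃ v ∈ X.vertices \ {a, b},
      0 < mink (orthNormal a b (p j)) v ∧ mink (orthNormal a b (p (j + 1))) v < 0 := by
    intro j
    obtain ⟨v, hv, h3, h4⟩ := hcon j (by omega)
    refine ⟨v, mem_sdiff.2 ⟨hv, ?_⟩, h3, h4⟩
    intro h5
    rcases mem_insert.1 h5 with rfl | h5
    · rw [mink_orthNormal_left ha hb] at h3
      have := Real.sinh_nonneg_iff.2 (h0.trans (hp (Nat.zero_le (j : ℕ))))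
      linarith
    · rw [mem_singleton.1 h5, mink_orthNormal_right ha hb hab, D.2.2] at h4
      have := Real.sinh_nonneg_iff.2 (sub_nonneg.2
        ((hp (show (j : ℕ) + 1 ≤ #X.vertices - 1 by omega)).trans h1))
      linarith
  choose f hf h3 h4 using hex
  have hlt : ∀ i j : Fin (#X.vertices - 1), i < j → f i ≠ f j := by
    intro i j hij h5
    have h6 := mink_orthNormal_neg_of_le ha hb hab (X.mem_H3 _ (mem_sdiff.1 (hf i)).1)
      (hp (show (i : ℕ) + 1 ≤ j from hij)) (h4 i)
    rw [h5] at h6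
    exact lt_asymm h6 (h3 j)
  have hinj : Function.Injective f := by
    intro i j h5
    rcases lt_trichotomy i j with h | h | h
    · exact absurd h5 (hlt i j h)
    · exact h
    · exact absurd h5.symm (hlt j i h)
  have h5 := card_le_card_of_injOn (s := univ) f (fun j _ => hf j) hinj.injOn
  rw [card_univ, Fintype.card_fin, hcard] at h5
  omega

end ConvexPolyhedron

/-! ### The choice of the lower bound for the diameter -/

theorem exp_div_four_le_sinh {x : ℝ} (hx : 1 ≤ x) : Real.exp x / 4 ≤ Real.sinh x := by
  rw [Real.sinh_eq]
  have h1 := Real.add_one_le_exp x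
  have h2 : Real.exp (-x) ≤ 1 := Real.exp_le_one_iff.2 (by linarith)
  linarith

open Filter in
theorem eventually_mul_inv_sinh_lt (C : ℝ) {ε α β : ℝ} (hε : 0 < ε) (hβ : 0 ≤ β) (hαβ : β < α) :
    ∀ᶠ x in atTop, C * (Real.sinh (α * x))⁻¹ < ε * Real.exp (-(β * x)) := by
  have hα : 0 < α := hβ.trans_lt hαβ
  have h1 : Tendsto (fun x : ℝ => Real.exp ((α - β) * x)) atTop atTop :=
    Real.tendsto_exp_atTop.comp (tendsto_id.const_mul_atTop (sub_pos.2 hαβ))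
  filter_upwards [h1.eventually_gt_atTop (4 * C / ε), eventually_ge_atTop α⁻¹] with x hx hx1
  have h2 : 1 ≤ α * x := by
    rw [inv_le_iff_one_le_mul₀ hα] at hx1
    linarith
  have h3 := exp_div_four_le_sinh h2
  have h4 : 0 < Real.sinh (α * x) := Real.sinh_pos_iff.2 (by linarith)
  rw [div_lt_iff₀ hε] at hx
  rw [← div_eq_mul_inv, div_lt_iff₀ h4]
  have h5 : Real.exp ((α - β) * x) = Real.exp (α * x) * Real.exp (-(β * x)) := by
    rw [← Real.exp_add]; ring_nf
  have h6 := mul_le_mul_of_nonneg_left h3 (mul_nonneg hε.le (Real.exp_pos (-(β * x))).le)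
  rw [h5] at hx
  linarith

end Hyp3

theorem mainTheorem7 (N : ℕ) :
    ∃ ρ₀ : ℝ, ∀ X : Hyp3.ConvexPolyhedron, X.vertices.card = N → ρ₀ ≤ X.diam →
      (∃ a b : Hyp3.E, X.IsDiameter a b) ∧
      ∀ a b : Hyp3.E, X.IsDiameter a b → ∀ p : ℕ → ℝ,
        (∀ j, p j = (j : ℝ) * (X.diam / ((N : ℝ) - 1))) →
        (∃ j : ℕ, j + 1 < N ∧ X.VertexFree a b (p j) (p (j + 1))) ∧
        ∀ j : ℕ, j + 1 < N → X.VertexFree a b (p j) (p (j + 1)) →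
          ∃ (k : ℕ) (F : Fin k → X.Face),
            Hyp3.ConvexPolyhedron.IsTransverseCycle F
              (Hyp3.orthNormal a b ((p j + p (j + 1)) / 2)) ∧
            ∑ i, Hyp3.ConvexPolyhedron.extDihedral (F i) (F (finRotate k i))
              < 2 * Real.pi + 12 * N * Real.exp (-X.diam / (2 * N)) ∧
            Hyp3.ConvexPolyhedron.IsCurveInGaussianImage F ∧
            Hyp3.ConvexPolyhedron.geodesicCurvature F
              ≤ 3 * k * Real.exp (-X.diam / N) ∧
            ∑ i, Hyp3.ConvexPolyhedron.edgeLineAngle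
                (F ((finRotate k).symm i)) (F i) (F (finRotate k i))
              ≤ 3 * k * Real.exp (-X.diam / N) := by
  have hNX : ∀ X : Hyp3.ConvexPolyhedron, 0 < X.diam → 2 ≤ X.vertices.card := by
    intro X hd
    obtain ⟨a, b, D⟩ := X.exists_isDiameter
    exact Finset.one_lt_card.2 ⟨a, D.left_mem_vertices, b, D.right_mem_vertices, D.ne hd⟩
  -- a polyhedron of positive diameter has at least two vertices
  rcases lt_or_ge N 2 with hN | hN
  · refine ⟨1, fun X hX hd => ?_⟩
    have := hNX X (by linarith)
    omega
  have hN' : (2 : ℝ) ≤ N := by exact_mod_cast hN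
  have hN1 : (0 : ℝ) < (N : ℝ) - 1 := by linarith
  have hα : 1 / (2 * (N : ℝ)) < 1 / (2 * ((N : ℝ) - 1)) :=
    one_div_lt_one_div_of_lt (by linarith) (by linarith)
  have hα' : 1 / (N : ℝ) < 1 / ((N : ℝ) - 1) := one_div_lt_one_div_of_lt (by linarith) (by linarith)
  -- the first two conditions are the bounds for at most `2 ^ N` dihedral angles and for a single
  -- corner; the last one makes the half-width of the slabs at least `2`
  obtain ⟨ρ₀, hρ₀⟩ := Filter.eventually_atTop.1
    (((Hyp3.eventually_mul_inv_sinh_lt (2 ^ N * 6) (by positivity : (0 : ℝ) < 12 * N)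
      (by positivity) hα).and (Hyp3.eventually_mul_inv_sinh_lt 2 (by norm_num : (0 : ℝ) < 3)
      (by positivity) hα')).and (Filter.eventually_ge_atTop (4 * ((N : ℝ) - 1))))
  refine ⟨ρ₀, fun X hX hρ => ⟨X.exists_isDiameter, fun a b D p hp => ?_⟩⟩
  obtain ⟨⟨hb1, hb2⟩, hb3⟩ := hρ₀ X.diam hρ
  have hd : 0 < X.diam := by linarith
  have hL : 0 < X.diam / ((N : ℝ) - 1) := div_pos hd hN1
  refine ⟨?_, fun j hj hV => ?_⟩
  · rw [← hX]
    refine D.exists_vertexFree hd ?_ ?_ ?_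
    · intro i j hij
      rw [hp, hp]
      exact mul_le_mul_of_nonneg_right (by exact_mod_cast hij) hL.le
    · rw [hp]; simp
    · rw [hp, hX, Nat.cast_sub (by omega), Nat.cast_one, mul_div_cancel₀ _ hN1.ne']
  have hs : (p j + p (j + 1)) / 2 = ((j : ℝ) + 1 / 2) * (X.diam / ((N : ℝ) - 1)) := by
    rw [hp, hp]; push_cast; ring
  -- the half-width of the slab
  obtain ⟨h, hh⟩ : ∃ h, h = 1 / (2 * ((N : ℝ) - 1)) * X.diam := ⟨_, rfl⟩
  have h2h : 2 * h = 1 / ((N : ℝ) - 1) * X.diam := by rw [hh]; field_simp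
  have hh2 : 2 ≤ h := by
    have : 4 * ((N : ℝ) - 1) / ((N : ℝ) - 1) ≤ X.diam / ((N : ℝ) - 1) :=
      div_le_div_of_nonneg_right hb3 hN1.le
    rw [mul_div_cancel_right₀ _ hN1.ne', div_eq_mul_one_div X.diam] at this
    linarith
  have S := D.isEmptySlab (s := (p j + p (j + 1)) / 2) (h := h) (by rw [hs]; positivity)
    (by
      have h1 : ((j : ℝ) + 1) + 1 ≤ N := by exact_mod_cast hj
      calc (p j + p (j + 1)) / 2 < ((N : ℝ) - 1) * (X.diam / ((N : ℝ) - 1)) := by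
            rw [hs]; exact mul_lt_mul_of_pos_right (by linarith) hL
        _ = X.diam := mul_div_cancel₀ _ hN1.ne') (by linarith)
    (by
      have h1 : (p j + p (j + 1)) / 2 - h = p j := by
        rw [hs, hp, hh]; field_simp; ring
      have h2 : (p j + p (j + 1)) / 2 + h = p (j + 1) := by
        rw [hs, hp, hh]; push_cast; field_simp; ring
      rw [h1, h2]
      exact hV)
  obtain ⟨k, F, hk, hT, hE, hC, hK, hA⟩ := S.exists_transverseCycle (by
    have := Real.self_le_sinh_iff.2 (by linarith : 0 ≤ h)
    nlinarith)
  have hk' : (k : ℝ) ≤ 2 ^ N := by rw [← hX]; exact_mod_cast hk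
  have e1 : -X.diam / (2 * N) = -(1 / (2 * (N : ℝ)) * X.diam) := by ring
  have e2 : -X.diam / N = -(1 / (N : ℝ) * X.diam) := by ring
  rw [← hh] at hb1
  rw [← h2h] at hb2
  have hK' : (k : ℝ) * (2 * (Real.sinh (2 * h))⁻¹) ≤ 3 * k * Real.exp (-X.diam / N) := by
    rw [e2, mul_comm 3 (k : ℝ), mul_assoc (k : ℝ)]
    exact mul_le_mul_of_nonneg_left hb2.le (Nat.cast_nonneg k)
  refine ⟨k, F, hT, ?_, hC, hK.trans hK', hA.trans hK'⟩
  have h1 : 0 < (Real.sinh h)⁻¹ := inv_pos.2 (Real.sinh_pos_iff.2 (by linarith))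
  have h2 := mul_le_mul_of_nonneg_right hk' (by linarith : 0 ≤ 6 * (Real.sinh h)⁻¹)
  rw [e1]
  linarith
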